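/- For a finite simple graph $G$ and $S\subseteq V(G)$ let $B(S)$ be the set of vertices outside $S$ adjacent to some vertex of $S$, let $B_{i,j}(G)$ be the number of $S\subseteq V(G)$ with $|B(S)|=i$, $|S|=j$, and let $B(G;x,y)=\sum_{S\subseteq V(G)}x^{|B(S)|}y^{|S|}$. For two graphs $G_1,G_2$ consider the planar system with real parameter $\alpha$ $$\frac{dx}{dt}=\alpha x-y+B(G_1;x,y)-1,\qquad \frac{dy}{dt}=x+\alpha y+B(G_2;x,y)-1, \qquad (\ast)$$ and put $$\sigma_B=\tfrac{3\pi}{2}\big(3B_{0,3}(G_2)+B_{1,2}(G_1)+B_{2,1}(G_2)+2B_{0,2}(G_1)B_{0,2}(G_2)+B_{1,1}(G_1)B_{0,2}(G_1)-B_{1,1}(G_2)B_{0,2}(G_2)\big).$$ The Liapunov number of the origin at $\alpha=0$ is the third derivative at $0$ of the displacement $d(s)=P(s)-s$, where $P$ is the Poincaré (first return) map on the positive $x$-axis; equivalently it is the $\sigma$ with $d(s)=\frac{\sigma}{3!}s^3+o(s^3)$ as $s\to0^+$. A stable (unstable) limit cycle is a periodic orbit that is asymptotically orbitally stable in forward (reversed)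 time. A supercritical (subcritical) Hopf bifurcation occurs at the origin at $\alpha=0$ if: * the Liapunov number at $\alpha=0$ is negative (positive); * for all $\alpha\ne0$ near $0$, the origin is asymptotically stable if $\alpha<0$, and asymptotically stable in reversed time if $\alpha>0$; * a unique stable (unstable) limit cycle bifurcates from the origin as $\alpha$ increases (decreases) from $0$: there are $\varepsilon>0$ and a neighbourhood $U$ of the origin such that for $0<\alpha<\varepsilon$ (for $-\varepsilon<\alpha<0$) $U$ contains exactly one periodic orbit, which is a stable (unstable) limit cycle and shrinks to the origin as $\alpha\to0$, while for all other $\alpha\in(-\varepsilon,\varepsilon)$ $U$ contains no periodic orbit. **Corollary.** Let $G_1$ be a connected graph of order at least $3$ without vertices of degree $1$, such that no two distinct vertices $u,v$ have exactly one vertex outside $\{u,v\}$ adjacent to $u$ or $v$ (i.e. $B_{1,2}(G_1)=0$). 1. If $G_2$ is connected, has order at least $3$ and has a vertex of degree $2$, then $\sigma_B$ is the Liapunov number of $(\ast)$ at the origin for $\alpha=0$, $\sigma_B>0$, and $(\ast)$ has a subcritical Hopf bifurcation at the origin at $\alpha=0$. 2. If $G_2$ is a finite graph without isolated vertices that has at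 least one component isomorphic to $P_2$ (the path on two vertices), no component isomorphic to the path $P_3$ or the cycle $C_3$ on three vertices, no vertex of degree $2$, and at least one vertex of degree $1$, then $\sigma_B$ is the Liapunov number of $(\ast)$ at the origin for $\alpha=0$, $\sigma_B<0$, and $(\ast)$ has a supercritical Hopf bifurcation at the origin at $\alpha=0$. -/

import Mathlib

open Filter Topology Asymptotics Set

/-- The boundary `B(S)` of a set of vertices `S`: the vertices outside `S` that are adjacent to
some vertex of `S`. -/
noncomputable def SimpleGraph.setBoundary {V : Type*} [Fintype V] (G : SimpleGraph V)
    (S : Finset V) : Finset V :=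
  open Classical in Finset.univ.filter fun w => w ∉ S ∧ ∃ v ∈ S, G.Adj v w

/-- The coefficient `B_{i,j}(G)`: the number of sets of vertices `S` with `|B(S)| = i` and
`|S| = j`. -/
noncomputable def SimpleGraph.boundaryCoeff {V : Type*} [Fintype V] (G : SimpleGraph V)
    (i j : ℕ) : ℕ :=
  (Finset.univ.filter fun S : Finset V => (G.setBoundary S).card = i ∧ S.card = j).card

/-- The boundary polynomial `B(G; x, y) = ∑_S x^{|B(S)|} y^{|S|}`, as a function of two real
variables. -/
noncomputable def SimpleGraph.boundaryPoly {V : Type*} [Fintype V] (G : SimpleGraph V)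
    (x y : ℝ) : ℝ :=
  ∑ S : Finset V, x ^ (G.setBoundary S).card * y ^ S.card

namespace BoundaryHopf

/-- The planar vector field of the system
`x' = α x - y + B(G₁; x, y) - 1`, `y' = x + α y + B(G₂; x, y) - 1`. -/
noncomputable def field {V₁ V₂ : Type*} [Fintype V₁] [Fintype V₂]
    (G₁ : SimpleGraph V₁) (G₂ : SimpleGraph V₂) (α : ℝ) (p : ℝ × ℝ) : ℝ × ℝ :=
  (α * p.1 - p.2 + G₁.boundaryPoly p.1 p.2 - 1, p.1 + α * p.2 + G₂.boundaryPoly p.1 p.2 - 1)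

/-- The number `σ_B` in terms of the coefficients of the boundary polynomials. -/
noncomputable def sigmaB {V₁ V₂ : Type*} [Fintype V₁] [Fintype V₂]
    (G₁ : SimpleGraph V₁) (G₂ : SimpleGraph V₂) : ℝ :=
  3 * Real.pi / 2 *
    (3 * (G₂.boundaryCoeff 0 3 : ℝ) + (G₁.boundaryCoeff 1 2 : ℝ) + (G₂.boundaryCoeff 2 1 : ℝ)
      + 2 * (G₁.boundaryCoeff 0 2 : ℝ) * (G₂.boundaryCoeff 0 2 : ℝ)
      + (G₁.boundaryCoeff 1 1 : ℝ) * (G₁.boundaryCoeff 0 2 : ℝ)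
      - (G₂.boundaryCoeff 1 1 : ℝ) * (G₂.boundaryCoeff 0 2 : ℝ))

/-- The trajectory of `p' = F p` starting at `(s, 0)` meets the positive `x`-axis again, for the
first time, at `(r, 0)`. -/
def FirstReturn (F : ℝ × ℝ → ℝ × ℝ) (s r : ℝ) : Prop :=
  ∃ (T : ℝ) (γ : ℝ → ℝ × ℝ), 0 < T ∧ IsIntegralCurveOn γ (fun _ => F) (Icc 0 T) ∧
    γ 0 = (s, 0) ∧ γ T = (r, 0) ∧ 0 < r ∧
    ∀ t ∈ Ioo 0 T, ¬ (0 < (γ t).1 ∧ (γ t).2 = 0)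

/-- `σ` is the Liapunov number of the weak focus of `p' = F p` at the origin, i.e. the third
derivative `d'''(0)` of the displacement `d(s) = P(s) - s` of the Poincaré map `P` on the positive
`x`-axis. The displacement vanishes to second order at a weak focus, so this says
`d(s) = (σ / 3!) s³ + o(s³)` as `s → 0+`. -/
def IsLiapunovNumber (F : ℝ × ℝ → ℝ × ℝ) (σ : ℝ) : Prop :=
  ∃ P : ℝ → ℝ, (∀ᶠ s in 𝓝[>] 0, FirstReturn F s (P s)) ∧
    (fun s => P s - s - σ / (Nat.factorial 3 : ℝ) * s ^ 3) =o[𝓝[>] 0] fun s => s ^ 3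

/-- `Γ` is a periodic orbit (cycle) of `p' = F p`: the range of a non-constant periodic
solution. -/
def IsPeriodicOrbit (F : ℝ × ℝ → ℝ × ℝ) (Γ : Set (ℝ × ℝ)) : Prop :=
  ∃ (γ : ℝ → ℝ × ℝ) (T : ℝ), IsIntegralCurve γ (fun _ => F) ∧ 0 < T ∧ Function.Periodic γ T ∧
    (∃ t, γ t ≠ γ 0) ∧ Γ = range γ

/-- The nonempty compact invariant set `K` is asymptotically stable for `p' = F p`: every
neighbourhood `U` of `K` contains the forward trajectories of all points of some neighbourhood `W`
of `K`, and these trajectories converge to `K`. -/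
def AsymptoticallyStable (F : ℝ × ℝ → ℝ × ℝ) (K : Set (ℝ × ℝ)) : Prop :=
  ∀ U, IsOpen U → K ⊆ U → ∃ W, IsOpen W ∧ K ⊆ W ∧ ∀ p ∈ W, ∃ γ : ℝ → ℝ × ℝ,
    γ 0 = p ∧ IsIntegralCurveOn γ (fun _ => F) (Ici 0) ∧ (∀ t, 0 ≤ t → γ t ∈ U) ∧
      Tendsto (fun t => Metric.infDist (γ t) K) atTop (𝓝 0)

/-- A stable limit cycle: all trajectories near `Γ` spiral towards `Γ` as `t → ∞`. -/
def IsStableLimitCycle (F : ℝ × ℝ → ℝ × ℝ) (Γ : Set (ℝ × ℝ)) : Prop :=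
  IsPeriodicOrbit F Γ ∧ AsymptoticallyStable F Γ

/-- An unstable limit cycle: all trajectories near `Γ` spiral towards `Γ` as `t → -∞`, i.e. `Γ` is
asymptotically stable in reversed time. -/
def IsUnstableLimitCycle (F : ℝ × ℝ → ℝ × ℝ) (Γ : Set (ℝ × ℝ)) : Prop :=
  IsPeriodicOrbit F Γ ∧ AsymptoticallyStable (fun p => -F p) Γ

/-- A unique periodic orbit of `p' = F α p` bifurcates from the origin at `α = 0`, on the side
`α ∈ J` (with `J = Ioi 0` or `J = Iio 0`), and it is a limit cycle in the sense of `IsCycle`: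
in a fixed neighbourhood `U` of the origin, for all small `α`, there is exactly one periodic orbit
`Γ α` if `α ∈ J`, and none if `α ∉ J` (in particular for `α = 0`); `Γ α` shrinks to the origin as
`α → 0`. -/
def UniqueCycleBifurcates (F : ℝ → ℝ × ℝ → ℝ × ℝ) (J : Set ℝ)
    (IsCycle : (ℝ × ℝ → ℝ × ℝ) → Set (ℝ × ℝ) → Prop) : Prop :=
  ∃ (ε : ℝ) (U : Set (ℝ × ℝ)) (Γ : ℝ → Set (ℝ × ℝ)), 0 < ε ∧ IsOpen U ∧ 0 ∈ U ∧
    (∀ α ∈ Ioo (-ε) ε, α ∈ J → Γ α ⊆ U ∧ IsCycle (F α) (Γ α) ∧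
      ∀ Γ' ⊆ U, IsPeriodicOrbit (F α) Γ' → Γ' = Γ α) ∧
    (∀ α ∈ Ioo (-ε) ε, α ∉ J → ∀ Γ' ⊆ U, ¬ IsPeriodicOrbit (F α) Γ') ∧
    ∀ W ∈ 𝓝 (0 : ℝ × ℝ), ∀ᶠ α in 𝓝[J] 0, Γ α ⊆ W

/-- As `α` increases through `0` the equilibrium at the origin changes from asymptotically stable
to repelling (asymptotically stable in reversed time). -/
def LosesStability (F : ℝ → ℝ × ℝ → ℝ × ℝ) : Prop :=
  (∀ᶠ α in 𝓝[<] 0, AsymptoticallyStable (F α) {0}) ∧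
    ∀ᶠ α in 𝓝[>] 0, AsymptoticallyStable (fun p => -F α p) {0}

/-- Supercritical Hopf bifurcation at the origin at `α = 0`: the Liapunov number at `α = 0` is
negative, and a unique stable limit cycle bifurcates from the origin as `α` increases from `0`. -/
def SupercriticalHopf (F : ℝ → ℝ × ℝ → ℝ × ℝ) : Prop :=
  (∃ σ < 0, IsLiapunovNumber (F 0) σ) ∧ LosesStability F ∧
    UniqueCycleBifurcates F (Ioi 0) IsStableLimitCycle

/-- Subcritical Hopf bifurcation at the origin at `α = 0`: the Liapunov number at `α = 0` is
positive, and a unique unstable limit cycle bifurcates from the origin as `α` decreases from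
`0`. -/
def SubcriticalHopf (F : ℝ → ℝ × ℝ → ℝ × ℝ) : Prop :=
  (∃ σ > 0, IsLiapunovNumber (F 0) σ) ∧ LosesStability F ∧
    UniqueCycleBifurcates F (Iio 0) IsUnstableLimitCycle

end BoundaryHopf

/-! The graphs enter only through the Taylor coefficients of degree at most three; the rest is a
quantitative Hopf theorem for planar families with linear part `α` times the identity plus a
rotation. A connected graph of order at least 3 has no set of one or two vertices with empty
boundary, so the hypotheses on `G₁` leave only `x²y` and `y³` among the nonlinear terms of degree at
most three in the first equation, and no new linear terms appear in either one.

In polar coordinates `r' = r (α + r A)`, `θ' = 1 + r C`. Averaging yields `2π`-periodic functions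
`u`, `v` such that `V = r² (1 + r u + r² v)` satisfies, per unit of angle, `(log V)' = α (2 + O(r))
+ η r² + O(r³)`, where `4 η = B₂₁(G₂) + 3 B₀₃(G₂) - B₁₁(G₂) B₀₂(G₂)` and `σ_B = 6 π η`
(`Jet.nonempty_polarForm`, `sigmaB_eq`). In the first case `B₀₂(G₂) = 0` and a vertex of degree 2
gives `η > 0`. In the second, `B₂₁(G₂) = 0`; also `B₀₃(G₂) = 0`, since a closed triple would carry a
graph with three vertices of degree 1; a leaf and a component `P₂` then make `η < 0`.

Everything else is read off from `w = log V`. At `α = 0`, integration over one turn gives `2 log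
(P(s) / s) ≈ 2 π η s²`, hence `d(s) ≈ π η s³` (`PolarForm.isLiapunovNumber`). Let `η < 0`. For `α ≤
0`, `w` strictly decreases along orbits, so there are no cycles. For `α > 0` let `m` be the radius
with `2 α + η m² = 0`: `w` increases well inside it and decreases well outside it, which gives a
trapping annulus, and the monotone return map has a fixed point there. On the annulus `dw/dθ` is
strictly decreasing in `r`, so the squared difference of `w` on two orbits at equal angle decays
exponentially (`Scale.contraction`); this gives both uniqueness and stability of the cycle. The case
`η > 0` follows from the symmetry `(x, y, t, α) ↦ (x, -y, -t, -α)`, which negates `η`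
(`UniqueCycleBifurcates.of_reverse`). -/

namespace BoundaryHopf

/-! ### Scalar equations: global existence, uniqueness, comparison -/

section ScalarODE

open scoped NNReal

variable {v : ℝ → ℝ → ℝ} {K L : ℝ≥0}

/-- A bounded vector field that is Lipschitz in space has global solutions. -/
theorem exists_global_solution (hv : ∀ t, LipschitzWith K (v t)) (hc : ∀ x, Continuous fun t => v t x)
    (hb : ∀ t x, |v t x| ≤ L) (t₀ x₀ : ℝ) :
    ∃ γ : ℝ → ℝ, γ t₀ = x₀ ∧ ∀ t, HasDerivAt γ (v t (γ t)) t := by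
  have local_sol : ∀ n : ℕ, ∃ γ : ℝ → ℝ, γ t₀ = x₀ ∧
      ∀ t ∈ Ioo (t₀ - (n + 1)) (t₀ + (n + 1)), HasDerivAt γ (v t (γ t)) t := by
    intro n
    have h0 : t₀ ∈ Icc (t₀ - ((n : ℝ) + 1)) (t₀ + (n + 1)) := by
      constructor <;> linarith [(Nat.cast_nonneg n : (0 : ℝ) ≤ n)]
    -- The radius `L (n + 1)` is the distance that a solution of speed at most `L` can cover in time
    -- `n + 1`, so no shrinking of the time interval is needed.
    have hpl : IsPicardLindelof v (⟨t₀, h0⟩ : Icc (t₀ - ((n : ℝ) + 1)) (t₀ + (n + 1))) x₀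
        (L * (n + 1)) 0 L K :=
      { lipschitzOnWith := fun t _ => (hv t).lipschitzOnWith
        continuousOn := fun x _ => (hc x).continuousOn
        norm_le := fun t _ x _ => by simpa using hb t x
        mul_max_le := by simp }
    obtain ⟨γ, h1, h2⟩ := hpl.exists_eq_forall_mem_Icc_hasDerivWithinAt₀
    exact ⟨γ, h1, fun t ht => (h2 t (Ioo_subset_Icc_self ht)).hasDerivAt (Icc_mem_nhds ht.1 ht.2)⟩
  choose γ h0 hγ using local_sol
  have agree : ∀ m n : ℕ, m ≤ n → ∀ t ∈ Ioo (t₀ - ((m : ℝ) + 1)) (t₀ + (m + 1)), γ m t = γ n t := by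
    intro m n hmn t ht
    have hmn' : (m : ℝ) ≤ n := by exact_mod_cast hmn
    refine ODE_solution_unique_of_mem_Ioo (v := v) (K := K) (s := fun _ => univ) (t₀ := t₀)
      (fun t _ => (hv t).lipschitzOnWith) ?_ (fun t ht => ⟨hγ m t ht, trivial⟩)
      (fun t ht => ⟨hγ n t ⟨by linarith [ht.1], by linarith [ht.2]⟩, trivial⟩)
      (by rw [h0, h0]) ht
    constructor <;> linarith [(Nat.cast_nonneg m : (0 : ℝ) ≤ m)]
  refine ⟨fun t => γ ⌈|t - t₀|⌉₊ t, h0 _, fun t => ?_⟩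
  have hmem : ∀ s : ℝ, s ∈ Ioo (t₀ - ((⌈|s - t₀|⌉₊ : ℝ) + 1)) (t₀ + (⌈|s - t₀|⌉₊ + 1)) := by
    intro s
    have := Nat.le_ceil |s - t₀|
    constructor <;> linarith [neg_abs_le (s - t₀), le_abs_self (s - t₀)]
  set n := ⌈|t - t₀|⌉₊ with hn
  have hev : (fun s => γ ⌈|s - t₀|⌉₊ s) =ᶠ[𝓝 t] γ n := by
    filter_upwards [isOpen_Ioo.mem_nhds (hmem t)] with s hs
    rcases le_total ⌈|s - t₀|⌉₊ n with h | h
    · exact agree _ _ h s (hmem s)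
    · exact (agree _ _ h s hs).symm
  exact (hγ n t (hmem t)).congr_of_eventuallyEq hev

theorem solution_eq_of_eq (hv : ∀ t, LipschitzWith K (v t)) {γ δ : ℝ → ℝ}
    (hγ : ∀ t, HasDerivAt γ (v t (γ t)) t) (hδ : ∀ t, HasDerivAt δ (v t (δ t)) t) {t₀ : ℝ}
    (h : γ t₀ = δ t₀) : γ = δ :=
  ODE_solution_unique_univ (s := fun _ => univ) (fun t => (hv t).lipschitzOnWith)
    (fun t => ⟨hγ t, trivial⟩) (fun t => ⟨hδ t, trivial⟩) h

/-- Solutions of a scalar equation do not cross. -/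
theorem solution_lt_of_lt (hv : ∀ t, LipschitzWith K (v t)) {γ δ : ℝ → ℝ}
    (hγ : ∀ t, HasDerivAt γ (v t (γ t)) t) (hδ : ∀ t, HasDerivAt δ (v t (δ t)) t) {t₀ : ℝ}
    (h : γ t₀ < δ t₀) (t : ℝ) : γ t < δ t := by
  by_contra! hle
  have hc : Continuous fun s => δ s - γ s :=
    (continuous_iff_continuousAt.2 fun s => (hδ s).continuousAt).sub
      (continuous_iff_continuousAt.2 fun s => (hγ s).continuousAt)
  obtain ⟨s, hs⟩ : (0 : ℝ) ∈ range fun s => δ s - γ s :=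
    mem_range_of_exists_le_of_exists_ge hc ⟨t, by linarith⟩ ⟨t₀, by linarith⟩
  have := solution_eq_of_eq hv hγ hδ (t₀ := s) (by simp only at hs; linarith)
  rw [this] at h
  exact lt_irrefl _ h

theorem solution_le_of_le (hv : ∀ t, LipschitzWith K (v t)) {γ δ : ℝ → ℝ}
    (hγ : ∀ t, HasDerivAt γ (v t (γ t)) t) (hδ : ∀ t, HasDerivAt δ (v t (δ t)) t) {t₀ : ℝ}
    (h : γ t₀ ≤ δ t₀) (t : ℝ) : γ t ≤ δ t := by
  rcases h.lt_or_eq with h | h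
  · exact (solution_lt_of_lt hv hγ hδ h t).le
  · rw [solution_eq_of_eq hv hγ hδ h]

end ScalarODE

/-! ### Differential inequalities, separation of variables, barriers -/

section Calculus

/-- `f' ≤ -κ f` implies exponential decay. -/
theorem le_exp_mul_of_deriv_le {f f' : ℝ → ℝ} {a κ : ℝ} (hf : ∀ t, a ≤ t → HasDerivAt f (f' t) t)
    (h : ∀ t, a ≤ t → f' t ≤ -κ * f t) (t : ℝ) (ht : a ≤ t) :
    f t ≤ f a * Real.exp (-κ * (t - a)) := by
  have hd : ∀ t, a ≤ t → HasDerivAt (fun t => f t * Real.exp (κ * (t - a)))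
      (f' t * Real.exp (κ * (t - a)) + f t * (Real.exp (κ * (t - a)) * κ)) t := by
    intro t ht
    have h1 : HasDerivAt (fun t => κ * (t - a)) κ t := by
      simpa using ((hasDerivAt_id t).sub_const a).const_mul κ
    exact (hf t ht).mul h1.exp
  have hanti : AntitoneOn (fun t => f t * Real.exp (κ * (t - a))) (Ici a) := by
    refine antitoneOn_of_deriv_nonpos (convex_Ici a)
      (fun s hs => (hd s hs).continuousAt.continuousWithinAt)
      (fun s hs => (hd s (interior_subset hs)).differentiableAt.differentiableWithinAt) ?_
    intro s hs
    have hs' : a ≤ s := interior_subset hs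
    rw [(hd s hs').deriv]
    have := mul_nonneg (sub_nonneg.2 (h s hs')) (Real.exp_pos (κ * (s - a))).le
    nlinarith
  have := hanti (mem_Ici.2 le_rfl) (mem_Ici.2 ht) ht
  simp only [sub_self, mul_zero, Real.exp_zero, mul_one] at this
  calc f t = f t * Real.exp (κ * (t - a)) * Real.exp (-κ * (t - a)) := by
        rw [mul_assoc, ← Real.exp_add]; simp
    _ ≤ f a * Real.exp (-κ * (t - a)) := by gcongr

/-- A differentiable periodic function with nonpositive derivative has zero derivative. -/
theorem deriv_eq_zero_of_periodic_of_nonpos {f f' : ℝ → ℝ} {T : ℝ} (hT : 0 < T)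
    (hf : ∀ t, HasDerivAt f (f' t) t) (hp : Function.Periodic f T) (h : ∀ t, f' t ≤ 0) (t : ℝ) :
    f' t = 0 := by
  have hanti : Antitone f := antitone_of_deriv_nonpos (fun t => (hf t).differentiableAt)
    fun t => by rw [(hf t).deriv]; exact h t
  -- Moving `x` to the right of `y` by whole periods does not change `f x`, so an antitone periodic
  -- function is constant.
  have hconst : ∀ x y, f x ≤ f y := by
    intro x y
    obtain ⟨n, hn⟩ := exists_nat_ge ((y - x) / T)
    have h1 : y ≤ x + n * T := by rw [div_le_iff₀ hT] at hn; linarith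
    calc f x = f (x + n * T) := ((hp.nat_mul n) x).symm
      _ ≤ f y := hanti h1
  have : f = fun _ => f t := funext fun x => le_antisymm (hconst _ _) (hconst _ _)
  have h2 := hf t
  rw [this] at h2
  exact h2.unique (hasDerivAt_const _ _)

theorem le_of_deriv_ge {f f' : ℝ → ℝ} {c : ℝ} (hf : ∀ t, HasDerivAt f (f' t) t)
    (h : ∀ t, c ≤ f' t) {s t : ℝ} (hst : s ≤ t) : f s + c * (t - s) ≤ f t := by
  have hm : Monotone fun t => f t - c * t := by
    have hd : ∀ t, HasDerivAt (fun t => f t - c * t) (f' t - c) t := fun t => by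
      have h1 : HasDerivAt (fun t => c * t) c t := by simpa using (hasDerivAt_id t).const_mul c
      exact (hf t).sub h1
    refine monotone_of_deriv_nonneg (fun t => (hd t).differentiableAt) fun t => ?_
    rw [(hd t).deriv]
    linarith [h t]
  have := hm hst
  simp only at this
  linarith

theorem tendsto_atTop_of_deriv_ge {f f' : ℝ → ℝ} {c : ℝ} (hc : 0 < c)
    (hf : ∀ t, HasDerivAt f (f' t) t) (h : ∀ t, c ≤ f' t) : Tendsto f atTop atTop := by
  refine tendsto_atTop_mono' atTop ?_
    (tendsto_atTop_add_const_left atTop (f 0) (tendsto_id.const_mul_atTop hc))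
  filter_upwards [eventually_ge_atTop (0 : ℝ)] with t ht
  have := le_of_deriv_ge hf h ht
  simpa using this

theorem tendsto_atBot_of_deriv_ge {f f' : ℝ → ℝ} {c : ℝ} (hc : 0 < c)
    (hf : ∀ t, HasDerivAt f (f' t) t) (h : ∀ t, c ≤ f' t) : Tendsto f atBot atBot := by
  refine tendsto_atBot_mono' atBot ?_
    (tendsto_atBot_add_const_left atBot (f 0) (tendsto_id.const_mul_atBot hc))
  filter_upwards [eventually_le_atBot (0 : ℝ)] with t ht
  have := le_of_deriv_ge hf h ht
  simp only [id]
  linarith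

theorem strictMono_of_deriv_ge {f f' : ℝ → ℝ} {c : ℝ} (hc : 0 < c)
    (hf : ∀ t, HasDerivAt f (f' t) t) (h : ∀ t, c ≤ f' t) : StrictMono f :=
  strictMono_of_deriv_pos fun t => by rw [(hf t).deriv]; exact hc.trans_le (h t)

theorem surjective_of_deriv_ge {f f' : ℝ → ℝ} {c : ℝ} (hc : 0 < c)
    (hf : ∀ t, HasDerivAt f (f' t) t) (h : ∀ t, c ≤ f' t) : Function.Surjective f :=
  (continuous_iff_continuousAt.2 fun t => (hf t).continuousAt).surjective
    (tendsto_atTop_of_deriv_ge hc hf h) (tendsto_atBot_of_deriv_ge hc hf h)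

/-- Separation of variables: `Θ' = ω(Θ)` is solvable for continuous `ω` with
`0 < c ≤ ω ≤ C`. -/
theorem exists_solution_autonomous {ω : ℝ → ℝ} (hω : Continuous ω) {c C : ℝ} (hc : 0 < c)
    (h1 : ∀ θ, c ≤ ω θ) (h2 : ∀ θ, ω θ ≤ C) (θ₀ : ℝ) :
    ∃ Θ : ℝ → ℝ, Θ 0 = θ₀ ∧ ∀ t, HasDerivAt Θ (ω (Θ t)) t := by
  have hpos : ∀ θ, 0 < ω θ := fun θ => hc.trans_le (h1 θ)
  have hC : 0 < C := (hpos 0).trans_le (h2 0)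
  have hcont : Continuous fun θ => (ω θ)⁻¹ := hω.inv₀ fun θ => (hpos θ).ne'
  -- `τ θ` is the time needed to travel from `θ₀` to `θ`; the solution is its inverse, global
  -- because `1 / ω` is bounded below.
  set τ : ℝ → ℝ := fun θ => ∫ x in θ₀..θ, (ω x)⁻¹ with hτ
  have hd : ∀ θ, HasDerivAt τ (ω θ)⁻¹ θ := fun θ => hcont.integral_hasStrictDerivAt θ₀ θ |>.hasDerivAt
  have hge : ∀ θ, C⁻¹ ≤ (ω θ)⁻¹ := fun θ => inv_anti₀ (hpos θ) (h2 θ)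
  have hC' : 0 < C⁻¹ := inv_pos.2 hC
  let e := (strictMono_of_deriv_ge hC' hd hge).orderIsoOfSurjective τ
    (surjective_of_deriv_ge hC' hd hge)
  have he : ∀ t, τ (e.symm t) = t := fun t => e.apply_symm_apply t
  refine ⟨e.symm, ?_, fun t => ?_⟩
  · rw [OrderIso.symm_apply_eq]
    change 0 = τ θ₀
    simp [hτ]
  · have := HasDerivAt.of_local_left_inverse (f := τ) (g := e.symm) (a := t)
      e.symm.continuous.continuousAt (hd _) (inv_pos.2 (hpos _)).ne' (Eventually.of_forall he)
    rwa [inv_inv] at this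

/-- Since `ω` is merely continuous, Lipschitz uniqueness does not apply. Instead the travel time `τ`
grows at rate 1 along every solution, and `τ` is injective. -/
theorem solution_autonomous_unique {ω : ℝ → ℝ} (hω : Continuous ω) (hpos : ∀ θ, 0 < ω θ)
    {Θ Φ : ℝ → ℝ} (hΘ : ∀ t, HasDerivAt Θ (ω (Θ t)) t) (hΦ : ∀ t, HasDerivAt Φ (ω (Φ t)) t)
    (h0 : Θ 0 = Φ 0) : Θ = Φ := by
  have hcont : Continuous fun θ => (ω θ)⁻¹ := hω.inv₀ fun θ => (hpos θ).ne'
  set τ : ℝ → ℝ := fun θ => ∫ x in (0 : ℝ)..θ, (ω x)⁻¹ with hτ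
  have hd : ∀ θ, HasDerivAt τ (ω θ)⁻¹ θ := fun θ =>
    (hcont.integral_hasStrictDerivAt 0 θ).hasDerivAt
  have hinj : Function.Injective τ :=
    (strictMono_of_deriv_pos fun θ => by rw [(hd θ).deriv]; exact inv_pos.2 (hpos θ)).injective
  have hdiff : ∀ t, HasDerivAt (fun t => τ (Θ t) - τ (Φ t)) 0 t := fun t =>
    (((hd _).comp t (hΘ t)).sub ((hd _).comp t (hΦ t))).congr_deriv (by
      rw [inv_mul_cancel₀ (hpos _).ne', inv_mul_cancel₀ (hpos _).ne', sub_self])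
  funext t
  apply hinj
  have := is_const_of_deriv_eq_zero (fun t => (hdiff t).differentiableAt)
    (fun t => (hdiff t).deriv) t 0
  simp only [h0, sub_self] at this
  linarith

/-- A function whose derivative exists and is negative wherever it meets the level `B` cannot leave
the sublevel set. -/
theorem le_of_deriv_neg_at_level {f : ℝ → ℝ} {a B : ℝ} (hf : Continuous f)
    (ha : f a ≤ B) (hB : ∀ t, a ≤ t → f t = B → ∃ d < 0, HasDerivAt f d t) :
    ∀ t, a ≤ t → f t ≤ B := by
  intro t₁ ht₁
  by_contra! hlt
  -- At the last time before `t₁` in the sublevel set, `f` equals `B` and exceeds `B` just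
  -- afterwards, against the negative derivative there.
  set S : Set ℝ := {t | t ∈ Icc a t₁ ∧ f t ≤ B} with hS
  have hne : S.Nonempty := ⟨a, ⟨le_rfl, ht₁⟩, ha⟩
  have hcl : IsClosed S := isClosed_Icc.inter (isClosed_le hf continuous_const)
  have hbd : BddAbove S := ⟨t₁, fun t ht => ht.1.2⟩
  obtain ⟨⟨hs1, hs2⟩, hs3⟩ := hcl.csSup_mem hne hbd
  set s := sSup S with hs
  have hst : s < t₁ := hs2.lt_of_ne fun h => by rw [h] at hs3; linarith
  have hgt : ∀ t ∈ Ioc s t₁, B < f t := by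
    intro t ht
    by_contra! h
    exact absurd (le_csSup hbd (show t ∈ S from ⟨⟨hs1.trans ht.1.le, ht.2⟩, h⟩)) (not_le.2 ht.1)
  have hev : ∀ᶠ t in 𝓝[>] s, B < f t := by
    filter_upwards [Ioc_mem_nhdsGT hst] with t ht using hgt t ht
  have hge : B ≤ f s := ge_of_tendsto (hf.continuousAt.tendsto.mono_left nhdsWithin_le_nhds)
    (hev.mono fun t ht => ht.le)
  obtain ⟨d, hd, hder⟩ := hB s hs1 (le_antisymm hs3 hge)
  have hslope := (hasDerivAt_iff_tendsto_slope.1 hder).mono_left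
    (nhdsWithin_mono s fun t (ht : t ∈ Ioi s) => ne_of_gt ht)
  have hneg := hslope.eventually (gt_mem_nhds hd)
  obtain ⟨t, ht1, ht2, ht3⟩ := (hneg.and (hev.and self_mem_nhdsWithin)).exists
  rw [slope_def_field, div_neg_iff] at ht1
  have : s < t := ht3
  rcases ht1 with h | h <;> linarith

theorem ge_of_deriv_pos_at_level {f : ℝ → ℝ} {a B : ℝ} (hf : Continuous f)
    (ha : B ≤ f a) (hB : ∀ t, a ≤ t → f t = B → ∃ d > 0, HasDerivAt f d t) :
    ∀ t, a ≤ t → B ≤ f t := by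
  intro t ht
  have := le_of_deriv_neg_at_level (f := fun t => -f t) (B := -B) hf.neg (by linarith)
    (fun t ht h => by
      obtain ⟨d, hd, h'⟩ := hB t ht (by linarith)
      exact ⟨-d, by linarith, h'.neg⟩) t ht
  linarith

end Calculus

end BoundaryHopf

/-! ### Uniformly Lipschitz functions of polar coordinates; the polar normal form -/

namespace BoundaryHopf

/-- Functions of polar coordinates that on `0 ≤ r ≤ ρ` are bounded and Lipschitz in `r`, uniformly
in `θ`, and continuous and `2π`-periodic in `θ`. -/
structure TameOn (ρ M : ℝ) (f : ℝ → ℝ → ℝ) : Prop where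
  nonneg : 0 ≤ M
  continuous : ∀ r ∈ Icc 0 ρ, Continuous (f r)
  bound : ∀ r ∈ Icc 0 ρ, ∀ θ, |f r θ| ≤ M
  lipschitz : ∀ r ∈ Icc 0 ρ, ∀ r' ∈ Icc 0 ρ, ∀ θ, |f r θ - f r' θ| ≤ M * |r - r'|
  periodic : ∀ r ∈ Icc 0 ρ, Function.Periodic (f r) (2 * Real.pi)

/-- `TameOn` with an unspecified constant. -/
def Tame (ρ : ℝ) (f : ℝ → ℝ → ℝ) : Prop := ∃ M, TameOn ρ M f

namespace TameOn

variable {ρ ρ' M M' : ℝ} {f g : ℝ → ℝ → ℝ}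

theorem mono (h : TameOn ρ M f) (hM : M ≤ M') (hρ : ρ' ≤ ρ) : TameOn ρ' M' f where
  nonneg := h.nonneg.trans hM
  continuous r hr := h.continuous r ⟨hr.1, hr.2.trans hρ⟩
  bound r hr θ := (h.bound r ⟨hr.1, hr.2.trans hρ⟩ θ).trans hM
  lipschitz r hr r' hr' θ := (h.lipschitz r ⟨hr.1, hr.2.trans hρ⟩ r' ⟨hr'.1, hr'.2.trans hρ⟩ θ).trans
    (mul_le_mul_of_nonneg_right hM (abs_nonneg _))
  periodic r hr := h.periodic r ⟨hr.1, hr.2.trans hρ⟩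

/-- Continuity in `θ` for fixed `r`, together with a Lipschitz bound in `r` uniform in `θ`, amounts
to joint continuity. -/
theorem continuous_comp (h : TameOn ρ M f) {R : ℝ → ℝ} (hR : Continuous R)
    (hmem : ∀ θ, R θ ∈ Icc 0 ρ) : Continuous fun θ => f (R θ) θ := by
  rw [continuous_iff_continuousAt]
  intro θ
  rw [Metric.continuousAt_iff']
  intro ε hε
  have h1 := Metric.continuousAt_iff'.1 ((h.continuous (R θ) (hmem θ)).continuousAt (x := θ))
    (ε / 2) (half_pos hε)
  have hpos : 0 < ε / (2 * (M + 1)) := by have := h.nonneg; positivity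
  have h2 := Metric.continuousAt_iff'.1 (hR.continuousAt (x := θ)) _ hpos
  filter_upwards [h1, h2] with x hx1 hx2
  have h3 := h.lipschitz (R x) (hmem x) (R θ) (hmem θ) x
  rw [Real.dist_eq] at *
  have hM := h.nonneg
  have h4 : M * |R x - R θ| ≤ (M + 1) * |R x - R θ| := by
    nlinarith [abs_nonneg (R x - R θ)]
  have h5 : (M + 1) * |R x - R θ| < ε / 2 := by
    rw [lt_div_iff₀ (by positivity)] at hx2
    linarith
  calc |f (R x) x - f (R θ) θ| ≤ |f (R x) x - f (R θ) x| + |f (R θ) x - f (R θ) θ| :=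
        abs_sub_le _ _ _
    _ < ε := by linarith

end TameOn

namespace Tame

variable {ρ ρ' : ℝ} {f g : ℝ → ℝ → ℝ}

theorem mono (h : Tame ρ f) (hρ : ρ' ≤ ρ) : Tame ρ' f :=
  let ⟨M, hM⟩ := h
  ⟨M, hM.mono le_rfl hρ⟩

theorem const (ρ c : ℝ) : Tame ρ fun _ _ => c :=
  ⟨|c|, abs_nonneg _, fun _ _ => continuous_const, fun _ _ _ => le_rfl,
    fun _ _ _ _ _ => by simpa using mul_nonneg (abs_nonneg c) (abs_nonneg _), fun _ _ _ => rfl⟩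

theorem angular {u : ℝ → ℝ} (ρ : ℝ) (hu : Continuous u) (hp : Function.Periodic u (2 * Real.pi))
    {M : ℝ} (hM : ∀ θ, |u θ| ≤ M) : Tame ρ fun _ θ => u θ :=
  ⟨M, (abs_nonneg _).trans (hM 0), fun _ _ => hu, fun _ _ => hM,
    fun _ _ _ _ _ => by simpa using mul_nonneg ((abs_nonneg _).trans (hM 0)) (abs_nonneg _),
    fun _ _ => hp⟩

theorem cos (ρ : ℝ) : Tame ρ fun _ θ => Real.cos θ :=
  angular ρ Real.continuous_cos Real.cos_periodic Real.abs_cos_le_one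

theorem sin (ρ : ℝ) : Tame ρ fun _ θ => Real.sin θ :=
  angular ρ Real.continuous_sin Real.sin_periodic Real.abs_sin_le_one

theorem radius (ρ : ℝ) : Tame ρ fun r _ => r := by
  refine ⟨max 1 |ρ|, by positivity, fun _ _ => continuous_const, fun r hr _ => ?_,
    fun r _ r' _ _ => ?_, fun _ _ _ => rfl⟩
  · rw [abs_of_nonneg hr.1]
    exact (hr.2.trans (le_abs_self ρ)).trans (le_max_right _ _)
  · exact le_mul_of_one_le_left (abs_nonneg _) (le_max_left _ _)

theorem add (hf : Tame ρ f) (hg : Tame ρ g) : Tame ρ fun r θ => f r θ + g r θ := by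
  obtain ⟨M, hf⟩ := hf
  obtain ⟨N, hg⟩ := hg
  refine ⟨M + N, add_nonneg hf.nonneg hg.nonneg,
    fun r hr => (hf.continuous r hr).add (hg.continuous r hr), fun r hr θ => ?_,
    fun r hr r' hr' θ => ?_, fun r hr => (hf.periodic r hr).add (hg.periodic r hr)⟩
  · exact (abs_add_le _ _).trans (add_le_add (hf.bound r hr θ) (hg.bound r hr θ))
  · calc |f r θ + g r θ - (f r' θ + g r' θ)| = |(f r θ - f r' θ) + (g r θ - g r' θ)| := by
          congr 1; ring
      _ ≤ M * |r - r'| + N * |r - r'| :=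
          (abs_add_le _ _).trans (add_le_add (hf.lipschitz r hr r' hr' θ) (hg.lipschitz r hr r' hr' θ))
      _ = (M + N) * |r - r'| := by ring

theorem mul (hf : Tame ρ f) (hg : Tame ρ g) : Tame ρ fun r θ => f r θ * g r θ := by
  obtain ⟨M, hf⟩ := hf
  obtain ⟨N, hg⟩ := hg
  have hM := hf.nonneg
  have hN := hg.nonneg
  refine ⟨2 * (M * N), by positivity,
    fun r hr => (hf.continuous r hr).mul (hg.continuous r hr), fun r hr θ => ?_,
    fun r hr r' hr' θ => ?_, fun r hr => (hf.periodic r hr).mul (hg.periodic r hr)⟩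
  · rw [abs_mul]
    have := mul_le_mul (hf.bound r hr θ) (hg.bound r hr θ) (abs_nonneg _) hM
    nlinarith [mul_nonneg hM hN]
  · calc |f r θ * g r θ - f r' θ * g r' θ|
        = |f r θ * (g r θ - g r' θ) + (f r θ - f r' θ) * g r' θ| := by congr 1; ring
      _ ≤ |f r θ| * |g r θ - g r' θ| + |f r θ - f r' θ| * |g r' θ| := by
          rw [← abs_mul, ← abs_mul]; exact abs_add_le _ _
      _ ≤ M * (N * |r - r'|) + (M * |r - r'|) * N := by
          have := abs_nonneg (r - r')
          exact add_le_add
            (mul_le_mul (hf.bound r hr θ) (hg.lipschitz r hr r' hr' θ) (abs_nonneg _) hM)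
            (mul_le_mul (hf.lipschitz r hr r' hr' θ) (hg.bound r' hr' θ) (abs_nonneg _)
              (by positivity))
      _ = 2 * (M * N) * |r - r'| := by ring

theorem const_mul (hf : Tame ρ f) (c : ℝ) : Tame ρ fun r θ => c * f r θ := (const ρ c).mul hf

theorem neg (hf : Tame ρ f) : Tame ρ fun r θ => -f r θ := by simpa using hf.const_mul (-1)

theorem sub (hf : Tame ρ f) (hg : Tame ρ g) : Tame ρ fun r θ => f r θ - g r θ := by
  simpa [sub_eq_add_neg] using hf.add hg.neg

theorem pow (hf : Tame ρ f) (n : ℕ) : Tame ρ fun r θ => f r θ ^ n := by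
  induction n with
  | zero => simpa using const ρ 1
  | succ n ih => simpa [pow_succ] using ih.mul hf

theorem sum {ι : Type*} (s : Finset ι) {f : ι → ℝ → ℝ → ℝ} (hf : ∀ i ∈ s, Tame ρ (f i)) :
    Tame ρ fun r θ => ∑ i ∈ s, f i r θ := by
  classical
  induction s using Finset.induction_on with
  | empty => simpa using const ρ 0
  | insert a s ha ih =>
    simp only [Finset.sum_insert ha]
    exact (hf a (Finset.mem_insert_self _ _)).add
      (ih fun i hi => hf i (Finset.mem_insert_of_mem hi))

theorem inv (hf : Tame ρ f) (h : ∀ r ∈ Icc 0 ρ, ∀ θ, 1 / 2 ≤ f r θ) :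
    Tame ρ fun r θ => (f r θ)⁻¹ := by
  obtain ⟨M, hf⟩ := hf
  have hpos : ∀ r ∈ Icc 0 ρ, ∀ θ, 0 < f r θ := fun r hr θ => by linarith [h r hr θ]
  have hle : ∀ r ∈ Icc 0 ρ, ∀ θ, (f r θ)⁻¹ ≤ 2 := fun r hr θ => by
    simpa using inv_anti₀ (by norm_num) (h r hr θ)
  have hM := hf.nonneg
  refine ⟨4 * M + 2, by positivity,
    fun r hr => (hf.continuous r hr).inv₀ fun θ => (hpos r hr θ).ne', fun r hr θ => ?_,
    fun r hr r' hr' θ => ?_, fun r hr θ => by simp only [hf.periodic r hr θ]⟩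
  · rw [abs_of_pos (inv_pos.2 (hpos r hr θ))]
    linarith [hle r hr θ]
  · have h1 := (hpos r hr θ).ne'
    have h2 := (hpos r' hr' θ).ne'
    have e : (f r θ)⁻¹ - (f r' θ)⁻¹ = (f r θ)⁻¹ * (f r' θ)⁻¹ * (f r' θ - f r θ) := by
      field_simp
    rw [e, abs_mul, abs_mul, abs_of_pos (inv_pos.2 (hpos r hr θ)),
      abs_of_pos (inv_pos.2 (hpos r' hr' θ)), abs_sub_comm (f r' θ)]
    have h3 : (f r θ)⁻¹ * (f r' θ)⁻¹ ≤ 2 * 2 :=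
      mul_le_mul (hle r hr θ) (hle r' hr' θ) (inv_pos.2 (hpos r' hr' θ)).le (by norm_num)
    calc _ ≤ (2 * 2) * (M * |r - r'|) :=
          mul_le_mul h3 (hf.lipschitz r hr r' hr' θ) (abs_nonneg _) (by norm_num)
      _ ≤ (4 * M + 2) * |r - r'| := by nlinarith [abs_nonneg (r - r')]

end Tame

/-- A family of planar vector fields whose linear part at the origin is `α` times the identity plus
the rotation, in polar coordinates `r' = r (α + r A)`, `θ' = 1 + r C`, together with a function
`w = 2 log r + log q` whose derivative with respect to `θ` along the trajectories is
`α K₁ + K₂` with `K₁ ≈ 2` and `K₂ ≈ η r²`. -/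
structure PolarForm (X : ℝ → ℝ × ℝ → ℝ × ℝ) (η : ℝ) where
  (ρ M : ℝ)
  (A C q K₁ K₂ : ℝ → ℝ → ℝ)
  ρ_pos : 0 < ρ
  one_le_M : 1 ≤ M
  M_mul_ρ_le : M * ρ ≤ 1 / 100
  M_mul_ρ_le_η : M * ρ ≤ |η| / 100
  continuous_field : ∀ α, Continuous (X α)
  field_polar : ∀ α θ, ∀ r ∈ Icc 0 ρ, X α (r * Real.cos θ, r * Real.sin θ) =
    (r * (α + r * A r θ) * Real.cos θ - r * (1 + r * C r θ) * Real.sin θ,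
      r * (α + r * A r θ) * Real.sin θ + r * (1 + r * C r θ) * Real.cos θ)
  tame_A : TameOn ρ M A
  tame_C : TameOn ρ M C
  half_le_q : ∀ θ, ∀ r ∈ Icc 0 ρ, 1 / 2 ≤ q r θ
  q_le_two : ∀ θ, ∀ r ∈ Icc 0 ρ, q r θ ≤ 2
  log_q_lipschitz : ∀ θ, ∀ r ∈ Icc 0 ρ, ∀ r' ∈ Icc 0 ρ,
    |Real.log (q r θ) - Real.log (q r' θ)| ≤ M * |r - r'|
  continuous_q : Continuous fun p : ℝ × ℝ => q p.1 p.2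
  q_periodic : ∀ r, Function.Periodic (q r) (2 * Real.pi)
  hasDerivAt_w : ∀ (α k t : ℝ) (r θ : ℝ → ℝ), r t ∈ Ioc 0 ρ →
    HasDerivAt r (k * (r t * (α + r t * A (r t) (θ t)))) t →
    HasDerivAt θ (k * (1 + r t * C (r t) (θ t))) t →
    HasDerivAt (fun s => 2 * Real.log (r s) + Real.log (q (r s) (θ s)))
      (k * (1 + r t * C (r t) (θ t)) * (α * K₁ (r t) (θ t) + K₂ (r t) (θ t))) t
  K₁_near : ∀ θ, ∀ r ∈ Icc 0 ρ, |K₁ r θ - 2| ≤ M * r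
  K₁_lipschitz : ∀ θ, ∀ r ∈ Icc 0 ρ, ∀ r' ∈ Icc 0 ρ, |K₁ r θ - K₁ r' θ| ≤ M * |r - r'|
  K₂_near : ∀ θ, ∀ r ∈ Icc 0 ρ, |K₂ r θ - η * r ^ 2| ≤ M * r ^ 3
  K₂_lipschitz : ∀ θ, ∀ R ≤ ρ, ∀ r ∈ Icc 0 R, ∀ r' ∈ Icc 0 R,
    |(K₂ r θ - η * r ^ 2) - (K₂ r' θ - η * r' ^ 2)| ≤ M * R ^ 2 * |r - r'|

namespace PolarForm

variable {X : ℝ → ℝ × ℝ → ℝ × ℝ} {η : ℝ} (P : PolarForm X η)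


theorem ρ_le : P.ρ ≤ 1 / 100 := by
  nlinarith [P.M_mul_ρ_le, P.one_le_M, P.ρ_pos]

theorem M_mul_le {r : ℝ} (hr : r ≤ P.ρ) : P.M * r ≤ 1 / 100 := by
  nlinarith [P.M_mul_ρ_le, P.one_le_M]

theorem M_mul_le_η {r : ℝ} (hr : r ≤ P.ρ) : P.M * r ≤ |η| / 100 := by
  nlinarith [P.M_mul_ρ_le_η, P.one_le_M]

theorem abs_mul_A_le (θ : ℝ) {r : ℝ} (hr : r ∈ Icc 0 P.ρ) : |r * P.A r θ| ≤ P.M * r := by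
  rw [abs_mul, abs_of_nonneg hr.1, mul_comm]
  exact mul_le_mul_of_nonneg_right (P.tame_A.bound r hr θ) hr.1

theorem abs_mul_C_le (θ : ℝ) {r : ℝ} (hr : r ∈ Icc 0 P.ρ) : |r * P.C r θ| ≤ P.M * r := by
  rw [abs_mul, abs_of_nonneg hr.1, mul_comm]
  exact mul_le_mul_of_nonneg_right (P.tame_C.bound r hr θ) hr.1

theorem angular_ge (θ : ℝ) {r : ℝ} (hr : r ∈ Icc 0 P.ρ) : 99 / 100 ≤ 1 + r * P.C r θ := by
  have := abs_le.1 ((P.abs_mul_C_le θ hr).trans (P.M_mul_le hr.2))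
  linarith [this.1]

theorem angular_le (θ : ℝ) {r : ℝ} (hr : r ∈ Icc 0 P.ρ) : 1 + r * P.C r θ ≤ 101 / 100 := by
  have := abs_le.1 ((P.abs_mul_C_le θ hr).trans (P.M_mul_le hr.2))
  linarith [this.2]

end PolarForm

end BoundaryHopf

/-! ### Polar coordinates along trajectories; the equation for `r` as a function of `θ` -/

namespace BoundaryHopf

/-- The projection of the radius to `[0, ρ]`. -/
noncomputable def clamp (ρ r : ℝ) : ℝ := max 0 (min r ρ)

theorem clamp_mem {ρ : ℝ} (hρ : 0 ≤ ρ) (r : ℝ) : clamp ρ r ∈ Icc 0 ρ :=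
  ⟨le_max_left _ _, max_le hρ (min_le_right _ _)⟩

theorem clamp_of_mem {ρ r : ℝ} (hr : r ∈ Icc 0 ρ) : clamp ρ r = r := by
  rw [clamp, min_eq_left hr.2, max_eq_right hr.1]

theorem lipschitzWith_clamp (ρ : ℝ) : LipschitzWith 1 (clamp ρ) :=
  (LipschitzWith.id.min_const ρ).const_max 0

/-- A nonvanishing differentiable curve in the plane has a differentiable polar angle. -/
theorem exists_polar_angle {x y x' y' : ℝ → ℝ} (hx : ∀ t, HasDerivAt x (x' t) t)
    (hy : ∀ t, HasDerivAt y (y' t) t) (hx' : Continuous x') (hy' : Continuous y')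
    (h0 : ∀ t, 0 < x t ^ 2 + y t ^ 2) :
    ∃ r θ : ℝ → ℝ, (∀ t, 0 < r t) ∧ (∀ t, r t ^ 2 = x t ^ 2 + y t ^ 2) ∧
      (∀ t, x t = r t * Real.cos (θ t)) ∧ (∀ t, y t = r t * Real.sin (θ t)) ∧
      (∀ t, HasDerivAt r ((x t * x' t + y t * y' t) / r t) t) ∧
      ∀ t, HasDerivAt θ ((x t * y' t - y t * x' t) / r t ^ 2) t := by
  set r : ℝ → ℝ := fun t => Real.sqrt (x t ^ 2 + y t ^ 2) with hr
  have rpos : ∀ t, 0 < r t := fun t => Real.sqrt_pos.2 (h0 t)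
  have rsq : ∀ t, r t ^ 2 = x t ^ 2 + y t ^ 2 := fun t => Real.sq_sqrt (h0 t).le
  have hrd : ∀ t, HasDerivAt r ((x t * x' t + y t * y' t) / r t) t := by
    intro t
    have h1 : HasDerivAt (fun t => x t ^ 2 + y t ^ 2) (2 * x t * x' t + 2 * y t * y' t) t :=
      (((hx t).pow 2).add ((hy t).pow 2)).congr_deriv (by norm_num)
    have := h1.sqrt (h0 t).ne'
    convert this using 1
    rw [show Real.sqrt (x t ^ 2 + y t ^ 2) = r t from rfl]
    have := (rpos t).ne'
    field_simp
  have hxc : Continuous x := continuous_iff_continuousAt.2 fun t => (hx t).continuousAt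
  have hyc : Continuous y := continuous_iff_continuousAt.2 fun t => (hy t).continuousAt
  have hrc : Continuous r := continuous_iff_continuousAt.2 fun t => (hrd t).continuousAt
  have hωc : Continuous fun t => (x t * y' t - y t * x' t) / r t ^ 2 :=
    ((hxc.mul hy').sub (hyc.mul hx')).div (hrc.pow 2) fun t => (pow_pos (rpos t) 2).ne'
  set z : ℂ := ⟨x 0, y 0⟩ with hz
  -- The angle is defined by integrating its expected derivative. That it is a polar angle follows
  -- because the vector `(x, y) / r`, rotated by `-θ`, has derivative zero and starts at `(1, 0)`.
  set θ : ℝ → ℝ := fun t => z.arg + ∫ s in (0 : ℝ)..t, (x s * y' s - y s * x' s) / r s ^ 2 with hθ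
  have hθd : ∀ t, HasDerivAt θ ((x t * y' t - y t * x' t) / r t ^ 2) t := fun t =>
    (hωc.integral_hasStrictDerivAt 0 t).hasDerivAt.const_add _
  have hz0 : z ≠ 0 := by
    intro h
    have h1 : x 0 = 0 := by simpa [hz] using congrArg Complex.re h
    have h2 : y 0 = 0 := by simpa [hz] using congrArg Complex.im h
    have := h0 0
    rw [h1, h2] at this
    norm_num at this
  have hznorm : ‖z‖ = r 0 := by
    rw [Complex.norm_eq_sqrt_sq_add_sq]
  have hθ0 : θ 0 = z.arg := by simp [hθ]
  have hcos0 : x 0 = r 0 * Real.cos (θ 0) := by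
    rw [hθ0, Complex.cos_arg hz0, hznorm]
    have := (rpos 0).ne'
    field_simp
    rfl
  have hsin0 : y 0 = r 0 * Real.sin (θ 0) := by
    rw [hθ0, Complex.sin_arg, hznorm]
    have := (rpos 0).ne'
    field_simp
    rfl
  have hξd : ∀ t, HasDerivAt
      (fun t => (x t * Real.cos (θ t) + y t * Real.sin (θ t)) / r t) 0 t := by
    intro t
    have h1 := (((hx t).mul (hθd t).cos).add ((hy t).mul (hθd t).sin)).div (hrd t) (rpos t).ne'
    refine h1.congr_deriv ?_
    have := (rpos t).ne'
    rw [div_eq_zero_iff]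
    left
    simp only [Pi.add_apply, Pi.mul_apply]
    field_simp
    rw [rsq t]
    ring
  have hζd : ∀ t, HasDerivAt
      (fun t => (y t * Real.cos (θ t) - x t * Real.sin (θ t)) / r t) 0 t := by
    intro t
    have h1 := (((hy t).mul (hθd t).cos).sub ((hx t).mul (hθd t).sin)).div (hrd t) (rpos t).ne'
    refine h1.congr_deriv ?_
    have := (rpos t).ne'
    rw [div_eq_zero_iff]
    left
    simp only [Pi.sub_apply, Pi.mul_apply]
    field_simp
    rw [rsq t]
    ring
  have hξ : ∀ t, (x t * Real.cos (θ t) + y t * Real.sin (θ t)) / r t = 1 := by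
    intro t
    rw [is_const_of_deriv_eq_zero (fun t => (hξd t).differentiableAt) (fun t => (hξd t).deriv) t 0,
      hcos0, hsin0, div_eq_one_iff_eq (rpos 0).ne']
    linear_combination r 0 * Real.sin_sq_add_cos_sq (θ 0)
  have hζ : ∀ t, (y t * Real.cos (θ t) - x t * Real.sin (θ t)) / r t = 0 := by
    intro t
    rw [is_const_of_deriv_eq_zero (fun t => (hζd t).differentiableAt) (fun t => (hζd t).deriv) t 0,
      hcos0, hsin0]
    ring
  refine ⟨r, θ, rpos, rsq, fun t => ?_, fun t => ?_, hrd, hθd⟩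
  · have h1 := (div_eq_one_iff_eq (rpos t).ne').1 (hξ t)
    have h2 := (div_eq_zero_iff.1 (hζ t)).resolve_right (rpos t).ne'
    linear_combination Real.cos (θ t) * h1 - Real.sin (θ t) * h2 -
      x t * Real.sin_sq_add_cos_sq (θ t)
  · have h1 := (div_eq_one_iff_eq (rpos t).ne').1 (hξ t)
    have h2 := (div_eq_zero_iff.1 (hζ t)).resolve_right (rpos t).ne'
    linear_combination Real.sin (θ t) * h1 + Real.cos (θ t) * h2 -
      y t * Real.sin_sq_add_cos_sq (θ t)

namespace PolarForm

variable {X : ℝ → ℝ × ℝ → ℝ × ℝ} {η : ℝ} (P : PolarForm X η)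

/-- The function `w = log V`, with `V = r² q` the Liapunov function. -/
noncomputable def w (r θ : ℝ) : ℝ := 2 * Real.log r + Real.log (P.q r θ)

/-- The derivative of `w` with respect to `θ` along the trajectories. -/
noncomputable def K (α r θ : ℝ) : ℝ := α * P.K₁ r θ + P.K₂ r θ

/-- The right-hand side of `dr/dθ = r (α + r A) / (1 + r C)`, with `r` projected to `[0, ρ]`. -/
noncomputable def slope (α θ r : ℝ) : ℝ :=
  clamp P.ρ r * (α + clamp P.ρ r * P.A (clamp P.ρ r) θ) *
    (1 + clamp P.ρ r * P.C (clamp P.ρ r) θ)⁻¹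

theorem w_periodic (r : ℝ) : Function.Periodic (P.w r) (2 * Real.pi) := fun θ => by
  simp only [w, P.q_periodic r θ]

theorem slope_of_mem (α θ : ℝ) {r : ℝ} (hr : r ∈ Icc 0 P.ρ) :
    P.slope α θ r = r * (α + r * P.A r θ) * (1 + r * P.C r θ)⁻¹ := by
  rw [slope, clamp_of_mem hr]

theorem tame_slope (α : ℝ) :
    Tame P.ρ fun r θ => r * (α + r * P.A r θ) * (1 + r * P.C r θ)⁻¹ := by
  refine ((Tame.radius _).mul ((Tame.const _ α).add ((Tame.radius _).mul ⟨_, P.tame_A⟩))).mul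
    (Tame.inv ((Tame.const _ 1).add ((Tame.radius _).mul ⟨_, P.tame_C⟩)) fun r hr θ => ?_)
  linarith [P.angular_ge θ hr]

/-- Projection to `[0, ρ]` is 1-Lipschitz, so bounds valid on `[0, ρ]` become global ones; this is
what makes global existence and comparison available before a solution is known to stay in `[0, ρ]`.
-/
theorem exists_lipschitz_slope (α : ℝ) :
    ∃ K : NNReal, (∀ θ, LipschitzWith K (P.slope α θ)) ∧ (∀ r, Continuous fun θ => P.slope α θ r) ∧
      ∀ θ r, |P.slope α θ r| ≤ K := by
  obtain ⟨M, hM⟩ := P.tame_slope α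
  have hc := clamp_mem P.ρ_pos.le
  refine ⟨⟨M, hM.nonneg⟩, fun θ => LipschitzWith.of_dist_le_mul fun r r' => ?_,
    fun r => hM.continuous _ (hc r), fun θ r => hM.bound _ (hc r) θ⟩
  have h1 := hM.lipschitz _ (hc r) _ (hc r') θ
  have h2 := (lipschitzWith_clamp P.ρ).dist_le_mul r r'
  rw [Real.dist_eq, Real.dist_eq] at *
  simp only [NNReal.coe_one, one_mul] at h2
  exact h1.trans (mul_le_mul_of_nonneg_left h2 hM.nonneg)

theorem exists_angular_solution (α θ₀ r₀ : ℝ) :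
    ∃ R : ℝ → ℝ, R θ₀ = r₀ ∧ ∀ θ, HasDerivAt R (P.slope α θ (R θ)) θ := by
  obtain ⟨K, h1, h2, h3⟩ := P.exists_lipschitz_slope α
  exact exists_global_solution h1 h2 h3 θ₀ r₀

theorem slope_periodic (α r θ : ℝ) : P.slope α (θ + 2 * Real.pi) r = P.slope α θ r := by
  have hc := clamp_mem P.ρ_pos.le r
  rw [slope, slope, P.tame_A.periodic _ hc θ, P.tame_C.periodic _ hc θ]

theorem slope_zero (α θ : ℝ) : P.slope α θ 0 = 0 := by
  rw [slope_of_mem P α θ ⟨le_rfl, P.ρ_pos.le⟩]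
  simp

variable {P} {α : ℝ} {R : ℝ → ℝ}

/-- The zero function is a solution, and solutions do not cross. -/
theorem angular_pos (hR : ∀ θ, HasDerivAt R (P.slope α θ (R θ)) θ) {θ₀ : ℝ} (h : 0 < R θ₀) (θ : ℝ) :
    0 < R θ := by
  obtain ⟨K, h1, -, -⟩ := P.exists_lipschitz_slope α
  exact solution_lt_of_lt (γ := fun _ => 0) h1
    (fun t => by rw [P.slope_zero]; exact hasDerivAt_const _ _) hR h θ

/-- The factor `k` in `P.hasDerivAt_w` is a change of time scale: `k = (1 + r C)⁻¹` makes `θ` the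
independent variable, while `k = 1` is the original time. -/
theorem hasDerivAt_w_angular (hR : ∀ θ, HasDerivAt R (P.slope α θ (R θ)) θ) {θ : ℝ}
    (h : R θ ∈ Ioc 0 P.ρ) : HasDerivAt (fun θ => P.w (R θ) θ) (P.K α (R θ) θ) θ := by
  have hmem := Ioc_subset_Icc_self h
  have hpos : 0 < 1 + R θ * P.C (R θ) θ := by linarith [P.angular_ge θ hmem]
  have h1 := P.hasDerivAt_w α (1 + R θ * P.C (R θ) θ)⁻¹ θ R id h
    ((hR θ).congr_deriv (by rw [P.slope_of_mem α θ hmem, id]; ring))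
    ((hasDerivAt_id θ).congr_deriv (by rw [id, inv_mul_cancel₀ hpos.ne']))
  refine h1.congr_deriv ?_
  rw [id, inv_mul_cancel₀ hpos.ne', one_mul, K]

theorem hasDerivAt_planar {r θ : ℝ → ℝ} {t : ℝ} (hmem : r t ∈ Icc 0 P.ρ)
    (hr : HasDerivAt r (r t * (α + r t * P.A (r t) (θ t))) t)
    (hθ : HasDerivAt θ (1 + r t * P.C (r t) (θ t)) t) :
    HasDerivAt (fun t => (r t * Real.cos (θ t), r t * Real.sin (θ t)))
      (X α (r t * Real.cos (θ t), r t * Real.sin (θ t))) t := by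
  rw [P.field_polar α _ _ hmem]
  exact ((hr.mul hθ.cos).congr_deriv (by ring)).prodMk ((hr.mul hθ.sin).congr_deriv (by ring))

variable (P) in
/-- The angular speed `1 + r C` along the curve with radius `R`, projected to `[0, ρ]`. -/
noncomputable def speed (R : ℝ → ℝ) (θ : ℝ) : ℝ :=
  1 + clamp P.ρ (R θ) * P.C (clamp P.ρ (R θ)) θ

theorem half_le_speed (θ : ℝ) : 1 / 2 ≤ P.speed R θ := by
  have := P.angular_ge θ (clamp_mem P.ρ_pos.le (R θ))
  rw [speed]
  linarith

theorem continuous_speed (hR : Continuous R) : Continuous (P.speed R) := by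
  have hcc : Continuous fun θ => clamp P.ρ (R θ) := (lipschitzWith_clamp P.ρ).continuous.comp hR
  exact continuous_const.add
    (hcc.mul (P.tame_C.continuous_comp hcc fun θ => clamp_mem P.ρ_pos.le _))

theorem speed_periodic (hR : Function.Periodic R (2 * Real.pi)) :
    Function.Periodic (P.speed R) (2 * Real.pi) := fun θ => by
  rw [speed, speed, hR θ, P.tame_C.periodic _ (clamp_mem P.ρ_pos.le _) θ]

/-- The planar trajectory with a given radius as a function of the polar angle. -/
theorem exists_planar_of_angular (hR : ∀ θ, HasDerivAt R (P.slope α θ (R θ)) θ) (θ₀ : ℝ) :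
    ∃ Θ : ℝ → ℝ, Θ 0 = θ₀ ∧ (∀ t, HasDerivAt Θ (P.speed R (Θ t)) t) ∧
      (∀ t, R (Θ t) ∈ Icc 0 P.ρ → HasDerivAt
        (fun t => (R (Θ t) * Real.cos (Θ t), R (Θ t) * Real.sin (Θ t)))
        (X α (R (Θ t) * Real.cos (Θ t), R (Θ t) * Real.sin (Θ t))) t) := by
  have hRc : Continuous R := continuous_iff_continuousAt.2 fun t => (hR t).continuousAt
  obtain ⟨Θ, h0, hΘ⟩ := exists_solution_autonomous (continuous_speed (P := P) hRc)
    (c := 1 / 2) (C := 101 / 100) (by norm_num) half_le_speed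
    (fun θ => P.angular_le θ (clamp_mem P.ρ_pos.le (R θ))) θ₀
  refine ⟨Θ, h0, hΘ, fun t ht => ?_⟩
  have h1 := hΘ t
  have h2 := (hR (Θ t)).comp t h1
  rw [P.slope_of_mem α _ ht, speed, clamp_of_mem ht] at h2
  rw [speed, clamp_of_mem ht] at h1
  refine hasDerivAt_planar (r := R ∘ Θ) ht (h2.congr_deriv ?_) h1
  have : 0 < 1 + R (Θ t) * P.C (R (Θ t)) (Θ t) := by linarith [P.angular_ge (Θ t) ht]
  simp only [Function.comp]
  field_simp

variable (P)

/-- Polar coordinates along a trajectory that avoids the origin. -/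
theorem exists_polar_of_planar {γ : ℝ → ℝ × ℝ} (hγ : IsIntegralCurve γ fun _ => X α)
    (h0 : ∀ t, 0 < (γ t).1 ^ 2 + (γ t).2 ^ 2) (hρ : ∀ t, (γ t).1 ^ 2 + (γ t).2 ^ 2 ≤ P.ρ ^ 2) :
    ∃ r θ : ℝ → ℝ, (∀ t, r t ∈ Ioc 0 P.ρ) ∧
      (∀ t, γ t = (r t * Real.cos (θ t), r t * Real.sin (θ t))) ∧
      (∀ t, HasDerivAt r (r t * (α + r t * P.A (r t) (θ t))) t) ∧
      ∀ t, HasDerivAt θ (1 + r t * P.C (r t) (θ t)) t := by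
  have hγc : Continuous γ := hγ.continuous
  have hXc : Continuous fun t => X α (γ t) := (P.continuous_field α).comp hγc
  obtain ⟨r, θ, rpos, rsq, hx, hy, hrd, hθd⟩ := exists_polar_angle
    (fun t => (hγ t).fst) (fun t => (hγ t).snd) (continuous_fst.comp hXc)
    (continuous_snd.comp hXc) h0
  have hle : ∀ t, r t ≤ P.ρ := fun t =>
    (sq_le_sq₀ (rpos t).le P.ρ_pos.le).1 ((rsq t).trans_le (hρ t))
  have hγe : ∀ t, γ t = (r t * Real.cos (θ t), r t * Real.sin (θ t)) := fun t =>
    Prod.ext (hx t) (hy t)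
  refine ⟨r, θ, fun t => ⟨rpos t, hle t⟩, hγe, fun t => ?_, fun t => ?_⟩
  · refine (hrd t).congr_deriv ?_
    simp only [hγe t, P.field_polar α _ _ ⟨(rpos t).le, hle t⟩]
    have := (rpos t).ne'
    field_simp
    linear_combination (α + r t * P.A (r t) (θ t)) * Real.sin_sq_add_cos_sq (θ t)
  · refine (hθd t).congr_deriv ?_
    simp only [hγe t, P.field_polar α _ _ ⟨(rpos t).le, hle t⟩]
    have := (rpos t).ne'
    field_simp
    linear_combination (1 + r t * P.C (r t) (θ t)) * Real.sin_sq_add_cos_sq (θ t)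

end PolarForm

end BoundaryHopf

/-! ### The return map at `α = 0` and the Liapunov number -/

namespace BoundaryHopf

theorem sub_one_bounds_of_log {x : ℝ} (hx : |x - 1| ≤ 1 / 100) :
    |x - 1| ≤ 2 * |Real.log x| ∧ |x - 1 - Real.log x| ≤ 2 * (x - 1) ^ 2 := by
  have h := abs_le.1 hx
  have hpos : 0 < x := by linarith [h.1]
  have h1 := Real.log_le_sub_one_of_pos hpos
  have h2 := Real.one_sub_inv_le_log_of_pos hpos
  have h3 : (x - 1) - 2 * (x - 1) ^ 2 ≤ 1 - x⁻¹ := by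
    rw [show 1 - x⁻¹ = (x - 1) / x by field_simp, le_div_iff₀ hpos]
    nlinarith [sq_nonneg (x - 1), h.1, h.2]
  have h4 : |x - 1 - Real.log x| ≤ 2 * (x - 1) ^ 2 := by
    rw [abs_of_nonneg (by linarith)]
    linarith
  refine ⟨?_, h4⟩
  have h5 : |x - 1| ≤ |x - 1 - Real.log x| + |Real.log x| := by
    simpa using abs_add_le (x - 1 - Real.log x) (Real.log x)
  have h6 : (x - 1) ^ 2 ≤ 1 / 100 * |x - 1| := by
    rw [← sq_abs, sq]
    exact mul_le_mul_of_nonneg_right hx (abs_nonneg _)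
  linarith [abs_nonneg (x - 1)]

namespace PolarForm

variable {X : ℝ → ℝ × ℝ → ℝ × ℝ} {η : ℝ} (P : PolarForm X η)

theorem abs_slope_zero_le (θ : ℝ) {r : ℝ} (hr : r ∈ Icc 0 P.ρ) :
    |P.slope 0 θ r| ≤ 2 * P.M * r ^ 2 := by
  rw [P.slope_of_mem 0 θ hr, zero_add, abs_mul, abs_mul, abs_of_nonneg hr.1, abs_mul,
    abs_of_nonneg hr.1]
  have h1 := P.angular_ge θ hr
  have h2 : |(1 + r * P.C r θ)⁻¹| ≤ 2 := by
    rw [abs_of_pos (inv_pos.2 (by linarith)), inv_le_comm₀ (by linarith) (by norm_num)]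
    linarith
  have h3 := P.tame_A.bound r hr θ
  have hM := P.tame_A.nonneg
  have hr0 := hr.1
  calc r * (r * |P.A r θ|) * |(1 + r * P.C r θ)⁻¹| ≤ r * (r * P.M) * 2 := by gcongr
    _ = 2 * P.M * r ^ 2 := by ring

variable {P} {R : ℝ → ℝ} {s : ℝ}

/-- As long as `R` is within `s / 100` of `s`, its slope is at most `4 M s²` in absolute value, so
the lines `s ± 5 M s² θ` are barriers. Over one turn they deviate by at most `35 M s²`, as `2 π ≤
7`, and this is below `s / 100` because `s ≤ ρ / 64`. -/
theorem abs_radius_sub_le (hR : ∀ θ, HasDerivAt R (P.slope 0 θ (R θ)) θ) (h0 : R 0 = s)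
    (hs : 0 < s) (hsρ : s ≤ P.ρ / 64) {θ : ℝ} (hθ : θ ∈ Icc 0 (2 * Real.pi)) :
    |R θ - s| ≤ 5 * P.M * s ^ 2 * θ ∧ |R θ - s| ≤ 35 * P.M * s ^ 2 ∧ |R θ - s| ≤ s / 100 := by
  have hM := P.one_le_M
  have hπ : 2 * Real.pi ≤ 7 := by linarith [Real.pi_lt_d2]
  have hMs : P.M * s ≤ 1 / 6400 := by nlinarith [P.M_mul_ρ_le]
  have hMs2 : P.M * s ^ 2 ≤ s / 6400 := by nlinarith
  have hMs0 : 0 < P.M * s ^ 2 := by positivity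
  have key : ∀ φ ∈ Icc 0 (2 * Real.pi), 5 * P.M * s ^ 2 * φ ≤ 35 * P.M * s ^ 2 := by
    intro φ hφ
    nlinarith [hφ.1, hφ.2]
  have slope_lt : ∀ φ r, |r - s| ≤ s / 100 → |P.slope 0 φ r| < 5 * P.M * s ^ 2 := by
    intro φ r hr
    have hr' := abs_le.1 hr
    refine (P.abs_slope_zero_le φ ⟨by linarith, by linarith⟩).trans_lt ?_
    have : r ^ 2 ≤ 2 * s ^ 2 := by nlinarith
    nlinarith
  have hd : ∀ φ, HasDerivAt (fun φ => s + 5 * P.M * s ^ 2 * φ) (5 * P.M * s ^ 2) φ := fun φ => by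
    simpa using ((hasDerivAt_id φ).const_mul (5 * P.M * s ^ 2)).const_add s
  have hd' : ∀ φ, HasDerivAt (fun φ => -s + 5 * P.M * s ^ 2 * φ) (5 * P.M * s ^ 2) φ := fun φ => by
    simpa using ((hasDerivAt_id φ).const_mul (5 * P.M * s ^ 2)).const_add (-s)
  have hup := image_le_of_deriv_right_lt_deriv_boundary (a := 0) (b := 2 * Real.pi) (f := R)
    (fun φ _ => (hR φ).continuousAt.continuousWithinAt) (fun φ _ => (hR φ).hasDerivWithinAt)
    (by simp [h0]) hd (fun φ hφ h => by
      have h1 := key φ (Ico_subset_Icc_self hφ)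
      refine (le_abs_self _).trans_lt (slope_lt φ _ ?_)
      rw [h, add_sub_cancel_left, abs_of_nonneg (mul_nonneg (by positivity) hφ.1)]
      linarith) hθ
  have hlow := image_le_of_deriv_right_lt_deriv_boundary (a := 0) (b := 2 * Real.pi)
    (f := fun φ => -R φ)
    (fun φ _ => (hR φ).neg.continuousAt.continuousWithinAt)
    (fun φ _ => (hR φ).neg.hasDerivWithinAt)
    (by simp [h0]) hd' (fun φ hφ h => by
      have h1 := key φ (Ico_subset_Icc_self hφ)
      refine (neg_le_abs _).trans_lt (slope_lt φ _ ?_)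
      rw [show R φ - s = -(5 * P.M * s ^ 2 * φ) by linarith, abs_neg,
        abs_of_nonneg (mul_nonneg (by positivity) hφ.1)]
      linarith) hθ
  have h1 : |R θ - s| ≤ 5 * P.M * s ^ 2 * θ := abs_le.2 ⟨by linarith, by linarith⟩
  have h2 := key θ hθ
  exact ⟨h1, h1.trans h2, by linarith⟩

/-- The angle increases strictly from `0` to `2π`; in between the orbit meets the `x`-axis only at
angle `π`, where `x < 0`. -/
theorem firstReturn_of_angular (hR : ∀ θ, HasDerivAt R (P.slope 0 θ (R θ)) θ) (h0 : R 0 = s)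
    (hs : 0 < s) (hsρ : s ≤ P.ρ / 64) : FirstReturn (X 0) s (R (2 * Real.pi)) := by
  obtain ⟨Θ, hΘ0, hΘ, hγ⟩ := exists_planar_of_angular hR 0
  have hge := fun t => half_le_speed (P := P) (R := R) (Θ t)
  have hmono := strictMono_of_deriv_ge (by norm_num) hΘ hge
  obtain ⟨T, hT⟩ := surjective_of_deriv_ge (by norm_num) hΘ hge (2 * Real.pi)
  have hTpos : 0 < T := by
    rw [← hmono.lt_iff_lt, hΘ0, hT]
    exact Real.two_pi_pos
  have hpos := angular_pos hR (h0.symm ▸ hs)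
  refine ⟨T, fun t => (R (Θ t) * Real.cos (Θ t), R (Θ t) * Real.sin (Θ t)), hTpos,
    fun t ht => (hγ t ?_).hasDerivWithinAt, by simp [hΘ0, h0], by simp [hT], hpos _,
    fun t ht haxis => ?_⟩
  · have hmem : Θ t ∈ Icc 0 (2 * Real.pi) :=
      ⟨hΘ0 ▸ hmono.monotone ht.1, hT ▸ hmono.monotone ht.2⟩
    have := abs_le.1 (abs_radius_sub_le hR h0 hs hsρ hmem).2.2
    exact ⟨(hpos _).le, by linarith⟩
  · have h1 : 0 < Θ t := hΘ0 ▸ hmono ht.1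
    have h2 : Θ t < 2 * Real.pi := hT ▸ hmono ht.2
    obtain ⟨hx, hy⟩ := haxis
    have hsin : Real.sin (Θ t) = 0 := (mul_eq_zero.1 hy).resolve_left (hpos _).ne'
    obtain ⟨n, hn⟩ := Real.sin_eq_zero_iff.1 hsin
    have hπ := Real.pi_pos
    have hn1 : (0 : ℝ) < n := by
      by_contra! h
      nlinarith
    have hn2 : (n : ℝ) < 2 := by
      by_contra! h
      nlinarith
    have hn3 : n = 1 := by
      have h3 : 0 < n := by exact_mod_cast hn1
      have h4 : n < 2 := by exact_mod_cast hn2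
      omega
    have hcos : Real.cos (Θ t) = -1 := by rw [← hn, hn3]; simp
    simp only [hcos] at hx
    linarith [hpos (Θ t)]

variable (P)

/-- The third order expansion of the return map of the weak focus. -/
theorem exists_displacement_bound : ∃ c : ℝ, ∀ (R : ℝ → ℝ) (s : ℝ),
    (∀ θ, HasDerivAt R (P.slope 0 θ (R θ)) θ) → R 0 = s → 0 < s → s ≤ P.ρ / 64 →
    |R (2 * Real.pi) - s - Real.pi * η * s ^ 3| ≤ c * s ^ 4 := by
  have hM := P.one_le_M
  set c₁ : ℝ := 2 * P.M + 105 * P.M * |η| with hc₁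
  have hc₁0 : 0 ≤ c₁ := by positivity
  set c₂ : ℝ := 7 * |η| + 7 * c₁ + 35 * P.M ^ 2 with hc₂
  have hc₂0 : 0 ≤ c₂ := by positivity
  refine ⟨2 * c₂ ^ 2 + 4 * c₁ + P.M * c₂, fun R s hR h0 hs hsρ => ?_⟩
  have hs1 : s ≤ 1 := by linarith [P.ρ_le]
  have hπ : 2 * Real.pi ≤ 7 := by linarith [Real.pi_lt_d2]
  have hπ0 := Real.two_pi_pos
  have hest := fun {φ} hφ => abs_radius_sub_le (θ := φ) hR h0 hs hsρ hφ
  have hmem : ∀ φ ∈ Icc 0 (2 * Real.pi), R φ ∈ Ioc 0 P.ρ ∧ R φ ≤ 101 / 100 * s := by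
    intro φ hφ
    have := abs_le.1 (hest hφ).2.2
    exact ⟨⟨by linarith, by linarith⟩, by linarith⟩
  -- Replacing `R φ` by `s` in `η R²` costs `O(s³)`, as does replacing `K₂` by `η R²`; hence `w`
  -- grows by `2 π η s² + O(s³)` in one turn.
  have hg := Convex.norm_image_sub_le_of_norm_hasDerivWithin_le (s := Icc 0 (2 * Real.pi))
    (f := fun θ => P.w (R θ) θ - η * s ^ 2 * θ)
    (f' := fun θ => P.K 0 (R θ) θ - η * s ^ 2) (C := c₁ * s ^ 3)
    (fun φ hφ => ((hasDerivAt_w_angular hR (hmem φ hφ).1).sub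
      (by simpa using (hasDerivAt_id φ).const_mul (η * s ^ 2))).hasDerivWithinAt)
    (fun φ hφ => by
      obtain ⟨hm, hm2⟩ := hmem φ hφ
      have h1 := P.K₂_near φ (R φ) (Ioc_subset_Icc_self hm)
      have h2 : |η * (R φ ^ 2 - s ^ 2)| ≤ |η| * (35 * P.M * s ^ 2 * (3 * s)) := by
        rw [abs_mul, show R φ ^ 2 - s ^ 2 = (R φ - s) * (R φ + s) by ring, abs_mul]
        have h4 : |R φ + s| ≤ 3 * s := by rw [abs_of_pos (by linarith [hm.1])]; linarith
        have h5 := (hest hφ).2.1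
        gcongr
      have h3 : P.M * R φ ^ 3 ≤ 2 * P.M * s ^ 3 := by
        have : R φ ^ 3 ≤ (101 / 100 * s) ^ 3 := pow_le_pow_left₀ hm.1.le hm2 3
        nlinarith [pow_pos hs 3]
      rw [Real.norm_eq_abs, K, zero_mul, zero_add]
      calc |P.K₂ (R φ) φ - η * s ^ 2|
          = |(P.K₂ (R φ) φ - η * R φ ^ 2) + η * (R φ ^ 2 - s ^ 2)| := by congr 1; ring
        _ ≤ |P.K₂ (R φ) φ - η * R φ ^ 2| + |η * (R φ ^ 2 - s ^ 2)| := abs_add_le _ _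
        _ ≤ c₁ * s ^ 3 := by rw [hc₁]; linarith)
    (convex_Icc _ _) (left_mem_Icc.2 hπ0.le) (right_mem_Icc.2 hπ0.le)
  have hR1 := hest (right_mem_Icc.2 hπ0.le)
  obtain ⟨hR1m, hR1le⟩ := hmem _ (right_mem_Icc.2 hπ0.le)
  set r := R (2 * Real.pi) with hr
  have hper : P.w r (2 * Real.pi) = P.w r 0 := by simpa using P.w_periodic r 0
  have hlq := P.log_q_lipschitz 0 r (Ioc_subset_Icc_self hR1m) s ⟨hs.le, by linarith⟩
  rw [Real.norm_eq_abs, Real.norm_eq_abs, sub_zero, abs_of_pos hπ0, hper, h0] at hg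
  simp only [w, mul_zero, sub_zero] at hg
  set x := r / s with hx
  have hlog : Real.log r - Real.log s = Real.log x := (Real.log_div hR1m.1.ne' hs.ne').symm
  have hxs : x * s = r := div_mul_cancel₀ _ hs.ne'
  have hx1 : |x - 1| * s = |r - s| := by
    rw [← abs_of_pos hs, ← abs_mul, abs_of_pos hs, sub_mul, hxs, one_mul]
  have hx2 : |x - 1| ≤ 1 / 100 := by
    have := hR1.2.2
    rw [← hx1] at this
    nlinarith
  obtain ⟨hb1, hb2⟩ := sub_one_bounds_of_log hx2
  set D := Real.log (P.q r 0) - Real.log (P.q s 0) with hD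
  have hmain : |2 * Real.log x + D - 2 * Real.pi * η * s ^ 2| ≤ 7 * c₁ * s ^ 3 := by
    have e : 2 * Real.log x + D - 2 * Real.pi * η * s ^ 2 =
        2 * Real.log r + Real.log (P.q r 0) - η * s ^ 2 * (2 * Real.pi) -
          (2 * Real.log s + Real.log (P.q s 0)) := by rw [← hlog, hD]; ring
    rw [e]
    refine hg.trans ?_
    have : 0 ≤ c₁ * s ^ 3 := by positivity
    nlinarith
  have hηs : |2 * Real.pi * η * s ^ 2| ≤ 7 * |η| * s ^ 2 := by
    rw [abs_mul, abs_mul, abs_of_pos hπ0, abs_of_pos (pow_pos hs 2)]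
    gcongr
  have hs3 : s ^ 3 ≤ s ^ 2 := pow_le_pow_of_le_one hs.le hs1 (by norm_num)
  -- A bootstrap: the crude bound `|r - s| = O(s²)` makes `D = O(s²)`, which gives `x - 1 = O(s²)`,
  -- that is `|r - s| = O(s³)`, and this in turn improves `D` to `O(s³)`.
  have hx3 : |x - 1| ≤ c₂ * s ^ 2 := by
    have h1 : |2 * Real.log x| ≤ 7 * c₁ * s ^ 3 + |D| + |2 * Real.pi * η * s ^ 2| := by
      have e : 2 * Real.log x = (2 * Real.log x + D - 2 * Real.pi * η * s ^ 2) - D +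
        2 * Real.pi * η * s ^ 2 := by ring
      rw [e]
      exact (abs_add_le _ _).trans (add_le_add_left ((abs_sub _ _).trans
        (add_le_add_left hmain _)) _)
    have h2 : |D| ≤ P.M * (35 * P.M * s ^ 2) :=
      hlq.trans (mul_le_mul_of_nonneg_left hR1.2.1 (by linarith))
    rw [abs_mul, abs_two] at h1
    have h3 : 7 * c₁ * s ^ 3 ≤ 7 * c₁ * s ^ 2 := by gcongr
    rw [hc₂]
    linarith
  have hD2 : |D| ≤ P.M * (c₂ * s ^ 3) := by
    refine hlq.trans (mul_le_mul_of_nonneg_left ?_ (by linarith))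
    rw [← hx1]
    nlinarith
  have hfin : |2 * (x - 1) - 2 * Real.pi * η * s ^ 2| ≤
      (4 * c₂ ^ 2 + 7 * c₁ + P.M * c₂) * s ^ 3 := by
    have h1 : (x - 1) ^ 2 ≤ c₂ ^ 2 * s ^ 3 := by
      rw [← sq_abs]
      calc |x - 1| ^ 2 ≤ (c₂ * s ^ 2) ^ 2 := pow_le_pow_left₀ (abs_nonneg _) hx3 2
        _ = c₂ ^ 2 * s ^ 4 := by ring
        _ ≤ c₂ ^ 2 * s ^ 3 :=
          mul_le_mul_of_nonneg_left (pow_le_pow_of_le_one hs.le hs1 (by norm_num)) (by positivity)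
    have e : 2 * (x - 1) - 2 * Real.pi * η * s ^ 2 = 2 * (x - 1 - Real.log x) +
      (2 * Real.log x + D - 2 * Real.pi * η * s ^ 2) - D := by ring
    rw [e]
    have h2 : |2 * (x - 1 - Real.log x)| ≤ 4 * (c₂ ^ 2 * s ^ 3) := by
      rw [abs_mul, abs_two]; linarith
    calc _ ≤ |2 * (x - 1 - Real.log x)| + |2 * Real.log x + D - 2 * Real.pi * η * s ^ 2| + |D| :=
          (abs_sub _ _).trans (add_le_add_left (abs_add_le _ _) _)
      _ ≤ _ := by linarith
  have e : r - s - Real.pi * η * s ^ 3 = s / 2 * (2 * (x - 1) - 2 * Real.pi * η * s ^ 2) := by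
    rw [← hxs]; ring
  rw [e, abs_mul, abs_of_pos (half_pos hs)]
  have h3 := mul_le_mul_of_nonneg_left hfin (half_pos hs).le
  refine h3.trans ?_
  have : 0 ≤ s ^ 4 := by positivity
  have h4 : 0 ≤ P.M * c₂ * s ^ 4 := by positivity
  have h5 : 0 ≤ c₁ * s ^ 4 := by positivity
  have e2 : s / 2 * ((4 * c₂ ^ 2 + 7 * c₁ + P.M * c₂) * s ^ 3) =
    2 * c₂ ^ 2 * s ^ 4 + 7 / 2 * (c₁ * s ^ 4) + P.M * c₂ * s ^ 4 / 2 := by ring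
  rw [e2]
  linarith

/-- The Liapunov number of the weak focus is `6 π η`. -/
theorem isLiapunovNumber (P : PolarForm X η) : IsLiapunovNumber (X 0) (6 * Real.pi * η) := by
  choose R hR0 hR using fun s => P.exists_angular_solution 0 0 s
  obtain ⟨c, hc⟩ := P.exists_displacement_bound
  have hev : ∀ᶠ s in 𝓝[>] (0 : ℝ), s ∈ Ioc 0 (P.ρ / 64) :=
    Ioc_mem_nhdsGT (by linarith [P.ρ_pos])
  refine ⟨fun s => R s (2 * Real.pi), ?_, ?_⟩
  · filter_upwards [hev] with s hs
    exact firstReturn_of_angular (hR s) (hR0 s) hs.1 hs.2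
  · have hO : (fun s => R s (2 * Real.pi) - s - 6 * Real.pi * η / (Nat.factorial 3 : ℝ) * s ^ 3)
        =O[𝓝[>] 0] fun s : ℝ => s ^ 4 := by
      refine IsBigO.of_bound c ?_
      filter_upwards [hev] with s hs
      rw [Real.norm_eq_abs, Real.norm_eq_abs, abs_of_pos (pow_pos hs.1 4)]
      refine le_trans (le_of_eq ?_) (hc (R s) s (hR s) (hR0 s) hs.1 hs.2)
      have h6 : (Nat.factorial 3 : ℝ) = 6 := by norm_num [Nat.factorial]
      rw [h6]
      congr 1
      ring
    exact hO.trans_isLittleO ((isLittleO_pow_pow (by norm_num : 3 < 4)).mono nhdsWithin_le_nhds)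

end PolarForm

end BoundaryHopf

/-! ### Asymptotic stability of the origin for `α < 0` -/

namespace BoundaryHopf

theorem exists_polar (p : ℝ × ℝ) : ∃ r θ : ℝ, 0 ≤ r ∧ p = (r * Real.cos θ, r * Real.sin θ) := by
  refine ⟨‖(⟨p.1, p.2⟩ : ℂ)‖, (⟨p.1, p.2⟩ : ℂ).arg, norm_nonneg _, Prod.ext ?_ ?_⟩
  · simp [Complex.norm_mul_cos_arg]
  · simp [Complex.norm_mul_sin_arg]

theorem polar_sq (r θ : ℝ) : (r * Real.cos θ) ^ 2 + (r * Real.sin θ) ^ 2 = r ^ 2 := by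
  linear_combination r ^ 2 * Real.sin_sq_add_cos_sq θ

theorem dist_polar_le (r s θ : ℝ) :
    dist (r * Real.cos θ, r * Real.sin θ) (s * Real.cos θ, s * Real.sin θ) ≤ |r - s| := by
  rw [Prod.dist_eq, Real.dist_eq, Real.dist_eq, ← sub_mul, ← sub_mul, abs_mul, abs_mul]
  exact max_le (mul_le_of_le_one_right (abs_nonneg _) (Real.abs_cos_le_one θ))
    (mul_le_of_le_one_right (abs_nonneg _) (Real.abs_sin_le_one θ))

theorem isOpen_sq_lt (c : ℝ) : IsOpen {p : ℝ × ℝ | p.1 ^ 2 + p.2 ^ 2 < c} :=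
  isOpen_lt (by fun_prop) continuous_const

theorem exists_disc_subset {U : Set (ℝ × ℝ)} (hU : U ∈ 𝓝 (0 : ℝ × ℝ)) :
    ∃ δ > 0, ∀ p : ℝ × ℝ, p.1 ^ 2 + p.2 ^ 2 ≤ δ ^ 2 → p ∈ U := by
  obtain ⟨ε, hε, h⟩ := Metric.mem_nhds_iff.1 hU
  refine ⟨ε / 2, half_pos hε, fun p hp => h ?_⟩
  have h1 : |p.1| ≤ ε / 2 := abs_le_of_sq_le_sq (by nlinarith [sq_nonneg p.2]) (half_pos hε).le
  have h2 : |p.2| ≤ ε / 2 := abs_le_of_sq_le_sq (by nlinarith [sq_nonneg p.1]) (half_pos hε).le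
  rw [Metric.mem_ball, Prod.dist_eq, Real.dist_eq, Real.dist_eq]
  simp only [Prod.fst_zero, Prod.snd_zero, sub_zero]
  exact (max_le h1 h2).trans_lt (half_lt_self hε)

namespace PolarForm

variable {X : ℝ → ℝ × ℝ → ℝ × ℝ} {η : ℝ} {P : PolarForm X η} {α : ℝ} {R : ℝ → ℝ}

theorem continuous_angular (hR : ∀ θ, HasDerivAt R (P.slope α θ (R θ)) θ) : Continuous R :=
  continuous_iff_continuousAt.2 fun t => (hR t).continuousAt

theorem angular_nonneg (hR : ∀ θ, HasDerivAt R (P.slope α θ (R θ)) θ) {θ₀ : ℝ} (h : 0 ≤ R θ₀)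
    (θ : ℝ) : 0 ≤ R θ := by
  obtain ⟨K, h1, -, -⟩ := P.exists_lipschitz_slope α
  exact solution_le_of_le (γ := fun _ => 0) h1
    (fun t => by rw [P.slope_zero]; exact hasDerivAt_const _ _) hR h θ

/-- For `M δ ≤ -α / 2` the term `r A` uses up at most half of `α`, and dividing by `1 + r C` loses
at most another factor 2. -/
theorem slope_le_of_small {δ r : ℝ} (hα : α < 0) (hδρ : δ ≤ P.ρ) (hδα : P.M * δ ≤ -α / 2)
    (hr : r ∈ Icc 0 δ) (θ : ℝ) : P.slope α θ r ≤ α / 4 * r := by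
  have hmem : r ∈ Icc 0 P.ρ := ⟨hr.1, hr.2.trans hδρ⟩
  have h1 := (abs_le.1 (P.abs_mul_A_le θ hmem)).2
  have hM := P.one_le_M
  have h2 : α + r * P.A r θ ≤ α / 2 := by nlinarith [hr.2]
  have h3 := P.angular_le θ hmem
  have h4 := P.angular_ge θ hmem
  have h5 : 1 / 2 ≤ (1 + r * P.C r θ)⁻¹ := by
    rw [le_inv_comm₀ (by norm_num) (by linarith)]
    linarith
  rw [P.slope_of_mem α θ hmem]
  have h6 : r * (α + r * P.A r θ) ≤ r * (α / 2) := mul_le_mul_of_nonneg_left h2 hr.1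
  nlinarith [hr.1, mul_nonneg hr.1 (neg_nonneg.2 hα.le)]

theorem angular_decay {δ θ₀ : ℝ} (hR : ∀ θ, HasDerivAt R (P.slope α θ (R θ)) θ)
    (hα : α < 0) (hδ : 0 < δ) (hδρ : δ ≤ P.ρ) (hδα : P.M * δ ≤ -α / 2) (h0 : R θ₀ ∈ Icc 0 δ) :
    ∀ θ, θ₀ ≤ θ → R θ ∈ Icc 0 δ ∧ R θ ≤ R θ₀ * Real.exp (α / 4 * (θ - θ₀)) := by
  have hnn := angular_nonneg hR h0.1
  have hle : ∀ θ, θ₀ ≤ θ → R θ ≤ δ :=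
    le_of_deriv_neg_at_level (continuous_angular hR) h0.2 fun θ _ h => ⟨_, by
      have := slope_le_of_small hα hδρ hδα (r := R θ) ⟨hnn θ, h.le⟩ θ
      rw [h] at this ⊢
      nlinarith, hR θ⟩
  have hexp := le_exp_mul_of_deriv_le (κ := -(α / 4)) (a := θ₀) (fun θ _ => hR θ) fun θ hθ => by
    rw [neg_neg]
    exact slope_le_of_small hα hδρ hδα (r := R θ) ⟨hnn θ, hle θ hθ⟩ θ
  refine fun θ hθ => ⟨⟨hnn θ, hle θ hθ⟩, ?_⟩
  simpa using hexp θ hθ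

/-- For `α < 0` the origin is asymptotically stable. -/
theorem asymptoticallyStable_origin (P : PolarForm X η) (hα : α < 0) :
    AsymptoticallyStable (X α) {0} := by
  intro U hU h0U
  obtain ⟨δ₀, hδ₀, hsub⟩ := exists_disc_subset (hU.mem_nhds (h0U rfl))
  have hM := P.one_le_M
  have hρ := P.ρ_pos
  set δ := min δ₀ (min P.ρ (-α / (2 * P.M))) with hδ
  have hδpos : 0 < δ := by
    have : 0 < -α / (2 * P.M) := div_pos (by linarith) (by linarith)
    positivity
  have hδρ : δ ≤ P.ρ := (min_le_right _ _).trans (min_le_left _ _)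
  have hδα : P.M * δ ≤ -α / 2 := by
    have : δ ≤ -α / (2 * P.M) := (min_le_right _ _).trans (min_le_right _ _)
    rw [le_div_iff₀ (by linarith)] at this
    linarith
  refine ⟨{p | p.1 ^ 2 + p.2 ^ 2 < δ ^ 2}, isOpen_sq_lt _, ?_, fun p hp => ?_⟩
  · rw [singleton_subset_iff]
    simpa using pow_pos hδpos 2
  obtain ⟨r, θ₀, hr, rfl⟩ := exists_polar p
  replace hp : r ^ 2 < δ ^ 2 := polar_sq r θ₀ ▸ hp
  have hrδ : r ≤ δ := ((sq_lt_sq₀ hr hδpos.le).1 hp).le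
  obtain ⟨R, hR0, hR⟩ := P.exists_angular_solution α θ₀ r
  have hdec := angular_decay hR hα hδpos hδρ hδα (θ₀ := θ₀) (by rw [hR0]; exact ⟨hr, hrδ⟩)
  obtain ⟨Θ, hΘ0, hΘ, hγ⟩ := exists_planar_of_angular hR θ₀
  have hge := fun t => half_le_speed (P := P) (R := R) (Θ t)
  have hmono := strictMono_of_deriv_ge (by norm_num) hΘ hge
  have htop := tendsto_atTop_of_deriv_ge (by norm_num) hΘ hge
  have hΘge : ∀ t, 0 ≤ t → θ₀ ≤ Θ t := fun t ht => hΘ0 ▸ hmono.monotone ht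
  refine ⟨fun t => (R (Θ t) * Real.cos (Θ t), R (Θ t) * Real.sin (Θ t)), by simp [hΘ0, hR0],
    fun t ht => (hγ t ?_).hasDerivWithinAt, fun t ht => hsub _ ?_, ?_⟩
  · have := (hdec _ (hΘge t ht)).1
    exact ⟨this.1, this.2.trans hδρ⟩
  · rw [polar_sq]
    have := (hdec _ (hΘge t ht)).1
    exact pow_le_pow_left₀ this.1 (this.2.trans (min_le_left _ _)) 2
  · have hlim : Tendsto (fun t => R θ₀ * Real.exp (α / 4 * (Θ t - θ₀))) atTop (𝓝 0) := by
      rw [← mul_zero (R θ₀)]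
      refine tendsto_const_nhds.mul (Real.tendsto_exp_atBot.comp ?_)
      exact (tendsto_atTop_add_const_right _ (-θ₀) htop).const_mul_atTop_of_neg (by linarith)
    refine squeeze_zero' (Eventually.of_forall fun t => Metric.infDist_nonneg) ?_ hlim
    filter_upwards [eventually_ge_atTop (0 : ℝ)] with t ht
    have := hdec _ (hΘge t ht)
    rw [Metric.infDist_singleton]
    have h1 := dist_polar_le (R (Θ t)) 0 (Θ t)
    rw [sub_zero, abs_of_nonneg this.1.1] at h1
    refine le_trans (le_of_eq ?_) (h1.trans this.2)
    congr 1
    simp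
    rfl

end PolarForm

end BoundaryHopf

/-! ### Trapping annulus, contraction and existence of the cycle for `η < 0` -/

namespace BoundaryHopf

namespace PolarForm

variable {X : ℝ → ℝ × ℝ → ℝ × ℝ} {η : ℝ} (P : PolarForm X η) {α m : ℝ} {R : ℝ → ℝ}

theorem exp_w {r : ℝ} (θ : ℝ) (hr : r ∈ Ioc 0 P.ρ) : Real.exp (P.w r θ) = r ^ 2 * P.q r θ := by
  have hq := P.half_le_q θ r (Ioc_subset_Icc_self hr)
  rw [w, Real.exp_add, Real.exp_log (by linarith), two_mul, Real.exp_add, Real.exp_log hr.1, sq]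

theorem exp_w_bounds {r : ℝ} (θ : ℝ) (hr : r ∈ Ioc 0 P.ρ) :
    r ^ 2 / 2 ≤ Real.exp (P.w r θ) ∧ Real.exp (P.w r θ) ≤ 2 * r ^ 2 := by
  have h1 := P.half_le_q θ r (Ioc_subset_Icc_self hr)
  have h2 := P.q_le_two θ r (Ioc_subset_Icc_self hr)
  rw [P.exp_w θ hr]
  constructor <;> nlinarith [sq_nonneg r]

/-- At a fixed angle, distances in `w` and in `r` are comparable: `2 log r` dominates `log q`, whose
Lipschitz constant `M` is at most `1 / r` and `1 / s`. The lower constant can be taken to be 1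
because `s ≤ 1`. -/
theorem w_sub_bounds {r s : ℝ} (θ : ℝ) (hr : r ∈ Ioc 0 P.ρ) (hs : s ∈ Ioc 0 P.ρ) (hrs : r ≤ s) :
    s - r ≤ P.w s θ - P.w r θ ∧ P.w s θ - P.w r θ ≤ 3 / r * (s - r) := by
  have hlog : Real.log s - Real.log r = Real.log (s / r) := (Real.log_div hs.1.ne' hr.1.ne').symm
  have hpos : 0 < s / r := div_pos hs.1 hr.1
  have h1 := Real.log_le_sub_one_of_pos hpos
  have h2 := Real.one_sub_inv_le_log_of_pos hpos
  have hq := abs_le.1 (P.log_q_lipschitz θ s (Ioc_subset_Icc_self hs) r (Ioc_subset_Icc_self hr))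
  rw [abs_of_nonneg (sub_nonneg.2 hrs)] at hq
  have hsr : s / r - 1 = (s - r) / r := by have := hr.1.ne'; field_simp
  have hrs' : 1 - (s / r)⁻¹ = (s - r) / s := by
    have := hr.1.ne'
    have := hs.1.ne'
    field_simp
  have hMr : P.M ≤ 1 / r := by
    rw [le_div_iff₀ hr.1]; linarith [P.M_mul_le hr.2]
  have hMs : P.M ≤ 1 / s := by
    rw [le_div_iff₀ hs.1]; linarith [P.M_mul_le hs.2]
  have hs1 : 1 ≤ 1 / s := by
    rw [le_div_iff₀ hs.1]; linarith [P.ρ_le, hs.2]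
  have hd := sub_nonneg.2 hrs
  rw [hsr] at h1
  rw [hrs'] at h2
  have e : P.w s θ - P.w r θ = 2 * (Real.log s - Real.log r) +
    (Real.log (P.q s θ) - Real.log (P.q r θ)) := by rw [w, w]; ring
  rw [e, hlog]
  constructor
  · have h3 : P.M * (s - r) ≤ (s - r) / s := by
      rw [div_eq_mul_one_div, mul_comm]; exact mul_le_mul_of_nonneg_left hMs hd
    have h4 : s - r ≤ (s - r) / s := by
      rw [div_eq_mul_one_div]; exact le_mul_of_one_le_right hd hs1
    linarith
  · have h3 : P.M * (s - r) ≤ (s - r) / r := by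
      rw [div_eq_mul_one_div, mul_comm]; exact mul_le_mul_of_nonneg_left hMr hd
    have h4 : 3 / r * (s - r) = 3 * ((s - r) / r) := by ring
    linarith

theorem le_of_w_le {r s θ : ℝ} (hr : r ∈ Ioc 0 P.ρ) (hs : s ∈ Ioc 0 P.ρ)
    (h : P.w r θ ≤ P.w s θ) : r ≤ s := by
  by_contra! hlt
  have := (P.w_sub_bounds θ hs hr hlt.le).1
  linarith

theorem w_le_of_le {r s : ℝ} (θ : ℝ) (hr : r ∈ Ioc 0 P.ρ) (hs : s ∈ Ioc 0 P.ρ)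
    (h : r ≤ s) : P.w r θ ≤ P.w s θ := by
  have := (P.w_sub_bounds θ hr hs h).1
  linarith

section Supercritical

theorem K_neg_of_nonpos (hη : η < 0) (hα : α ≤ 0) {r : ℝ} (θ : ℝ) (hr : r ∈ Ioc 0 P.ρ) :
    P.K α r θ < 0 := by
  have hr' := Ioc_subset_Icc_self hr
  have h1 := abs_le.1 (P.K₁_near θ r hr')
  have h2 := abs_le.1 (P.K₂_near θ r hr')
  have h3 := P.M_mul_le hr.2
  have h4 := P.M_mul_le_η hr.2
  rw [abs_of_neg hη] at h4
  have hr2 : 0 < r ^ 2 := pow_pos hr.1 2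
  have h5 : P.M * r ^ 3 ≤ -η / 100 * r ^ 2 := by nlinarith
  have h6 : α * P.K₁ r θ ≤ 0 := mul_nonpos_of_nonpos_of_nonneg hα (by linarith [h1.1])
  rw [K]
  nlinarith

/-- The standing hypotheses on the scale `m` of the limit cycle for a given parameter `α`. -/
structure Scale (P : PolarForm X η) (α m : ℝ) : Prop where
  η_neg : η < 0
  m_pos : 0 < m
  two_mul_α : 2 * α = -η * m ^ 2
  m_le : 10000 * m ≤ P.ρ

variable {P}

namespace Scale

theorem α_pos (h : Scale P α m) : 0 < α := by
  have := h.two_mul_α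
  have h1 := h.η_neg
  have h2 := pow_pos h.m_pos 2
  nlinarith

/-- At such radii `-η r²` is at least twice `2 α`, and relative errors of one percent in the two
terms cannot restore the sign. -/
theorem K_neg (h : Scale P α m) {r : ℝ} (θ : ℝ) (hr : r ∈ Ioc 0 P.ρ) (hrm : 2 * m ^ 2 ≤ r ^ 2) : P.K α r θ < 0 := by
  have hr' := Ioc_subset_Icc_self hr
  have h1 := abs_le.1 (P.K₁_near θ r hr')
  have h2 := abs_le.1 (P.K₂_near θ r hr')
  have h3 := P.M_mul_le hr.2
  have h4 := P.M_mul_le_η hr.2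
  have hη := h.η_neg
  rw [abs_of_neg hη] at h4
  have hr2 : 0 < r ^ 2 := pow_pos hr.1 2
  have h5 : P.M * r ^ 3 ≤ -η / 100 * r ^ 2 := by nlinarith
  have h6 : α * P.K₁ r θ ≤ α * (201 / 100) :=
    mul_le_mul_of_nonneg_left (by linarith [h1.2]) h.α_pos.le
  have h7 : 2 * α ≤ -η * (r ^ 2 / 2) := by
    rw [h.two_mul_α]; exact mul_le_mul_of_nonneg_left (by linarith) (by linarith)
  rw [K]
  nlinarith

theorem K_pos (h : Scale P α m) {r : ℝ} (θ : ℝ) (hr : r ∈ Ioc 0 P.ρ) (hrm : r ^ 2 ≤ m ^ 2 / 2) : 0 < P.K α r θ := by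
  have hr' := Ioc_subset_Icc_self hr
  have h1 := abs_le.1 (P.K₁_near θ r hr')
  have h2 := abs_le.1 (P.K₂_near θ r hr')
  have h3 := P.M_mul_le hr.2
  have h4 := P.M_mul_le_η hr.2
  have hη := h.η_neg
  rw [abs_of_neg hη] at h4
  have hr2 : 0 < r ^ 2 := pow_pos hr.1 2
  have h5 : P.M * r ^ 3 ≤ -η / 100 * r ^ 2 := by nlinarith
  have h6 : α * (199 / 100) ≤ α * P.K₁ r θ :=
    mul_le_mul_of_nonneg_left (by linarith [h1.1]) h.α_pos.le
  have h7 : -η * (2 * r ^ 2) ≤ 2 * α := by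
    rw [h.two_mul_α]; exact mul_le_mul_of_nonneg_left (by linarith) (by linarith)
  rw [K]
  nlinarith

theorem mem_of_mem (h : Scale P α m) {r : ℝ} (hr : r ∈ Icc (m / 32) (32 * m)) : r ∈ Ioc 0 P.ρ :=
  ⟨by linarith [hr.1, h.m_pos], by linarith [hr.2, h.m_le, h.m_pos]⟩

/-- The term `η r²` decreases in `r` at rate at least `-η m / 16` on this range. Since `α` is of
order `m²` and `M m` is tiny compared with `-η`, each of the two error terms changes at rate at most
`-η m / 100`. -/
theorem K_sub_le (h : Scale P α m) {r s : ℝ} (θ : ℝ) (hr : r ∈ Icc (m / 32) (32 * m))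
    (hs : s ∈ Icc (m / 32) (32 * m)) (hrs : r ≤ s) :
    P.K α s θ - P.K α r θ ≤ -(-η * m / 32) * (s - r) := by
  have hm := h.m_pos
  have h1 := abs_le.1 (P.K₁_lipschitz θ s (Ioc_subset_Icc_self (h.mem_of_mem hs)) r
    (Ioc_subset_Icc_self (h.mem_of_mem hr)))
  have h2 := abs_le.1 (P.K₂_lipschitz θ (32 * m) (by linarith [h.m_le]) s
    ⟨by linarith [hs.1], hs.2⟩ r ⟨by linarith [hr.1], hr.2⟩)
  rw [abs_of_nonneg (sub_nonneg.2 hrs)] at h1 h2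
  have h4 := P.M_mul_le_η h.m_le
  have hη := h.η_neg
  rw [abs_of_neg hη] at h4
  have hα := h.α_pos
  have hMm : P.M * m ≤ -η / 1000000 := by linarith
  have hMm2 := P.M_mul_le h.m_le
  have hd := sub_nonneg.2 hrs
  have h5 : α * (P.K₁ s θ - P.K₁ r θ) ≤ α * (P.M * (s - r)) :=
    mul_le_mul_of_nonneg_left h1.2 hα.le
  have h6 : α * P.M ≤ -η * m / 100 := by
    have : 2 * (α * P.M) = -η * m * (P.M * m) := by
      linear_combination P.M * h.two_mul_α
    have h8 : -η * m * (P.M * m) ≤ -η * m * (1 / 1000000) :=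
      mul_le_mul_of_nonneg_left (by linarith) (by nlinarith)
    nlinarith
  have h7 : P.M * (32 * m) ^ 2 ≤ -η * m / 100 := by
    have : P.M * (32 * m) ^ 2 = 1024 * (P.M * m) * m := by ring
    rw [this]
    nlinarith
  have h8 : η * (s ^ 2 - r ^ 2) ≤ η * (m / 16) * (s - r) := by
    have : η * (s ^ 2 - r ^ 2) = η * ((s + r) * (s - r)) := by ring
    rw [this, mul_assoc]
    exact mul_le_mul_of_nonpos_left
      (mul_le_mul_of_nonneg_right (by linarith [hr.1, hs.1]) hd) hη.le
  have h9 := mul_le_mul_of_nonneg_right h6 hd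
  have h10 := mul_le_mul_of_nonneg_right h7 hd
  have e : P.K α s θ - P.K α r θ = α * (P.K₁ s θ - P.K₁ r θ) +
    ((P.K₂ s θ - η * s ^ 2) - (P.K₂ r θ - η * r ^ 2)) + η * (s ^ 2 - r ^ 2) := by
    rw [K, K]; ring
  have hpos : 0 ≤ -η * m * (s - r) := mul_nonneg (by nlinarith) hd
  rw [e]
  linarith [h2.2]

/-- The difference of `w` along two trajectories is contracted. -/
theorem contraction (h : Scale P α m) {r s : ℝ} (θ : ℝ) (hr : r ∈ Icc (m / 32) (32 * m))
    (hs : s ∈ Icc (m / 32) (32 * m)) :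
    (P.w s θ - P.w r θ) * (P.K α s θ - P.K α r θ) ≤
      -(-η * m ^ 2 / 3072) * (P.w s θ - P.w r θ) ^ 2 := by
  have hm := h.m_pos
  have hη := h.η_neg
  have key : ∀ r ∈ Icc (m / 32) (32 * m), ∀ s ∈ Icc (m / 32) (32 * m), r ≤ s →
      (P.w s θ - P.w r θ) * (P.K α s θ - P.K α r θ) ≤
      -(-η * m ^ 2 / 3072) * (P.w s θ - P.w r θ) ^ 2 := by
    intro r hr s hs hrs
    obtain ⟨h1, h2⟩ := P.w_sub_bounds θ (h.mem_of_mem hr) (h.mem_of_mem hs) hrs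
    have h3 := h.K_sub_le θ hr hs hrs
    have hd := sub_nonneg.2 hrs
    have h4 : 3 / r ≤ 96 / m := by
      rw [div_le_div_iff₀ (h.mem_of_mem hr).1 hm]
      linarith [hr.1]
    set D := P.w s θ - P.w r θ with hD
    have hD0 : 0 ≤ D := hd.trans h1
    have h5 : D ≤ 96 / m * (s - r) := h2.trans (mul_le_mul_of_nonneg_right h4 hd)
    have h6 : m / 96 * D ≤ s - r := by
      calc m / 96 * D ≤ m / 96 * (96 / m * (s - r)) := by gcongr
        _ = s - r := by field_simp
    have h7 : -η * m / 32 * (m / 96 * D) ≤ -η * m / 32 * (s - r) :=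
      mul_le_mul_of_nonneg_left h6 (by nlinarith)
    calc D * (P.K α s θ - P.K α r θ) ≤ D * (-(-η * m / 32 * (m / 96 * D))) :=
          mul_le_mul_of_nonneg_left (by linarith) hD0
      _ = -(-η * m ^ 2 / 3072) * D ^ 2 := by ring
  rcases le_total r s with hrs | hrs
  · exact key r hr s hs hrs
  · have := key s hs r hr hrs
    nlinarith

theorem rate_pos (h : Scale P α m) : 0 < -η * m ^ 2 / 3072 := by
  have := h.η_neg
  have := pow_pos h.m_pos 2
  have : 0 < -η * m ^ 2 := by nlinarith
  linarith

/-- Truncating the radius at `ρ` keeps `w` continuous and controlled before `R ≤ ρ` is known; the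
barrier arguments run on this truncation and afterwards show that it is inactive. -/
theorem continuous_w_min (hRc : Continuous R) (hpos : ∀ θ, 0 < R θ) :
    Continuous fun θ => P.w (min (R θ) P.ρ) θ := by
  have hc : Continuous fun θ => min (R θ) P.ρ := hRc.min continuous_const
  have h1 : ∀ θ, 0 < min (R θ) P.ρ := fun θ => lt_min (hpos θ) P.ρ_pos
  have hq : Continuous fun θ => P.q (min (R θ) P.ρ) θ :=
    P.continuous_q.comp (hc.prodMk continuous_id)
  exact (continuous_const.mul (hc.log fun θ => (h1 θ).ne')).add
    (hq.log fun θ => by linarith [P.half_le_q θ _ ⟨(h1 θ).le, min_le_right _ _⟩])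

theorem hasDerivAt_w_min (hR : ∀ θ, HasDerivAt R (P.slope α θ (R θ)) θ) {θ : ℝ}
    (hmem : R θ ∈ Ioo 0 P.ρ) :
    HasDerivAt (fun θ => P.w (min (R θ) P.ρ) θ) (P.K α (R θ) θ) θ := by
  refine (hasDerivAt_w_angular hR ⟨hmem.1, hmem.2.le⟩).congr_of_eventuallyEq ?_
  filter_upwards [(hR θ).continuousAt.eventually (gt_mem_nhds hmem.2)] with φ hφ
  rw [min_eq_left hφ.le]

/-- Sublevel sets of `w` that contain the limit cycle are positively invariant. -/
theorem upper_invariant (h : Scale P α m) {B θ₀ : ℝ} (hR : ∀ θ, HasDerivAt R (P.slope α θ (R θ)) θ)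
    (hB₁ : 4 * m ^ 2 ≤ Real.exp B) (hB₂ : Real.exp B ≤ 256 * m ^ 2) (h0 : R θ₀ ∈ Ioc 0 P.ρ)
    (hw : P.w (R θ₀) θ₀ ≤ B) (θ : ℝ) (hθ : θ₀ ≤ θ) : R θ ∈ Ioc 0 P.ρ ∧ P.w (R θ) θ ≤ B := by
  have hm := h.m_pos
  have hpos := angular_pos hR h0.1
  have hmem : ∀ θ, min (R θ) P.ρ ∈ Ioc 0 P.ρ := fun θ => ⟨lt_min (hpos θ) P.ρ_pos, min_le_right _ _⟩
  have small : ∀ θ, P.w (min (R θ) P.ρ) θ ≤ B → R θ < P.ρ := by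
    intro θ hle
    have h1 := (P.exp_w_bounds θ (hmem θ)).1.trans ((Real.exp_le_exp.2 hle).trans hB₂)
    by_contra! hge
    rw [min_eq_right hge] at h1
    nlinarith [h.m_le]
  have hle := le_of_deriv_neg_at_level (continuous_w_min (continuous_angular hR) hpos) (a := θ₀)
    (B := B) (by rw [min_eq_left h0.2]; exact hw) (fun φ _ he => by
      have h1 := small φ he.le
      refine ⟨_, ?_, hasDerivAt_w_min hR ⟨hpos φ, h1⟩⟩
      rw [min_eq_left h1.le] at he
      have h2 := (P.exp_w_bounds φ ⟨hpos φ, h1.le⟩).2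
      rw [he] at h2
      exact h.K_neg φ ⟨hpos φ, h1.le⟩ (by linarith)) θ hθ
  have h1 := small θ hle
  rw [min_eq_left h1.le] at hle
  exact ⟨⟨hpos θ, h1.le⟩, hle⟩

/-- Superlevel sets of `w` that contain the limit cycle are positively invariant. -/
theorem lower_invariant (h : Scale P α m) {B θ₀ : ℝ} (hR : ∀ θ, HasDerivAt R (P.slope α θ (R θ)) θ)
    (hB : Real.exp B ≤ m ^ 2 / 4) (h0 : R θ₀ ∈ Ioc 0 P.ρ)
    (hw : B ≤ P.w (R θ₀) θ₀) (θ : ℝ) (hθ : θ₀ ≤ θ) : B ≤ P.w (min (R θ) P.ρ) θ := by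
  have hm := h.m_pos
  have hpos := angular_pos hR h0.1
  have hmem : ∀ θ, min (R θ) P.ρ ∈ Ioc 0 P.ρ := fun θ => ⟨lt_min (hpos θ) P.ρ_pos, min_le_right _ _⟩
  refine ge_of_deriv_pos_at_level (continuous_w_min (continuous_angular hR) hpos) (a := θ₀)
    (B := B) (by rw [min_eq_left h0.2]; exact hw) (fun φ _ he => ?_) θ hθ
  have h1 := (P.exp_w_bounds φ (hmem φ)).1
  rw [he] at h1
  have h2 : R φ < P.ρ := by
    by_contra! hge
    rw [min_eq_right hge] at h1
    nlinarith [h.m_le]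
  rw [min_eq_left h2.le] at h1
  exact ⟨_, h.K_pos φ ⟨hpos φ, h2.le⟩ (by linarith), hasDerivAt_w_min hR ⟨hpos φ, h2⟩⟩

theorem invariant (h : Scale P α m) {B B' θ₀ : ℝ} (hR : ∀ θ, HasDerivAt R (P.slope α θ (R θ)) θ)
    (hB₁ : 4 * m ^ 2 ≤ Real.exp B) (hB₂ : Real.exp B ≤ 256 * m ^ 2)
    (hB' : Real.exp B' ≤ m ^ 2 / 4) (h0 : R θ₀ ∈ Ioc 0 P.ρ)
    (hw : P.w (R θ₀) θ₀ ≤ B) (hw' : B' ≤ P.w (R θ₀) θ₀) (θ : ℝ) (hθ : θ₀ ≤ θ) :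
    R θ ∈ Ioc 0 P.ρ ∧ R θ ^ 2 ≤ 2 * Real.exp B ∧ Real.exp B' / 2 ≤ R θ ^ 2 := by
  obtain ⟨h1, h2⟩ := h.upper_invariant hR hB₁ hB₂ h0 hw θ hθ
  have h3 := h.lower_invariant hR hB' h0 hw' θ hθ
  rw [min_eq_left h1.2] at h3
  obtain ⟨h4, h5⟩ := P.exp_w_bounds θ h1
  have h6 := Real.exp_le_exp.2 h2
  have h7 := Real.exp_le_exp.2 h3
  exact ⟨h1, by linarith, by linarith⟩

theorem mem_of_sq (h : Scale P α m) {r a b : ℝ} (hr : 0 < r) (ha : 0 ≤ a) (hb : 0 ≤ b) (h1 : (a * m) ^ 2 ≤ r ^ 2)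
    (h2 : r ^ 2 ≤ (b * m) ^ 2) : r ∈ Icc (a * m) (b * m) :=
  ⟨(sq_le_sq₀ (mul_nonneg ha h.m_pos.le) hr.le).1 h1,
    (sq_le_sq₀ hr.le (mul_nonneg hb h.m_pos.le)).1 h2⟩

/-- Every trajectory that starts near the limit cycle stays in the contraction region. -/
theorem stays_in_zone (h : Scale P α m) {θ₀ : ℝ} (hR : ∀ θ, HasDerivAt R (P.slope α θ (R θ)) θ)
    (h0 : R θ₀ ∈ Icc (m / 11) (11 * m)) (θ : ℝ) (hθ : θ₀ ≤ θ) :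
    R θ ∈ Icc (m / 32) (32 * m) := by
  have hm := h.m_pos
  have hm2 := pow_pos hm 2
  have h0' : R θ₀ ∈ Ioc 0 P.ρ := h.mem_of_mem ⟨by linarith [h0.1], by linarith [h0.2]⟩
  obtain ⟨h1, h2⟩ := P.exp_w_bounds θ₀ h0'
  -- Since `r² / 2 ≤ exp w ≤ 2 r²`, starting in `[m / 11, 11 m]` puts `exp w` between `m² / 242` and
  -- `242 m²`. The levels `m² / 256` and `256 m²` therefore trap the orbit, with `r²` between `m² /
  -- 512` and `512 m²`.
  have e1 : Real.exp (Real.log (256 * m ^ 2)) = 256 * m ^ 2 := Real.exp_log (by positivity)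
  have e2 : Real.exp (Real.log (m ^ 2 / 256)) = m ^ 2 / 256 := Real.exp_log (by positivity)
  have hsq1 : R θ₀ ^ 2 ≤ (11 * m) ^ 2 := pow_le_pow_left₀ h0'.1.le h0.2 2
  have hsq2 : (m / 11) ^ 2 ≤ R θ₀ ^ 2 := pow_le_pow_left₀ (by positivity) h0.1 2
  obtain ⟨h3, h4, h5⟩ := h.invariant hR (B := Real.log (256 * m ^ 2))
    (B' := Real.log (m ^ 2 / 256)) (by rw [e1]; linarith) (by rw [e1]) (by rw [e2]; linarith) h0'
    (by rw [← Real.exp_le_exp, e1]; nlinarith) (by rw [← Real.exp_le_exp, e2]; nlinarith) θ hθ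
  rw [e1] at h4
  rw [e2] at h5
  have := h.mem_of_sq (a := 1 / 32) (b := 32) h3.1 (by norm_num) (by norm_num) (by nlinarith)
    (by nlinarith)
  exact ⟨by linarith [this.1], this.2⟩

/-- The radius of the limit cycle as a function of the polar angle. -/
theorem exists_periodic_angular (h : Scale P α m) : ∃ R : ℝ → ℝ, (∀ θ, HasDerivAt R (P.slope α θ (R θ)) θ) ∧
    Function.Periodic R (2 * Real.pi) ∧ ∀ θ, R θ ∈ Icc (m / 8) (8 * m) := by
  have hm := h.m_pos
  have hm2 := pow_pos hm 2
  have hπ := Real.two_pi_pos.le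
  choose S hS0 hS using fun s => P.exists_angular_solution α 0 s
  obtain ⟨K, hlip, -, -⟩ := P.exists_lipschitz_slope α
  set f : ℝ → ℝ := fun s => S s (2 * Real.pi) with hf
  have hmono : Monotone f := fun s t hst =>
    solution_le_of_le hlip (hS s) (hS t) (t₀ := 0) (by rwa [hS0, hS0]) _
  have ha : m / 4 ∈ Ioc 0 P.ρ := h.mem_of_mem ⟨by linarith, by linarith⟩
  have hb : 4 * m ∈ Ioc 0 P.ρ := h.mem_of_mem ⟨by linarith, by linarith⟩
  obtain ⟨ha1, ha2⟩ := P.exp_w_bounds 0 ha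
  obtain ⟨hb1, hb2⟩ := P.exp_w_bounds 0 hb
  have hinv : ∀ s ∈ Icc (m / 4) (4 * m), ∀ θ, 0 ≤ θ →
      S s θ ∈ Icc (m / 8) (8 * m) ∧ P.w (S s θ) θ ≤ P.w (4 * m) 0 ∧
        P.w (m / 4) 0 ≤ P.w (S s θ) θ := by
    intro s hs θ hθ
    have hs' : s ∈ Ioc 0 P.ρ := h.mem_of_mem ⟨by linarith [hs.1], by linarith [hs.2]⟩
    have hw1 := P.w_le_of_le 0 hs' hb hs.2
    have hw2 := P.w_le_of_le 0 ha hs' hs.1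
    obtain ⟨h1, h2⟩ := h.upper_invariant (hS s) (B := P.w (4 * m) 0) (θ₀ := 0) (by nlinarith)
      (by nlinarith) (by rwa [hS0]) (by rwa [hS0]) θ hθ
    have h3 := h.lower_invariant (hS s) (B := P.w (m / 4) 0) (θ₀ := 0) (by nlinarith)
      (by rwa [hS0]) (by rwa [hS0]) θ hθ
    rw [min_eq_left h1.2] at h3
    obtain ⟨h4, h5⟩ := P.exp_w_bounds θ h1
    have h6 := Real.exp_le_exp.2 h2
    have h7 := Real.exp_le_exp.2 h3
    have := h.mem_of_sq (a := 1 / 8) (b := 8) h1.1 (by norm_num) (by norm_num) (by nlinarith)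
      (by nlinarith)
    exact ⟨⟨by linarith [this.1], this.2⟩, h2, h3⟩
  have hab : m / 4 ≤ 4 * m := by linarith
  -- The trapping levels are those of `w` through the endpoints at angle `0`. By periodicity of `w`
  -- they cut out the same interval at angle `2π`.
  have hmaps : ∀ s ∈ Icc (m / 4) (4 * m), f s ∈ Icc (m / 4) (4 * m) := by
    intro s hs
    obtain ⟨h1, h2, h3⟩ := hinv s hs (2 * Real.pi) hπ
    have hper : P.w (S s (2 * Real.pi)) (2 * Real.pi) = P.w (S s (2 * Real.pi)) 0 := by
      simpa using P.w_periodic (S s (2 * Real.pi)) 0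
    rw [hper] at h2 h3
    have hmem : S s (2 * Real.pi) ∈ Ioc 0 P.ρ :=
      h.mem_of_mem ⟨by linarith [h1.1], by linarith [h1.2]⟩
    exact ⟨P.le_of_w_le ha hmem h3, P.le_of_w_le hmem hb h2⟩
  obtain ⟨z, hz, hfz⟩ : ∃ z ∈ Icc (m / 4) (4 * m), f z = z := by
    -- Knaster–Tarski: a monotone self-map of an interval fixes the supremum of `{s | s ≤ f s}`, so
    -- continuity of the return map is not needed.
    set E : Set ℝ := {s | s ∈ Icc (m / 4) (4 * m) ∧ s ≤ f s} with hE
    have haE : m / 4 ∈ E := ⟨⟨le_rfl, hab⟩, (hmaps _ ⟨le_rfl, hab⟩).1⟩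
    have hbdd : BddAbove E := ⟨4 * m, fun s hs => hs.1.2⟩
    have hz : sSup E ∈ Icc (m / 4) (4 * m) :=
      ⟨le_csSup hbdd haE, csSup_le ⟨_, haE⟩ fun s hs => hs.1.2⟩
    have hle : sSup E ≤ f (sSup E) :=
      csSup_le ⟨_, haE⟩ fun s hs => hs.2.trans (hmono (le_csSup hbdd hs))
    exact ⟨sSup E, hz, le_antisymm (le_csSup hbdd ⟨hmaps _ hz, hmono hle⟩) hle⟩
  have hper : Function.Periodic (S z) (2 * Real.pi) := by
    have hshift : ∀ θ, HasDerivAt (fun θ => S z (θ + 2 * Real.pi))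
        (P.slope α θ (S z (θ + 2 * Real.pi))) θ := fun θ => by
      have := (hS z (θ + 2 * Real.pi)).comp_add_const θ (2 * Real.pi)
      rwa [P.slope_periodic] at this
    have heq := solution_eq_of_eq hlip hshift (hS z) (t₀ := 0) (by
      rw [zero_add, hS0]; exact hfz)
    exact fun θ => congrFun heq θ
  refine ⟨S z, hS z, hper, fun θ => ?_⟩
  -- Invariance holds only for `θ ≥ 0`; negative angles are moved there by whole turns.
  obtain ⟨n, hn⟩ := exists_nat_ge (-θ / (2 * Real.pi))
  rw [div_le_iff₀ Real.two_pi_pos] at hn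
  rw [← (hper.nat_mul n) θ]
  exact (hinv z hz _ (by linarith)).1

end Scale

end Supercritical

end PolarForm

end BoundaryHopf

/-! ### Uniqueness and stability of the cycle for `η < 0` -/

namespace BoundaryHopf

/-- The value of a `2π`-periodic function at the polar angle of a point. -/
theorem continuousAt_periodic_arg {f : ℝ → ℝ} (hf : Continuous f)
    (hp : Function.Periodic f (2 * Real.pi)) {z : ℂ} (hz : z ≠ 0) :
    ContinuousAt (fun z : ℂ => f z.arg) z := by
  -- `Complex.arg` jumps across the negative axis, but its class modulo `2π` is continuous away from
  -- `0`, and `f` depends only on that class.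
  have hlift : Continuous (hp.lift : Real.Angle → ℝ) := continuous_quot_lift _ hf
  exact ContinuousAt.comp (g := (hp.lift : Real.Angle → ℝ)) hlift.continuousAt
    (Complex.continuousAt_arg_coe_angle hz)

/-- The closed curve with polar equation `r = R θ`. -/
def polarCurve (R : ℝ → ℝ) : Set (ℝ × ℝ) :=
  range fun θ => (R θ * Real.cos θ, R θ * Real.sin θ)

theorem isCompact_polarCurve {R : ℝ → ℝ} (hR : Continuous R)
    (hp : Function.Periodic R (2 * Real.pi)) : IsCompact (polarCurve R) := by
  refine Function.Periodic.compact_of_continuous (c := 2 * Real.pi) (fun θ => ?_)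
    Real.two_pi_pos.ne' (by fun_prop)
  simp only [hp θ, Real.cos_add_two_pi, Real.sin_add_two_pi]

/-- A neighbourhood of a closed curve with positive polar equation, in polar coordinates. -/
theorem exists_polar_nhds {R : ℝ → ℝ} (hR : Continuous R) (hpos : ∀ θ, 0 < R θ)
    (hp : Function.Periodic R (2 * Real.pi)) {δ : ℝ} (hδ : 0 < δ) :
    ∃ W, IsOpen W ∧ polarCurve R ⊆ W ∧ ∀ p ∈ W, ∃ r θ : ℝ, 0 < r ∧ |r - R θ| < δ ∧
      p = (r * Real.cos θ, r * Real.sin θ) := by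
  set W : Set ℂ := {z | z ≠ 0 ∧ |‖z‖ - R z.arg| < δ} with hW
  have hWo : IsOpen W := by
    have hc : ContinuousOn (fun z : ℂ => |‖z‖ - R z.arg|) {0}ᶜ := fun z hz =>
      ((continuous_norm.continuousAt.sub (continuousAt_periodic_arg hR hp hz)).abs).continuousWithinAt
    have := hc.isOpen_inter_preimage isOpen_compl_singleton (isOpen_Iio (a := δ))
    exact this
  refine ⟨(fun p : ℝ × ℝ => Complex.equivRealProdCLM.symm p) ⁻¹' W,
    hWo.preimage Complex.equivRealProdCLM.symm.continuous, ?_, fun p hp' => ?_⟩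
  · rintro _ ⟨θ, rfl⟩
    have hz : Complex.equivRealProdCLM.symm (R θ * Real.cos θ, R θ * Real.sin θ) =
        R θ * (Complex.cos θ + Complex.sin θ * Complex.I) := by
      apply Complex.ext <;> simp [Complex.cos_ofReal_re, Complex.sin_ofReal_re]
    have hn : ‖(R θ * (Complex.cos θ + Complex.sin θ * Complex.I) : ℂ)‖ = R θ := by
      rw [norm_mul, Complex.norm_cos_add_sin_mul_I, mul_one, Complex.norm_real, Real.norm_eq_abs,
        abs_of_pos (hpos θ)]
    have harg : R (R θ * (Complex.cos θ + Complex.sin θ * Complex.I) : ℂ).arg = R θ := by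
      have h1 := Complex.arg_mul_cos_add_sin_mul_I_coe_angle (hpos θ) (θ : Real.Angle)
      rw [Real.Angle.cos_coe, Real.Angle.sin_coe, Complex.ofReal_cos, Complex.ofReal_sin,
        Real.Angle.angle_eq_iff_two_pi_dvd_sub] at h1
      obtain ⟨k, hk⟩ := h1
      have := hp.int_mul k θ
      refine Eq.trans ?_ this
      congr 1
      linarith
    show Complex.equivRealProdCLM.symm (R θ * Real.cos θ, R θ * Real.sin θ) ∈ W
    rw [hz]
    refine ⟨?_, by rw [hn, harg]; simpa using hδ⟩
    rw [← norm_pos_iff, hn]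
    exact hpos θ
  · obtain ⟨h1, h2⟩ := hp'
    refine ⟨_, _, norm_pos_iff.2 h1, h2, Prod.ext ?_ ?_⟩
    · rw [Complex.norm_mul_cos_arg]; simp
    · rw [Complex.norm_mul_sin_arg]; simp

namespace PolarForm

variable {X : ℝ → ℝ × ℝ → ℝ × ℝ} {η : ℝ} {P : PolarForm X η} {α m : ℝ} {R : ℝ → ℝ}

/-- A periodic orbit near the origin avoids the origin. -/
theorem periodicOrbit_ne_zero (P : PolarForm X η) {γ : ℝ → ℝ × ℝ} {T : ℝ}
    (hγ : IsIntegralCurve γ fun _ => X α) (hT : 0 < T) (hp : Function.Periodic γ T)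
    (hne : ∃ t, γ t ≠ γ 0) (hρ : ∀ t, (γ t).1 ^ 2 + (γ t).2 ^ 2 ≤ P.ρ ^ 2) (t : ℝ) :
    0 < (γ t).1 ^ 2 + (γ t).2 ^ 2 := by
  have hnn : ∀ t, 0 ≤ (γ t).1 ^ 2 + (γ t).2 ^ 2 := fun t => by positivity
  by_contra! hle
  have h0 : (γ t).1 ^ 2 + (γ t).2 ^ 2 = 0 := le_antisymm hle (hnn t)
  have hγ₁ : ∀ s, HasDerivAt (fun s => (γ s).1) (X α (γ s)).1 s := fun s => (hγ s).fst
  have hγ₂ : ∀ s, HasDerivAt (fun s => (γ s).2) (X α (γ s)).2 s := fun s => (hγ s).snd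
  have hd : ∀ s, HasDerivAt (fun s => (γ s).1 ^ 2 + (γ s).2 ^ 2)
      (2 * (γ s).1 * (X α (γ s)).1 + 2 * (γ s).2 * (X α (γ s)).2) s := fun s =>
    ((hγ₁ s).pow 2 |>.add ((hγ₂ s).pow 2)).congr_deriv (by norm_num)
  -- The squared norm grows at most exponentially, so once it vanishes it vanishes at all later
  -- times, and by periodicity at all times. This replaces uniqueness for the planar equation.
  have hbound : ∀ s, 2 * (γ s).1 * (X α (γ s)).1 + 2 * (γ s).2 * (X α (γ s)).2 ≤
      -(-(2 * (|α| + 1))) * ((γ s).1 ^ 2 + (γ s).2 ^ 2) := by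
    intro s
    obtain ⟨r, θ, hr, hγs⟩ := exists_polar (γ s)
    have hr2 := hρ s
    rw [hγs] at hr2 ⊢
    rw [polar_sq] at hr2
    have hmem : r ∈ Icc 0 P.ρ := ⟨hr, (sq_le_sq₀ hr P.ρ_pos.le).1 hr2⟩
    rw [P.field_polar α θ r hmem, polar_sq]
    have h1 := (abs_le.1 ((P.abs_mul_A_le θ hmem).trans (P.M_mul_le hmem.2))).2
    have h2 := le_abs_self α
    have e : 2 * (r * Real.cos θ) * (r * (α + r * P.A r θ) * Real.cos θ -
        r * (1 + r * P.C r θ) * Real.sin θ) + 2 * (r * Real.sin θ) *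
        (r * (α + r * P.A r θ) * Real.sin θ + r * (1 + r * P.C r θ) * Real.cos θ) =
        2 * (α + r * P.A r θ) * r ^ 2 := by
      linear_combination 2 * (α + r * P.A r θ) * r ^ 2 * Real.sin_sq_add_cos_sq θ
    simp only [e]
    rw [neg_neg]
    exact mul_le_mul_of_nonneg_right (by linarith) (sq_nonneg r)
  have hzero : ∀ s, t ≤ s → γ s = 0 := by
    intro s hs
    have h1 := le_exp_mul_of_deriv_le (fun s _ => hd s) (fun s _ => hbound s) s hs
    rw [h0, zero_mul] at h1
    have h2 : (γ s).1 = 0 := by nlinarith [sq_nonneg (γ s).1, sq_nonneg (γ s).2]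
    have h3 : (γ s).2 = 0 := by nlinarith [sq_nonneg (γ s).1, sq_nonneg (γ s).2]
    exact Prod.ext h2 h3
  have hall : ∀ s, γ s = 0 := by
    intro s
    obtain ⟨n, hn⟩ := exists_nat_ge ((t - s) / T)
    rw [div_le_iff₀ hT] at hn
    rw [← (hp.nat_mul n) s]
    exact hzero _ (by linarith)
  obtain ⟨s, hs⟩ := hne
  exact hs (by rw [hall, hall])

/-- Polar coordinates along a periodic orbit near the origin. -/
theorem exists_polar_of_periodicOrbit (P : PolarForm X η) {Γ : Set (ℝ × ℝ)}
    (hΓ : IsPeriodicOrbit (X α) Γ) (hsub : Γ ⊆ {p | p.1 ^ 2 + p.2 ^ 2 < P.ρ ^ 2}) :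
    ∃ (r θ : ℝ → ℝ) (T : ℝ), 0 < T ∧ (∀ t, r t ∈ Ioc 0 P.ρ) ∧
      (∀ t, HasDerivAt r (r t * (α + r t * P.A (r t) (θ t))) t) ∧
      (∀ t, HasDerivAt θ (1 + r t * P.C (r t) (θ t)) t) ∧
      (∀ t, r (t + T) = r t) ∧ (∀ t, ∃ n : ℤ, θ (t + T) = θ t + n * (2 * Real.pi)) ∧
      Γ = range fun t => (r t * Real.cos (θ t), r t * Real.sin (θ t)) := by
  obtain ⟨γ, T, hγ, hT, hp, hne, rfl⟩ := hΓ
  have hρ : ∀ t, (γ t).1 ^ 2 + (γ t).2 ^ 2 ≤ P.ρ ^ 2 := fun t => (hsub ⟨t, rfl⟩).le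
  obtain ⟨r, θ, hr, hγe, hrd, hθd⟩ :=
    P.exists_polar_of_planar hγ (P.periodicOrbit_ne_zero hγ hT hp hne hρ) hρ
  have hrT : ∀ t, r (t + T) = r t := by
    intro t
    have h1 := hp t
    rw [hγe, hγe] at h1
    obtain ⟨h3, h4⟩ := Prod.ext_iff.1 h1
    simp only at h3 h4
    have h2 := polar_sq (r (t + T)) (θ (t + T))
    rw [h3, h4, polar_sq] at h2
    exact ((sq_eq_sq₀ (hr _).1.le (hr _).1.le).1 h2).symm
  refine ⟨r, θ, T, hT, hr, hrd, hθd, hrT, fun t => ?_, by simp only [← hγe]⟩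
  have h1 := hp t
  rw [hγe, hγe, hrT] at h1
  obtain ⟨h2, h3⟩ := Prod.ext_iff.1 h1
  obtain ⟨n, hn⟩ := Real.Angle.angle_eq_iff_two_pi_dvd_sub.1 (Real.Angle.cos_sin_inj
    (mul_left_cancel₀ (hr t).1.ne' h2) (mul_left_cancel₀ (hr t).1.ne' h3))
  exact ⟨n, by linarith⟩

theorem hasDerivAt_w_time {r θ : ℝ → ℝ} {t : ℝ} (hr : r t ∈ Ioc 0 P.ρ)
    (hrd : HasDerivAt r (r t * (α + r t * P.A (r t) (θ t))) t)
    (hθd : HasDerivAt θ (1 + r t * P.C (r t) (θ t)) t) :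
    HasDerivAt (fun t => P.w (r t) (θ t)) ((1 + r t * P.C (r t) (θ t)) * P.K α (r t) (θ t)) t :=
  (P.hasDerivAt_w α 1 t r θ hr (by rwa [one_mul]) (by rwa [one_mul])).congr_deriv
    (by rw [K, one_mul])

theorem w_time_periodic {r θ : ℝ → ℝ} {T : ℝ} (hrT : ∀ t, r (t + T) = r t)
    (hθT : ∀ t, ∃ n : ℤ, θ (t + T) = θ t + n * (2 * Real.pi)) :
    Function.Periodic (fun t => P.w (r t) (θ t)) T := fun t => by
  obtain ⟨n, hn⟩ := hθT t
  simp only [hrT, hn]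
  exact (P.w_periodic (r t)).int_mul n (θ t)

/-- If `η < 0`, then there are no periodic orbits near the origin for `α ≤ 0`. -/
theorem not_isPeriodicOrbit (P : PolarForm X η) (hη : η < 0) (hα : α ≤ 0) {Γ : Set (ℝ × ℝ)}
    (hsub : Γ ⊆ {p | p.1 ^ 2 + p.2 ^ 2 < P.ρ ^ 2}) : ¬ IsPeriodicOrbit (X α) Γ := by
  intro hΓ
  obtain ⟨r, θ, T, hT, hr, hrd, hθd, hrT, hθT, -⟩ := P.exists_polar_of_periodicOrbit hΓ hsub
  have hneg : ∀ t, (1 + r t * P.C (r t) (θ t)) * P.K α (r t) (θ t) < 0 := fun t =>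
    mul_neg_of_pos_of_neg (by linarith [P.angular_ge (θ t) (Ioc_subset_Icc_self (hr t))])
      (P.K_neg_of_nonpos hη hα (θ t) (hr t))
  have := deriv_eq_zero_of_periodic_of_nonpos hT
    (fun t => hasDerivAt_w_time (hr t) (hrd t) (hθd t)) (w_time_periodic hrT hθT)
    (fun t => (hneg t).le) 0
  exact (hneg 0).ne this

namespace Scale

/-- A periodic orbit near the origin lies where the limit cycle must be. -/
theorem mem_of_periodic (h : Scale P α m) {r θ : ℝ → ℝ} {T : ℝ} (hT : 0 < T)
    (hr : ∀ t, r t ∈ Ioc 0 P.ρ)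
    (hrd : ∀ t, HasDerivAt r (r t * (α + r t * P.A (r t) (θ t))) t)
    (hθd : ∀ t, HasDerivAt θ (1 + r t * P.C (r t) (θ t)) t)
    (hp : Function.Periodic (fun t => P.w (r t) (θ t)) T) (t : ℝ) :
    r t ∈ Icc (m / 32) (32 * m) := by
  have hm := h.m_pos
  have hm2 := pow_pos hm 2
  have hd := fun t => hasDerivAt_w_time (hr t) (hrd t) (hθd t)
  have hc : Continuous fun t => P.w (r t) (θ t) :=
    continuous_iff_continuousAt.2 fun t => (hd t).continuousAt
  have hK : ∀ s, (1 + r s * P.C (r s) (θ s)) * P.K α (r s) (θ s) = 0 → P.K α (r s) (θ s) = 0 :=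
    fun s hs => (mul_eq_zero.1 hs).resolve_left
      (by linarith [P.angular_ge (θ s) (Ioc_subset_Icc_self (hr s))])
  -- At the maximum and the minimum of `w` on the orbit `K` vanishes, which bounds the radius there;
  -- the level of `w` carries the bounds to all other points.
  have hcomp := hp.compact_of_continuous hT.ne' hc
  obtain ⟨_, ⟨s₁, rfl⟩, hmax⟩ := hcomp.exists_isGreatest (range_nonempty _)
  obtain ⟨_, ⟨s₂, rfl⟩, hmin⟩ := hcomp.exists_isLeast (range_nonempty _)
  have hle : ∀ t, P.w (r t) (θ t) ≤ P.w (r s₁) (θ s₁) := fun t => hmax ⟨t, rfl⟩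
  have hge : ∀ t, P.w (r s₂) (θ s₂) ≤ P.w (r t) (θ t) := fun t => hmin ⟨t, rfl⟩
  have h1 := hK s₁ (IsLocalMax.hasDerivAt_eq_zero (Eventually.of_forall hle) (hd s₁))
  have h2 := hK s₂ (IsLocalMin.hasDerivAt_eq_zero (Eventually.of_forall hge) (hd s₂))
  have h3 : r s₁ ^ 2 ≤ 2 * m ^ 2 := by
    by_contra! hlt
    exact (h.K_neg (θ s₁) (hr s₁) hlt.le).ne h1
  have h4 : m ^ 2 / 2 ≤ r s₂ ^ 2 := by
    by_contra! hlt
    exact (h.K_pos (θ s₂) (hr s₂) hlt.le).ne' h2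
  have h5 := Real.exp_le_exp.2 (hle t)
  have h6 := Real.exp_le_exp.2 (hge t)
  have h7 := (P.exp_w_bounds (θ s₁) (hr s₁)).2
  have h8 := (P.exp_w_bounds (θ s₂) (hr s₂)).1
  have h9 := P.exp_w_bounds (θ t) (hr t)
  have := h.mem_of_sq (a := 1 / 32) (b := 32) (hr t).1 (by norm_num) (by norm_num) (by nlinarith)
      (by nlinarith)
  exact ⟨by linarith [this.1], this.2⟩

theorem radius_mem (h : Scale P α m) (hmem : ∀ θ, R θ ∈ Icc (m / 8) (8 * m)) (θ : ℝ) :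
    R θ ∈ Icc (m / 32) (32 * m) :=
  ⟨by linarith [(hmem θ).1, h.m_pos], by linarith [(hmem θ).2, h.m_pos]⟩

theorem isPeriodicOrbit_polarCurve (h : Scale P α m)
    (hR : ∀ θ, HasDerivAt R (P.slope α θ (R θ)) θ)
    (hp : Function.Periodic R (2 * Real.pi)) (hmem : ∀ θ, R θ ∈ Icc (m / 8) (8 * m)) :
    IsPeriodicOrbit (X α) (polarCurve R) := by
  have hmem' := fun θ => h.mem_of_mem (h.radius_mem hmem θ)
  obtain ⟨Θ, hΘ0, hΘ, hγ⟩ := exists_planar_of_angular hR 0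
  have hge := fun t => half_le_speed (P := P) (R := R) (Θ t)
  have hsurj := surjective_of_deriv_ge (by norm_num) hΘ hge
  have hmono := strictMono_of_deriv_ge (by norm_num) hΘ hge
  obtain ⟨T, hT⟩ := hsurj (2 * Real.pi)
  have hTpos : 0 < T := by
    rw [← hmono.lt_iff_lt, hΘ0, hT]
    exact Real.two_pi_pos
  have hsp := speed_periodic (P := P) hp
  -- The speed is periodic in the angle, so the angle restarted after one turn solves the same
  -- initial value problem.
  have hshift : (fun t => Θ (t + T) - 2 * Real.pi) = Θ := by
    refine solution_autonomous_unique (continuous_speed (P := P) (continuous_angular hR))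
      (fun θ => by linarith [half_le_speed (P := P) (R := R) θ]) (fun t => ?_) hΘ
      (by simp [hT, hΘ0])
    have := ((hΘ (t + T)).comp_add_const t T).sub_const (2 * Real.pi)
    rwa [← hsp.sub_eq] at this
  have hΘT : ∀ t, Θ (t + T) = Θ t + 2 * Real.pi := fun t => by
    have := congrFun hshift t
    linarith
  refine ⟨fun t => (R (Θ t) * Real.cos (Θ t), R (Θ t) * Real.sin (Θ t)), T,
    fun t => hγ t (Ioc_subset_Icc_self (hmem' _)), hTpos, fun t => ?_, ?_, ?_⟩
  · simp only [hΘT, hp (Θ t), Real.cos_add_two_pi, Real.sin_add_two_pi]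
  · obtain ⟨t, ht⟩ := hsurj Real.pi
    refine ⟨t, fun heq => ?_⟩
    have := (Prod.ext_iff.1 heq).1
    simp only [ht, hΘ0, Real.cos_pi, Real.cos_zero] at this
    linarith [(hmem' Real.pi).1, (hmem' 0).1]
  · exact (hsurj.range_comp fun θ => (R θ * Real.cos θ, R θ * Real.sin θ)).symm

/-- Contraction makes the squared difference of `w` decay exponentially, and `w_sub_bounds` converts
this to radii. Only the upper comparison, used at `θ₀`, costs a factor: `3 / r ≤ 96 / m`. -/
theorem dist_angular_le (h : Scale P α m) (hR : ∀ θ, HasDerivAt R (P.slope α θ (R θ)) θ)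
    (hmem : ∀ θ, R θ ∈ Icc (m / 8) (8 * m)) {S : ℝ → ℝ} {θ₀ : ℝ}
    (hS : ∀ θ, HasDerivAt S (P.slope α θ (S θ)) θ) (h0 : S θ₀ ∈ Icc (m / 11) (11 * m)) (θ : ℝ)
    (hθ : θ₀ ≤ θ) : |S θ - R θ| ^ 2 ≤ (96 / m * |S θ₀ - R θ₀|) ^ 2 *
      Real.exp (-(2 * (-η * m ^ 2 / 3072)) * (θ - θ₀)) := by
  have hm := h.m_pos
  have hSz := h.stays_in_zone hS h0
  have hRz := h.radius_mem hmem
  have habs : ∀ θ, θ₀ ≤ θ → |S θ - R θ| ≤ |P.w (S θ) θ - P.w (R θ) θ| ∧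
      |P.w (S θ) θ - P.w (R θ) θ| ≤ 96 / m * |S θ - R θ| := by
    intro θ hθ
    have key : ∀ r ∈ Icc (m / 32) (32 * m), ∀ s ∈ Icc (m / 32) (32 * m), r ≤ s →
        |s - r| ≤ |P.w s θ - P.w r θ| ∧ |P.w s θ - P.w r θ| ≤ 96 / m * |s - r| := by
      intro r hr s hs hrs
      obtain ⟨h1, h2⟩ := P.w_sub_bounds θ (h.mem_of_mem hr) (h.mem_of_mem hs) hrs
      have hd := sub_nonneg.2 hrs
      have h4 : 3 / r ≤ 96 / m := by
        rw [div_le_div_iff₀ (h.mem_of_mem hr).1 hm]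
        linarith [hr.1]
      rw [abs_of_nonneg hd, abs_of_nonneg (hd.trans h1)]
      exact ⟨h1, h2.trans (mul_le_mul_of_nonneg_right h4 hd)⟩
    rcases le_total (R θ) (S θ) with hle | hle
    · exact key _ (hRz θ) _ (hSz θ hθ) hle
    · have := key _ (hSz θ hθ) _ (hRz θ) hle
      rwa [abs_sub_comm (R θ), abs_sub_comm (P.w (R θ) θ)] at this
  have hd : ∀ θ, θ₀ ≤ θ → HasDerivAt (fun θ => (P.w (S θ) θ - P.w (R θ) θ) ^ 2)
      (2 * ((P.w (S θ) θ - P.w (R θ) θ) * (P.K α (S θ) θ - P.K α (R θ) θ))) θ := fun θ hθ =>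
    (((hasDerivAt_w_angular hS (h.mem_of_mem (hSz θ hθ))).sub
      (hasDerivAt_w_angular hR (h.mem_of_mem (hRz θ)))).pow 2).congr_deriv (by
        simp only [Pi.sub_apply]; push_cast; ring)
  have hexp := le_exp_mul_of_deriv_le (κ := 2 * (-η * m ^ 2 / 3072)) hd (fun θ hθ => by
    have := h.contraction θ (hRz θ) (hSz θ hθ)
    linarith) θ hθ
  calc |S θ - R θ| ^ 2 ≤ |P.w (S θ) θ - P.w (R θ) θ| ^ 2 :=
        pow_le_pow_left₀ (abs_nonneg _) (habs θ hθ).1 2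
    _ = (P.w (S θ) θ - P.w (R θ) θ) ^ 2 := sq_abs _
    _ ≤ (P.w (S θ₀) θ₀ - P.w (R θ₀) θ₀) ^ 2 *
        Real.exp (-(2 * (-η * m ^ 2 / 3072)) * (θ - θ₀)) := hexp
    _ ≤ _ := by
        refine mul_le_mul_of_nonneg_right ?_ (Real.exp_pos _).le
        rw [← sq_abs]
        exact pow_le_pow_left₀ (abs_nonneg _) (habs θ₀ le_rfl).2 2

theorem asymptoticallyStable_polarCurve (h : Scale P α m)
    (hR : ∀ θ, HasDerivAt R (P.slope α θ (R θ)) θ)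
    (hp : Function.Periodic R (2 * Real.pi)) (hmem : ∀ θ, R θ ∈ Icc (m / 8) (8 * m)) :
    AsymptoticallyStable (X α) (polarCurve R) := by
  intro U hU hΓU
  have hm := h.m_pos
  have hRc := continuous_angular hR
  obtain ⟨ε, hε, hεU⟩ := (isCompact_polarCurve hRc hp).exists_thickening_subset_open hU hΓU
  have hmem' := fun θ => h.mem_of_mem (h.radius_mem hmem θ)
  -- `m / 100` keeps the initial radius in `[m / 11, 11 m]`, because the cycle lies in `[m / 8, 8
  -- m]`; `m / 96 * ε` compensates the factor `96 / m` in `dist_angular_le`.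
  set δ := min (m / 100) (m / 96 * ε) with hδ
  have hδpos : 0 < δ := by positivity
  obtain ⟨W, hWo, hWsub, hW⟩ := exists_polar_nhds hRc (fun θ => (hmem' θ).1) hp hδpos
  refine ⟨W, hWo, hWsub, fun p hpW => ?_⟩
  obtain ⟨r, θ₀, hr, hrδ, rfl⟩ := hW p hpW
  obtain ⟨S, hS0, hS⟩ := P.exists_angular_solution α θ₀ r
  have hr1 : |r - R θ₀| < m / 100 := hrδ.trans_le (min_le_left _ _)
  have hr2 : 96 / m * |r - R θ₀| < ε := by
    have := hrδ.trans_le (min_le_right _ _)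
    calc 96 / m * |r - R θ₀| < 96 / m * (m / 96 * ε) := by gcongr
      _ = ε := by field_simp
  have hS0mem : S θ₀ ∈ Icc (m / 11) (11 * m) := by
    have := abs_lt.1 hr1
    rw [hS0]
    constructor <;> linarith [(hmem θ₀).1, (hmem θ₀).2]
  have hdist := h.dist_angular_le hR hmem hS hS0mem
  have hSz := h.stays_in_zone hS hS0mem
  have hrate := h.rate_pos
  rw [hS0] at hdist
  obtain ⟨Θ, hΘ0, hΘ, hγ⟩ := exists_planar_of_angular hS θ₀
  have hge := fun t => half_le_speed (P := P) (R := S) (Θ t)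
  have hmono := strictMono_of_deriv_ge (by norm_num) hΘ hge
  have htop := tendsto_atTop_of_deriv_ge (by norm_num) hΘ hge
  have hΘge : ∀ t, 0 ≤ t → θ₀ ≤ Θ t := fun t ht => hΘ0 ▸ hmono.monotone ht
  refine ⟨fun t => (S (Θ t) * Real.cos (Θ t), S (Θ t) * Real.sin (Θ t)), by simp [hΘ0, hS0],
    fun t ht => (hγ t (Ioc_subset_Icc_self
      (h.mem_of_mem (hSz _ (hΘge t ht))))).hasDerivWithinAt, fun t ht => hεU ?_, ?_⟩
  · rw [Metric.mem_thickening_iff]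
    refine ⟨_, ⟨Θ t, rfl⟩, (dist_polar_le _ _ _).trans_lt ?_⟩
    have h1 := hdist (Θ t) (hΘge t ht)
    have h2 : Real.exp (-(2 * (-η * m ^ 2 / 3072)) * (Θ t - θ₀)) ≤ 1 :=
      Real.exp_le_one_iff.2 (by nlinarith [hΘge t ht])
    have h3 : |S (Θ t) - R (Θ t)| ^ 2 ≤ (96 / m * |r - R θ₀|) ^ 2 :=
      h1.trans (mul_le_of_le_one_right (sq_nonneg _) h2)
    exact ((sq_le_sq₀ (abs_nonneg _) (by positivity)).1 h3).trans_lt hr2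
  · have hlim : Tendsto (fun t => (96 / m * |r - R θ₀|) ^ 2 *
        Real.exp (-(2 * (-η * m ^ 2 / 3072)) * (Θ t - θ₀))) atTop (𝓝 0) := by
      have hl := (tendsto_const_nhds (x := (96 / m * |r - R θ₀|) ^ 2)).mul
        (Real.tendsto_exp_atBot.comp ((tendsto_atTop_add_const_right _ (-θ₀)
          htop).const_mul_atTop_of_neg (neg_lt_zero.2 (mul_pos two_pos hrate))))
      rw [mul_zero] at hl
      exact hl
    have hsqrt := hlim.sqrt
    rw [Real.sqrt_zero] at hsqrt
    refine squeeze_zero' (Eventually.of_forall fun t => Metric.infDist_nonneg) ?_ hsqrt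
    filter_upwards [eventually_ge_atTop (0 : ℝ)] with t ht
    have hΓ : (R (Θ t) * Real.cos (Θ t), R (Θ t) * Real.sin (Θ t)) ∈ polarCurve R := ⟨Θ t, rfl⟩
    refine (Metric.infDist_le_dist_of_mem hΓ).trans ((dist_polar_le _ _ _).trans ?_)
    exact Real.le_sqrt_of_sq_le (hdist (Θ t) (hΘge t ht))

/-- The limit cycle is the only periodic orbit near the origin. -/
theorem eq_polarCurve_of_isPeriodicOrbit (h : Scale P α m)
    (hR : ∀ θ, HasDerivAt R (P.slope α θ (R θ)) θ)
    (hp : Function.Periodic R (2 * Real.pi)) (hmem : ∀ θ, R θ ∈ Icc (m / 8) (8 * m))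
    {Γ : Set (ℝ × ℝ)} (hsub : Γ ⊆ {p | p.1 ^ 2 + p.2 ^ 2 < P.ρ ^ 2})
    (hΓ : IsPeriodicOrbit (X α) Γ) : Γ = polarCurve R := by
  obtain ⟨r, θ, T, hT, hr, hrd, hθd, hrT, hθT, rfl⟩ := P.exists_polar_of_periodicOrbit hΓ hsub
  have hωpos : ∀ t, 1 / 2 ≤ 1 + r t * P.C (r t) (θ t) := fun t => by
    linarith [P.angular_ge (θ t) (Ioc_subset_Icc_self (hr t))]
  have hwp := w_time_periodic (P := P) hrT hθT
  have hrz := h.mem_of_periodic hT hr hrd hθd hwp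
  have hRz := h.radius_mem hmem
  have hRp : ∀ t, R (θ (t + T)) = R (θ t) := fun t => by
    obtain ⟨n, hn⟩ := hθT t
    rw [hn]
    exact hp.int_mul n (θ t)
  have hRwp := w_time_periodic (P := P) (r := fun t => R (θ t)) hRp hθT
  -- The orbit is compared with the cycle at the same angle. The squared difference of `w` is
  -- periodic in time and nonincreasing, so its derivative vanishes, and contraction then forces the
  -- difference itself to vanish.
  have hd : ∀ t, HasDerivAt (fun t => (P.w (r t) (θ t) - P.w (R (θ t)) (θ t)) ^ 2)
      (2 * (1 + r t * P.C (r t) (θ t)) * ((P.w (r t) (θ t) - P.w (R (θ t)) (θ t)) *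
        (P.K α (r t) (θ t) - P.K α (R (θ t)) (θ t)))) t := fun t =>
    (((hasDerivAt_w_time (hr t) (hrd t) (hθd t)).sub
      ((hasDerivAt_w_angular hR (h.mem_of_mem (hRz (θ t)))).comp t (hθd t))).pow 2).congr_deriv (by
        simp only [Pi.sub_apply, Function.comp]; push_cast; ring)
  have hcontr := fun t => h.contraction (θ t) (hRz (θ t)) (hrz t)
  have hrate := h.rate_pos
  have hzero := deriv_eq_zero_of_periodic_of_nonpos hT hd
    (fun t => by
      have h1 := hwp t
      have h2 := hRwp t
      simp only at h1 h2 ⊢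
      rw [h1, h2]) (fun t => by
      have h1 := hcontr t
      have h2 := hωpos t
      have h3 : (P.w (r t) (θ t) - P.w (R (θ t)) (θ t)) *
        (P.K α (r t) (θ t) - P.K α (R (θ t)) (θ t)) ≤ 0 := h1.trans
          (mul_nonpos_of_nonpos_of_nonneg (by linarith) (sq_nonneg _))
      exact mul_nonpos_of_nonneg_of_nonpos (by linarith) h3)
  have heq : ∀ t, r t = R (θ t) := by
    intro t
    have h1 := (mul_eq_zero.1 (hzero t)).resolve_left (by linarith [hωpos t])
    have h2 := hcontr t
    rw [h1] at h2
    have h3 : (P.w (r t) (θ t) - P.w (R (θ t)) (θ t)) ^ 2 = 0 :=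
      le_antisymm (by nlinarith) (sq_nonneg _)
    have h4 : P.w (r t) (θ t) = P.w (R (θ t)) (θ t) := sub_eq_zero.1 (pow_eq_zero_iff two_ne_zero |>.1 h3)
    exact le_antisymm (P.le_of_w_le (hr t) (h.mem_of_mem (hRz _)) h4.le)
      (P.le_of_w_le (h.mem_of_mem (hRz _)) (hr t) h4.ge)
  simp only [heq]
  exact (surjective_of_deriv_ge (by norm_num) hθd hωpos).range_comp
    fun θ => (R θ * Real.cos θ, R θ * Real.sin θ)

theorem exists_limitCycle (h : Scale P α m) :
    ∃ Γ : Set (ℝ × ℝ), (∀ p ∈ Γ, p.1 ^ 2 + p.2 ^ 2 ≤ (8 * m) ^ 2) ∧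
      IsStableLimitCycle (X α) Γ ∧ ∀ Γ' ⊆ {p : ℝ × ℝ | p.1 ^ 2 + p.2 ^ 2 < P.ρ ^ 2},
        IsPeriodicOrbit (X α) Γ' → Γ' = Γ := by
  obtain ⟨R, hR, hp, hmem⟩ := h.exists_periodic_angular
  refine ⟨polarCurve R, ?_, ⟨h.isPeriodicOrbit_polarCurve hR hp hmem,
    h.asymptoticallyStable_polarCurve hR hp hmem⟩,
    fun Γ' hsub hΓ' => h.eq_polarCurve_of_isPeriodicOrbit hR hp hmem hsub hΓ'⟩
  rintro _ ⟨θ, rfl⟩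
  rw [polar_sq]
  exact pow_le_pow_left₀ (h.mem_of_mem (h.radius_mem hmem θ)).1.le (hmem θ).2 2

end Scale

/-- If `η < 0`, then a unique stable limit cycle bifurcates from the origin. -/
theorem uniqueCycleBifurcates (P : PolarForm X η) (hη : η < 0) :
    UniqueCycleBifurcates X (Ioi 0) IsStableLimitCycle := by
  have hρ := P.ρ_pos
  -- `μ α` is the radius `m` at which `2 α + η m²` vanishes, and the `ε` below is the parameter at
  -- which it reaches `ρ / 10000`.
  set μ : ℝ → ℝ := fun α => Real.sqrt (2 * α / -η) with hμ
  set ε : ℝ := -η * (P.ρ / 10000) ^ 2 / 2 with hε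
  have hεpos : 0 < ε := by
    have : 0 < -η := by linarith
    positivity
  have hscale : ∀ α ∈ Ioo (-ε) ε, α ∈ Ioi (0 : ℝ) → P.Scale α (μ α) := by
    intro α hα hα0
    have hpos : 0 < 2 * α / -η := div_pos (by linarith [mem_Ioi.1 hα0]) (by linarith)
    refine ⟨hη, Real.sqrt_pos.2 hpos, ?_, ?_⟩
    · rw [hμ]
      simp only
      rw [Real.sq_sqrt hpos.le]
      field_simp [hη.ne]
    · have : μ α ≤ P.ρ / 10000 := by
        refine Real.sqrt_le_iff.2 ⟨by positivity, ?_⟩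
        rw [div_le_iff₀ (by linarith)]
        have := hα.2
        rw [hε] at this
        linarith
      linarith
  have hex : ∀ α, ∃ Γ : Set (ℝ × ℝ), α ∈ Ioo (-ε) ε → α ∈ Ioi (0 : ℝ) →
      (∀ p ∈ Γ, p.1 ^ 2 + p.2 ^ 2 ≤ (8 * μ α) ^ 2) ∧
      IsStableLimitCycle (X α) Γ ∧ ∀ Γ' ⊆ {p : ℝ × ℝ | p.1 ^ 2 + p.2 ^ 2 < P.ρ ^ 2},
        IsPeriodicOrbit (X α) Γ' → Γ' = Γ := by
    intro α
    by_cases hα : α ∈ Ioo (-ε) ε ∧ α ∈ Ioi (0 : ℝ)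
    · obtain ⟨Γ, hΓ⟩ := (hscale α hα.1 hα.2).exists_limitCycle
      exact ⟨Γ, fun _ _ => hΓ⟩
    · exact ⟨∅, fun h1 h2 => absurd ⟨h1, h2⟩ hα⟩
  choose Γ hΓ using hex
  refine ⟨ε, {p | p.1 ^ 2 + p.2 ^ 2 < P.ρ ^ 2}, Γ, hεpos, isOpen_sq_lt _, ?_, ?_, ?_, ?_⟩
  · simpa using pow_pos hρ 2
  · intro α hα hα0
    obtain ⟨h1, h2, h3⟩ := hΓ α hα hα0
    have hs := hscale α hα hα0
    refine ⟨fun p hp => (h1 p hp).trans_lt ?_, h2, h3⟩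
    exact pow_lt_pow_left₀ (by linarith [hs.m_le, hs.m_pos]) (by linarith [hs.m_pos]) two_ne_zero
  · intro α _ hα0 Γ' hsub
    exact P.not_isPeriodicOrbit hη (not_lt.1 hα0) hsub
  · intro W hW
    obtain ⟨δ, hδ, hsub⟩ := exists_disc_subset hW
    have hlim : Tendsto (fun α => 8 * μ α) (𝓝[>] 0) (𝓝 0) := by
      have hc : Continuous fun α => 8 * μ α := by
        simp only [hμ]
        fun_prop
      have := (hc.tendsto 0).mono_left (nhdsWithin_le_nhds (s := Ioi 0))
      simpa [hμ] using this
    filter_upwards [hlim.eventually (gt_mem_nhds hδ), self_mem_nhdsWithin,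
      Ioo_mem_nhdsGT hεpos] with α h1 h2 h3
    have hα : α ∈ Ioo (-ε) ε := ⟨by linarith [h3.1], h3.2⟩
    have hs := hscale α hα h2
    exact fun p hp => hsub p (((hΓ α hα h2).1 p hp).trans
      (pow_le_pow_left₀ (by linarith [hs.m_pos]) h1.le 2))

end PolarForm

end BoundaryHopf

/-! ### Time reversal: reduction of `η > 0` to `η < 0` -/

namespace BoundaryHopf

/-- The reflection in the `x`-axis. -/
def flip (p : ℝ × ℝ) : ℝ × ℝ := (p.1, -p.2)

@[simp] theorem flip_flip (p : ℝ × ℝ) : flip (flip p) = p := by simp [flip]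

theorem continuous_flip : Continuous flip := by unfold flip; fun_prop

theorem isometry_flip : Isometry flip := Isometry.of_dist_eq fun p q => by
  simp [flip, Prod.dist_eq, dist_neg_neg]

theorem flip_zero : flip 0 = 0 := by simp [flip]

@[simp] theorem image_flip_image_flip (s : Set (ℝ × ℝ)) : flip '' (flip '' s) = s := by
  simp [image_image]

/-- The family that arises from the symmetry `(x, y, t, α) ↦ (x, -y, -t, -α)`. -/
def reverse (X : ℝ → ℝ × ℝ → ℝ × ℝ) (α : ℝ) (p : ℝ × ℝ) : ℝ × ℝ := -flip (X (-α) (flip p))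

theorem hasDerivAt_flip_comp {γ : ℝ → ℝ × ℝ} {v : ℝ × ℝ} {s : Set ℝ} {t : ℝ}
    (h : HasDerivWithinAt γ v s t) : HasDerivWithinAt (fun t => flip (γ t)) (flip v) s t := by
  have h1 : HasDerivWithinAt (fun t => (γ t).1) v.1 s t := h.fst
  have h2 : HasDerivWithinAt (fun t => -(γ t).2) (-v.2) s t :=
    HasDerivWithinAt.neg (f := fun t => (γ t).2) h.snd
  exact h1.prodMk h2

theorem flip_neg (p : ℝ × ℝ) : flip (-p) = -flip p := by simp [flip]

variable {X : ℝ → ℝ × ℝ → ℝ × ℝ} {α : ℝ}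

theorem reverse_reverse : reverse (reverse X) = X := by
  funext α p
  simp [reverse, flip_neg]

/-- The reflection conjugates `reverse X (-α)` to `-X α` and preserves distances to sets. -/
theorem asymptoticallyStable_of_reverse {K : Set (ℝ × ℝ)}
    (h : AsymptoticallyStable (reverse X (-α)) K) :
    AsymptoticallyStable (fun p => -X α p) (flip '' K) := by
  intro U hU hKU
  obtain ⟨W, hW, hKW, hγ⟩ := h (flip ⁻¹' U) (hU.preimage continuous_flip)
    (image_subset_iff.1 hKU)
  refine ⟨flip ⁻¹' W, hW.preimage continuous_flip, ?_, fun p hp => ?_⟩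
  · rw [image_subset_iff]
    intro p hp
    simpa using hKW hp
  · obtain ⟨γ, h0, h1, h2, h3⟩ := hγ (flip p) hp
    refine ⟨fun t => flip (γ t), by simp [h0], fun t ht => ?_, fun t ht => h2 t ht, ?_⟩
    · have := hasDerivAt_flip_comp (h1 t ht)
      simpa [reverse, flip_neg] using this
    · simpa only [Metric.infDist_image isometry_flip] using h3

theorem isPeriodicOrbit_flip {Γ : Set (ℝ × ℝ)} (h : IsPeriodicOrbit (X α) Γ) :
    IsPeriodicOrbit (reverse X (-α)) (flip '' Γ) := by
  obtain ⟨γ, T, h1, hT, hp, ⟨t, ht⟩, rfl⟩ := h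
  refine ⟨fun t => flip (γ (-t)), T, fun t => ?_, hT, fun t => ?_, ⟨-t, fun h => ht ?_⟩, ?_⟩
  · have h2 := hasDerivAt_flip_comp ((h1 (-t)).hasDerivWithinAt (s := univ))
    rw [hasDerivWithinAt_univ] at h2
    have h3 := h2.scomp t (hasDerivAt_neg t)
    simpa [reverse, Function.comp_def] using h3
  · simp only
    rw [← hp (-(t + T))]
    congr 2
    ring
  · simpa using congrArg flip h
  · rw [← range_comp]
    exact ((Equiv.neg ℝ).surjective.range_comp (flip ∘ γ)).symm

theorem isPeriodicOrbit_of_reverse {Γ : Set (ℝ × ℝ)} (h : IsPeriodicOrbit (reverse X (-α)) Γ) :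
    IsPeriodicOrbit (X α) (flip '' Γ) := by
  have := isPeriodicOrbit_flip h
  rwa [reverse_reverse, neg_neg] at this

theorem UniqueCycleBifurcates.of_reverse
    (h : UniqueCycleBifurcates (reverse X) (Ioi 0) IsStableLimitCycle) :
    UniqueCycleBifurcates X (Iio 0) IsUnstableLimitCycle := by
  obtain ⟨ε, U, Γ, hε, hU, h0, h1, h2, h3⟩ := h
  have hmem : ∀ α ∈ Ioo (-ε) ε, -α ∈ Ioo (-ε) ε := fun α hα => ⟨by linarith [hα.2], by linarith [hα.1]⟩
  have himg : ∀ {Γ' : Set (ℝ × ℝ)}, Γ' ⊆ flip ⁻¹' U → flip '' Γ' ⊆ U := fun h =>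
    image_subset_iff.2 h
  refine ⟨ε, flip ⁻¹' U, fun α => flip '' Γ (-α), hε, hU.preimage continuous_flip,
    by simpa [flip_zero] using h0, fun α hα hα0 => ?_, fun α hα hα0 Γ' hΓ' hper => ?_,
    fun W hW => ?_⟩
  · obtain ⟨h4, ⟨h5, h6⟩, h7⟩ := h1 (-α) (hmem α hα) (mem_Ioi.2 (neg_pos.2 (mem_Iio.1 hα0)))
    refine ⟨?_, ⟨isPeriodicOrbit_of_reverse h5, asymptoticallyStable_of_reverse h6⟩,
      fun Γ' hΓ' hper => ?_⟩
    · rw [image_subset_iff]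
      intro p hp
      simpa using h4 hp
    · change Γ' = flip '' Γ (-α)
      rw [← h7 _ (himg hΓ') (isPeriodicOrbit_flip hper), image_flip_image_flip]
  · exact h2 (-α) (hmem α hα) (fun h => hα0 (mem_Iio.2 (neg_pos.1 (mem_Ioi.1 h)))) _ (himg hΓ') (isPeriodicOrbit_flip hper)
  · have hW' : flip ⁻¹' W ∈ 𝓝 (0 : ℝ × ℝ) :=
      continuous_flip.continuousAt.preimage_mem_nhds (by rwa [flip_zero])
    have htend : Tendsto (fun α : ℝ => -α) (𝓝[<] 0) (𝓝[>] 0) := by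
      simpa using tendsto_neg_nhdsLT (a := (0 : ℝ))
    filter_upwards [htend.eventually (h3 _ hW')] with α hα
    exact image_subset_iff.2 hα

/-- The polar normal form of the reversed family. -/
def PolarForm.reverse {η : ℝ} (P : PolarForm X η) : PolarForm (reverse X) (-η) where
  ρ := P.ρ
  M := P.M
  A r θ := -P.A r (-θ)
  C r θ := P.C r (-θ)
  q r θ := P.q r (-θ)
  K₁ r θ := P.K₁ r (-θ)
  K₂ r θ := -P.K₂ r (-θ)
  ρ_pos := P.ρ_pos
  one_le_M := P.one_le_M
  M_mul_ρ_le := P.M_mul_ρ_le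
  M_mul_ρ_le_η := by rw [abs_neg]; exact P.M_mul_ρ_le_η
  continuous_field α :=
    (continuous_flip.comp ((P.continuous_field (-α)).comp continuous_flip)).neg
  field_polar α θ r hr := by
    have h1 : flip (r * Real.cos θ, r * Real.sin θ) =
        (r * Real.cos (-θ), r * Real.sin (-θ)) := by simp [flip]
    rw [BoundaryHopf.reverse, h1, P.field_polar _ _ r hr]
    simp only [flip, Real.cos_neg, Real.sin_neg, Prod.neg_mk, Prod.mk.injEq]
    constructor <;> ring
  tame_A := ⟨P.tame_A.nonneg, fun r hr => ((P.tame_A.continuous r hr).comp continuous_neg).neg,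
    fun r hr θ => by rw [abs_neg]; exact P.tame_A.bound r hr _,
    fun r hr r' hr' θ => by
      rw [neg_sub_neg, abs_sub_comm]; exact P.tame_A.lipschitz r hr r' hr' _,
    fun r hr θ => by
      rw [neg_add, ← sub_eq_add_neg, (P.tame_A.periodic r hr).sub_eq]⟩
  tame_C := ⟨P.tame_C.nonneg, fun r hr => (P.tame_C.continuous r hr).comp continuous_neg,
    fun r hr θ => P.tame_C.bound r hr _,
    fun r hr r' hr' θ => P.tame_C.lipschitz r hr r' hr' _,
    fun r hr θ => by
      rw [neg_add, ← sub_eq_add_neg, (P.tame_C.periodic r hr).sub_eq]⟩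
  half_le_q θ r hr := P.half_le_q _ r hr
  q_le_two θ r hr := P.q_le_two _ r hr
  log_q_lipschitz θ r hr r' hr' := P.log_q_lipschitz _ r hr r' hr'
  continuous_q := P.continuous_q.comp (continuous_fst.prodMk continuous_snd.neg)
  q_periodic r θ := by
    change P.q r (-(θ + 2 * Real.pi)) = P.q r (-θ)
    rw [neg_add, ← sub_eq_add_neg, (P.q_periodic r).sub_eq]
  -- The reversal of time is absorbed by the free time factor: `k` becomes `-k` along with `α ↦ -α`
  -- and `θ ↦ -θ`.
  hasDerivAt_w α k t r θ hr hrd hθd :=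
    (P.hasDerivAt_w (-α) (-k) t r (fun t => -θ t) hr (hrd.congr_deriv (by ring))
      (hθd.neg.congr_deriv (by ring))).congr_deriv (by ring)
  K₁_near θ r hr := P.K₁_near _ r hr
  K₁_lipschitz θ r hr r' hr' := P.K₁_lipschitz _ r hr r' hr'
  K₂_near θ r hr := by
    rw [neg_mul, neg_sub_neg, abs_sub_comm]; exact P.K₂_near _ r hr
  K₂_lipschitz θ R hR r hr r' hr' := by
    have := P.K₂_lipschitz (-θ) R hR r hr r' hr'
    rw [← abs_neg] at this
    refine le_trans (le_of_eq ?_) this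
    congr 1
    ring

namespace PolarForm

theorem losesStability {η : ℝ} (P : PolarForm X η) : LosesStability X := by
  refine ⟨?_, ?_⟩
  · filter_upwards [self_mem_nhdsWithin] with α hα
    exact P.asymptoticallyStable_origin hα
  · filter_upwards [self_mem_nhdsWithin] with α hα
    have := asymptoticallyStable_of_reverse
      (P.reverse.asymptoticallyStable_origin (neg_lt_zero.2 (mem_Ioi.1 hα)))
    rwa [image_singleton, flip_zero] at this

theorem supercriticalHopf {η : ℝ} (P : PolarForm X η) (hη : η < 0) : SupercriticalHopf X :=
  ⟨⟨6 * Real.pi * η, mul_neg_of_pos_of_neg (by positivity) hη, P.isLiapunovNumber⟩,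
    P.losesStability, P.uniqueCycleBifurcates hη⟩

theorem subcriticalHopf {η : ℝ} (P : PolarForm X η) (hη : 0 < η) : SubcriticalHopf X :=
  ⟨⟨6 * Real.pi * η, by positivity, P.isLiapunovNumber⟩, P.losesStability,
    (P.reverse.uniqueCycleBifurcates (neg_lt_zero.2 hη)).of_reverse⟩

end PolarForm

end BoundaryHopf

/-! ### Construction of the polar normal form from the 3-jet -/

namespace BoundaryHopf

theorem Tame.of_periodic {u : ℝ → ℝ} (ρ : ℝ) (hu : Continuous u)
    (hp : Function.Periodic u (2 * Real.pi)) : Tame ρ fun _ θ => u θ := by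
  obtain ⟨M, hM⟩ := (hp.isBounded_of_continuous Real.two_pi_pos.ne' hu).exists_norm_le
  exact Tame.angular ρ hu hp fun θ => hM _ ⟨θ, rfl⟩

theorem abs_log_sub_log_le {a b : ℝ} (ha : 1 / 2 ≤ a) (hb : 1 / 2 ≤ b) :
    |Real.log a - Real.log b| ≤ 2 * |a - b| := by
  have key : ∀ a b : ℝ, 1 / 2 ≤ a → 1 / 2 ≤ b → Real.log a - Real.log b ≤ 2 * |a - b| := by
    intro a b ha hb
    have hb0 : 0 < b := by linarith
    have ha0 : 0 < a := by linarith
    rw [← Real.log_div ha0.ne' hb0.ne']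
    refine (Real.log_le_sub_one_of_pos (div_pos ha0 hb0)).trans ?_
    rw [show a / b - 1 = (a - b) / b by field_simp, div_le_iff₀ hb0]
    nlinarith [le_abs_self (a - b), abs_nonneg (a - b)]
  rw [abs_le]
  have h1 := key a b ha hb
  have h2 := key b a hb ha
  rw [abs_sub_comm] at h2
  constructor <;> linarith

/-- The coefficients of the terms of degree at most three of the nonlinear part
`(a₂₁ x² y + a₀₃ y³, p x y + q y² + b₂₁ x² y + b₁₂ x y² + b₀₃ y³)`. -/
structure Jet where
  (p q a₂₁ a₀₃ b₂₁ b₁₂ b₀₃ : ℝ)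

namespace Jet

variable (j : Jet)

/-- The first focal quantity. -/
noncomputable def η : ℝ := (j.b₂₁ + 3 * j.b₀₃ - j.p * j.q) / 4

/-- The planar family with given terms of degree at most three and given remainders. -/
def field (f g : ℝ × ℝ → ℝ) (α : ℝ) (z : ℝ × ℝ) : ℝ × ℝ :=
  (α * z.1 - z.2 + (j.a₂₁ * z.1 ^ 2 * z.2 + j.a₀₃ * z.2 ^ 3 + f z),
    z.1 + α * z.2 + (j.p * z.1 * z.2 + j.q * z.2 ^ 2 + j.b₂₁ * z.1 ^ 2 * z.2 +
      j.b₁₂ * z.1 * z.2 ^ 2 + j.b₀₃ * z.2 ^ 3 + g z))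

noncomputable def A₀ (θ : ℝ) : ℝ := Real.sin θ ^ 2 * (j.p * Real.cos θ + j.q * Real.sin θ)

noncomputable def A₁ (θ : ℝ) : ℝ :=
  j.a₂₁ * Real.cos θ ^ 3 * Real.sin θ + (j.a₀₃ + j.b₁₂) * Real.cos θ * Real.sin θ ^ 3 +
    j.b₂₁ * Real.cos θ ^ 2 * Real.sin θ ^ 2 + j.b₀₃ * Real.sin θ ^ 4

noncomputable def C₀ (θ : ℝ) : ℝ :=
  Real.cos θ * Real.sin θ * (j.p * Real.cos θ + j.q * Real.sin θ)

noncomputable def C₁ (θ : ℝ) : ℝ :=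
  Real.cos θ * (j.b₂₁ * Real.cos θ ^ 2 * Real.sin θ + j.b₁₂ * Real.cos θ * Real.sin θ ^ 2 +
    j.b₀₃ * Real.sin θ ^ 3) -
  Real.sin θ * (j.a₂₁ * Real.cos θ ^ 2 * Real.sin θ + j.a₀₃ * Real.sin θ ^ 3)

/-- The periodic antiderivative of `-2 A₀`, chosen to remove the term of order `r` from `dw/dθ` at
`α = 0`. It exists because `A₀` has mean zero. -/
noncomputable def u (θ : ℝ) : ℝ :=
  -(2 / 3) * j.p * Real.sin θ ^ 3 + j.q * (2 * Real.cos θ - 2 / 3 * Real.cos θ ^ 3)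

noncomputable def v (θ : ℝ) : ℝ :=
  j.a₂₁ / 2 * Real.cos θ ^ 4 - (j.a₀₃ + j.b₁₂) / 2 * Real.sin θ ^ 4 +
    j.b₂₁ / 4 * (Real.sin θ * Real.cos θ * (Real.cos θ ^ 2 - Real.sin θ ^ 2)) +
    j.b₀₃ * (Real.sin θ ^ 3 * Real.cos θ / 2 + 3 / 4 * (Real.sin θ * Real.cos θ)) +
    (j.p ^ 2 / 2 - j.q ^ 2) * Real.sin θ ^ 4 +
    j.p * j.q * (-(3 / 2) * (Real.sin θ ^ 3 * Real.cos θ) - Real.sin θ * Real.cos θ / 4)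

noncomputable def u' (θ : ℝ) : ℝ := -2 * j.A₀ θ

/-- Fixed by requiring the coefficient of `r⁴` in the derivative of `V` to be the constant `η`. The
value of `η` is the only one for which the antiderivative `v` is periodic. -/
noncomputable def v' (θ : ℝ) : ℝ :=
  j.η - 2 * j.A₁ θ - 3 * j.u θ * j.A₀ θ + 2 * j.A₀ θ * j.C₀ θ

theorem hasDerivAt_u (θ : ℝ) : HasDerivAt j.u (j.u' θ) θ := by
  have hs := Real.hasDerivAt_sin θ
  have hc := Real.hasDerivAt_cos θ
  have h := ((hs.pow 3).const_mul (-(2 / 3) * j.p)).add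
    (((hc.const_mul 2).sub ((hc.pow 3).const_mul (2 / 3))).const_mul j.q)
  refine h.congr_deriv ?_
  simp only [u', A₀]
  have h1 := Real.sin_sq_add_cos_sq θ
  push_cast
  linear_combination (2 * j.q * Real.sin θ) * h1

theorem hasDerivAt_v (θ : ℝ) : HasDerivAt j.v (j.v' θ) θ := by
  have hs := Real.hasDerivAt_sin θ
  have hc := Real.hasDerivAt_cos θ
  have h := ((((((hc.pow 4).const_mul (j.a₂₁ / 2)).sub
    ((hs.pow 4).const_mul ((j.a₀₃ + j.b₁₂) / 2))).add
    (((hs.mul hc).mul ((hc.pow 2).sub (hs.pow 2))).const_mul (j.b₂₁ / 4))).add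
    (((((hs.pow 3).mul hc).div_const 2).add ((hs.mul hc).const_mul (3 / 4))).const_mul j.b₀₃)).add
    ((hs.pow 4).const_mul (j.p ^ 2 / 2 - j.q ^ 2))).add
    (((((hs.pow 3).mul hc).const_mul (-(3 / 2))).sub ((hs.mul hc).div_const 4)).const_mul
      (j.p * j.q))
  refine h.congr_deriv ?_
  have h1 := Real.sin_sq_add_cos_sq θ
  simp only [v', η, A₀, A₁, C₀, u, Pi.mul_apply, Pi.pow_apply, Pi.sub_apply]
  generalize Real.sin θ = s at *
  generalize Real.cos θ = c at *
  obtain ⟨p, q, a₂₁, a₀₃, b₂₁, b₁₂, b₀₃⟩ := j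
  push_cast
  grind

end Jet

end BoundaryHopf

namespace BoundaryHopf

namespace Jet

variable (j : Jet)

theorem tame_A₀ (ρ : ℝ) : Tame ρ fun _ θ => j.A₀ θ :=
  Tame.of_periodic ρ (by unfold A₀; fun_prop) fun θ => by simp [A₀]

theorem tame_A₁ (ρ : ℝ) : Tame ρ fun _ θ => j.A₁ θ :=
  Tame.of_periodic ρ (by unfold A₁; fun_prop) fun θ => by simp [A₁]

theorem tame_C₀ (ρ : ℝ) : Tame ρ fun _ θ => j.C₀ θ :=
  Tame.of_periodic ρ (by unfold C₀; fun_prop) fun θ => by simp [C₀]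

theorem tame_C₁ (ρ : ℝ) : Tame ρ fun _ θ => j.C₁ θ :=
  Tame.of_periodic ρ (by unfold C₁; fun_prop) fun θ => by simp [C₁]

theorem continuous_u : Continuous j.u := by unfold u; fun_prop

theorem continuous_v : Continuous j.v := by unfold v; fun_prop

theorem tame_u (ρ : ℝ) : Tame ρ fun _ θ => j.u θ :=
  Tame.of_periodic ρ j.continuous_u fun θ => by simp [u]

theorem tame_v (ρ : ℝ) : Tame ρ fun _ θ => j.v θ :=
  Tame.of_periodic ρ j.continuous_v fun θ => by simp [v]

theorem tame_u' (ρ : ℝ) : Tame ρ fun _ θ => j.u' θ := (j.tame_A₀ ρ).const_mul (-2)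

theorem tame_v' (ρ : ℝ) : Tame ρ fun _ θ => j.v' θ :=
  ((((Tame.const ρ j.η).sub ((j.tame_A₁ ρ).const_mul 2)).sub
    (((j.tame_u ρ).const_mul 3).mul (j.tame_A₀ ρ))).add
    (((j.tame_A₀ ρ).const_mul 2).mul (j.tame_C₀ ρ)))

section

variable (F G : ℝ → ℝ → ℝ)

noncomputable def A₂ (r θ : ℝ) : ℝ := Real.cos θ * F r θ + Real.sin θ * G r θ

noncomputable def C₂ (r θ : ℝ) : ℝ := Real.cos θ * G r θ - Real.sin θ * F r θ

noncomputable def A (r θ : ℝ) : ℝ := j.A₀ θ + r * (j.A₁ θ + r * A₂ F G r θ)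

noncomputable def C (r θ : ℝ) : ℝ := j.C₀ θ + r * (j.C₁ θ + r * C₂ F G r θ)

/-- Not a derivative, in contrast to `u'` and `v'`: the normal form takes `q = 1 + r q'`. -/
noncomputable def q' (r θ : ℝ) : ℝ := j.u θ + r * j.v θ

/-- The function with `q (1 + r C) = 1 + r Z`. -/
noncomputable def Z (r θ : ℝ) : ℝ := j.q' r θ + j.C F G r θ + r * (j.q' r θ * j.C F G r θ)

noncomputable def E (r θ : ℝ) : ℝ :=
  2 * A₂ F G r θ + 3 * j.u θ * (j.A₁ θ + r * A₂ F G r θ) + 4 * j.v θ * j.A F G r θ +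
    j.u' θ * (j.C₁ θ + r * C₂ F G r θ) + j.v' θ * j.C F G r θ

noncomputable def k₁ (r θ : ℝ) : ℝ :=
  (3 * j.u θ + r * (4 * j.v θ) - 2 * j.Z F G r θ) * (1 + r * j.Z F G r θ)⁻¹

noncomputable def k₂ (r θ : ℝ) : ℝ :=
  (j.E F G r θ - j.η * j.Z F G r θ) * (1 + r * j.Z F G r θ)⁻¹

theorem one_add_mul_Z (r θ : ℝ) :
    1 + r * j.Z F G r θ = (1 + r * j.q' r θ) * (1 + r * j.C F G r θ) := by
  rw [Z]; ring

/-- The right-hand side is the time derivative of `V` at `α = 0`, divided by `r²`. Its order `r`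
part cancels by the choice of `u'`, its order `r²` part is `η` by the choice of `v'`, and `E`
collects the remainder. -/
theorem η_add_mul_E (r θ : ℝ) :
    j.η * r ^ 2 + r ^ 3 * j.E F G r θ =
      (2 + 3 * r * j.u θ + 4 * r ^ 2 * j.v θ) * (r * j.A F G r θ) +
        (r * j.u' θ + r ^ 2 * j.v' θ) * (1 + r * j.C F G r θ) := by
  simp only [E, A, C, u', v']
  ring

end

variable {j}

/-- This is `V' / V`, with `V = r² q`, divided by the angular speed. Both quotients have denominator
`q (1 + r C) = 1 + r Z`; subtracting their leading terms `2` and `η r²` leaves factors `r` and `r³`,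
whose cofactors are `k₁` and `k₂`. -/
theorem hasDerivAt_polar_w {F G : ℝ → ℝ → ℝ} {α k t : ℝ} {r θ : ℝ → ℝ} (hr : 0 < r t)
    (hq : 0 < 1 + r t * j.q' (r t) (θ t)) (hC : 0 < 1 + r t * j.C F G (r t) (θ t))
    (hrd : HasDerivAt r (k * (r t * (α + r t * j.A F G (r t) (θ t)))) t)
    (hθd : HasDerivAt θ (k * (1 + r t * j.C F G (r t) (θ t))) t) :
    HasDerivAt (fun s => 2 * Real.log (r s) + Real.log (1 + r s * j.q' (r s) (θ s)))
      (k * (1 + r t * j.C F G (r t) (θ t)) *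
        (α * (2 + r t * j.k₁ F G (r t) (θ t)) +
          (j.η * (r t) ^ 2 + (r t) ^ 3 * j.k₂ F G (r t) (θ t)))) t := by
  have hu := (j.hasDerivAt_u (θ t)).comp t hθd
  have hv := (j.hasDerivAt_v (θ t)).comp t hθd
  have hqd : HasDerivAt (fun s => 1 + r s * j.q' (r s) (θ s))
      (k * (r t * (α + r t * j.A F G (r t) (θ t))) * (j.u (θ t) + 2 * r t * j.v (θ t)) +
        k * (1 + r t * j.C F G (r t) (θ t)) * (r t * j.u' (θ t) + r t ^ 2 * j.v' (θ t))) t :=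
    ((hrd.mul (hu.add (hrd.mul hv))).const_add 1).congr_deriv (by
      simp only [Pi.add_apply, Pi.mul_apply, Function.comp]; ring)
  have h := ((hrd.log hr.ne').const_mul 2).add (hqd.log hq.ne')
  refine h.congr_deriv ?_
  have hZ := j.one_add_mul_Z F G (r t) (θ t)
  have hE := j.η_add_mul_E F G (r t) (θ t)
  have hZ0 : (1 + r t * j.q' (r t) (θ t)) * (1 + r t * j.C F G (r t) (θ t)) ≠ 0 :=
    (mul_pos hq hC).ne'
  have hq' : j.q' (r t) (θ t) = j.u (θ t) + r t * j.v (θ t) := rfl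
  rw [← hZ] at hZ0
  have e1 : 2 + r t * j.k₁ F G (r t) (θ t) =
      (2 + 3 * r t * j.u (θ t) + 4 * r t ^ 2 * j.v (θ t)) / (1 + r t * j.Z F G (r t) (θ t)) := by
    rw [k₁]
    field_simp
    ring
  have e2 : j.η * (r t) ^ 2 + (r t) ^ 3 * j.k₂ F G (r t) (θ t) =
      (j.η * r t ^ 2 + r t ^ 3 * j.E F G (r t) (θ t)) / (1 + r t * j.Z F G (r t) (θ t)) := by
    rw [k₂]
    field_simp
    ring
  rw [e1, e2, hE, hZ]
  generalize j.A F G (r t) (θ t) = A at *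
  have hr' := hr.ne'
  have hC' := hC.ne'
  have hq0 := hq.ne'
  generalize j.C F G (r t) (θ t) = C at *
  rw [hq'] at hq0 ⊢
  generalize j.u (θ t) = u at *
  generalize j.v (θ t) = v at *
  generalize r t = ρ at *
  field_simp
  ring

section Tameness

variable {F G : ℝ → ℝ → ℝ} {ρ : ℝ}

theorem tame_A₂ (hF : Tame ρ F) (hG : Tame ρ G) : Tame ρ (A₂ F G) :=
  ((Tame.cos ρ).mul hF).add ((Tame.sin ρ).mul hG)

theorem tame_C₂ (hF : Tame ρ F) (hG : Tame ρ G) : Tame ρ (C₂ F G) :=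
  ((Tame.cos ρ).mul hG).sub ((Tame.sin ρ).mul hF)

theorem tame_A (hF : Tame ρ F) (hG : Tame ρ G) : Tame ρ (j.A F G) :=
  (j.tame_A₀ ρ).add ((Tame.radius ρ).mul
    ((j.tame_A₁ ρ).add ((Tame.radius ρ).mul (tame_A₂ hF hG))))

theorem tame_C (hF : Tame ρ F) (hG : Tame ρ G) : Tame ρ (j.C F G) :=
  (j.tame_C₀ ρ).add ((Tame.radius ρ).mul
    ((j.tame_C₁ ρ).add ((Tame.radius ρ).mul (tame_C₂ hF hG))))

theorem tame_q' : Tame ρ j.q' := (j.tame_u ρ).add ((Tame.radius ρ).mul (j.tame_v ρ))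

theorem tame_Z (hF : Tame ρ F) (hG : Tame ρ G) : Tame ρ (j.Z F G) :=
  (tame_q'.add (tame_C hF hG)).add ((Tame.radius ρ).mul (tame_q'.mul (tame_C hF hG)))

theorem tame_E (hF : Tame ρ F) (hG : Tame ρ G) : Tame ρ (j.E F G) :=
  ((((((tame_A₂ hF hG).const_mul 2).add (((j.tame_u ρ).const_mul 3).mul
    ((j.tame_A₁ ρ).add ((Tame.radius ρ).mul (tame_A₂ hF hG))))).add
    (((j.tame_v ρ).const_mul 4).mul (tame_A hF hG))).add
    ((j.tame_u' ρ).mul ((j.tame_C₁ ρ).add ((Tame.radius ρ).mul (tame_C₂ hF hG))))).add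
    ((j.tame_v' ρ).mul (tame_C hF hG)))

theorem tame_k₁ (hF : Tame ρ F) (hG : Tame ρ G)
    (hZ : ∀ r ∈ Icc 0 ρ, ∀ θ, 1 / 2 ≤ 1 + r * j.Z F G r θ) : Tame ρ (j.k₁ F G) :=
  ((((j.tame_u ρ).const_mul 3).add ((Tame.radius ρ).mul ((j.tame_v ρ).const_mul 4))).sub
    ((tame_Z hF hG).const_mul 2)).mul
    (((Tame.const ρ 1).add ((Tame.radius ρ).mul (tame_Z hF hG))).inv hZ)

theorem tame_k₂ (hF : Tame ρ F) (hG : Tame ρ G)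
    (hZ : ∀ r ∈ Icc 0 ρ, ∀ θ, 1 / 2 ≤ 1 + r * j.Z F G r θ) : Tame ρ (j.k₂ F G) :=
  ((tame_E hF hG).sub ((tame_Z hF hG).const_mul j.η)).mul
    (((Tame.const ρ 1).add ((Tame.radius ρ).mul (tame_Z hF hG))).inv hZ)

end Tameness

theorem _root_.BoundaryHopf.Tame.exists_mul_radius_le {f : ℝ → ℝ → ℝ} (hf : Tame 1 f) :
    ∃ ρ > 0, ρ ≤ 1 ∧ ∀ r ∈ Icc 0 ρ, ∀ θ, |r * f r θ| ≤ 1 / 2 := by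
  obtain ⟨M, hM⟩ := hf
  have hM0 := hM.nonneg
  have hpos : 0 < 1 / (2 * (M + 1)) := by positivity
  refine ⟨min 1 (1 / (2 * (M + 1))), lt_min one_pos hpos, min_le_left _ _, fun r hr θ => ?_⟩
  have h1 := hM.bound r ⟨hr.1, hr.2.trans (min_le_left _ _)⟩ θ
  have h2 := hr.2.trans (min_le_right _ _)
  rw [le_div_iff₀ (by positivity)] at h2
  rw [abs_mul, abs_of_nonneg hr.1]
  have h3 : r * |f r θ| ≤ r * M := mul_le_mul_of_nonneg_left h1 hr.1
  nlinarith [hr.1]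

/-- Every family with nonvanishing first focal quantity has a polar normal form. -/
theorem nonempty_polarForm (j : Jet) (hη : j.η ≠ 0) {f g : ℝ × ℝ → ℝ} {F G : ℝ → ℝ → ℝ}
    (hf : Continuous f) (hg : Continuous g) (hF : Tame 1 F) (hG : Tame 1 G)
    (hfF : ∀ r θ, f (r * Real.cos θ, r * Real.sin θ) = r ^ 4 * F r θ)
    (hgG : ∀ r θ, g (r * Real.cos θ, r * Real.sin θ) = r ^ 4 * G r θ) :
    Nonempty (PolarForm (j.field f g) j.η) := by
  obtain ⟨ρ₁, hρ₁, hρ₁1, hZ⟩ := (tame_Z (j := j) hF hG).exists_mul_radius_le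
  obtain ⟨ρ₂, hρ₂, hρ₂1, hq⟩ := (tame_q' (j := j)).exists_mul_radius_le
  set ρ₀ := min ρ₁ ρ₂ with hρ₀
  have hρ₀pos : 0 < ρ₀ := lt_min hρ₁ hρ₂
  have hρ₀1 : ρ₀ ≤ 1 := (min_le_left _ _).trans hρ₁1
  have hF₀ := hF.mono hρ₀1
  have hG₀ := hG.mono hρ₀1
  have hZ₀ : ∀ r ∈ Icc 0 ρ₀, ∀ θ, 1 / 2 ≤ 1 + r * j.Z F G r θ := fun r hr θ => by
    have := abs_le.1 (hZ r ⟨hr.1, hr.2.trans (min_le_left _ _)⟩ θ)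
    linarith [this.1]
  have hq₀ : ∀ r ∈ Icc 0 ρ₀, ∀ θ, 1 / 2 ≤ 1 + r * j.q' r θ ∧ 1 + r * j.q' r θ ≤ 2 :=
    fun r hr θ => by
    have := abs_le.1 (hq r ⟨hr.1, hr.2.trans (min_le_right _ _)⟩ θ)
    constructor <;> linarith [this.1, this.2]
  obtain ⟨MA, hA⟩ := tame_A (j := j) hF₀ hG₀
  obtain ⟨MC, hC⟩ := tame_C (j := j) hF₀ hG₀
  obtain ⟨Mq, hqL⟩ := (Tame.const ρ₀ 1).add ((Tame.radius ρ₀).mul (tame_q' (j := j)))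
  obtain ⟨M₁, hk₁⟩ := tame_k₁ hF₀ hG₀ hZ₀
  obtain ⟨M₁', hk₁'⟩ := (Tame.const ρ₀ 2).add ((Tame.radius ρ₀).mul (tame_k₁ hF₀ hG₀ hZ₀))
  obtain ⟨M₂, hk₂⟩ := tame_k₂ hF₀ hG₀ hZ₀
  have := hA.nonneg
  have := hC.nonneg
  have := hqL.nonneg
  have := hk₁.nonneg
  have := hk₁'.nonneg
  have hM₂0 := hk₂.nonneg
  -- One constant for all estimates: `2 Mq` because `log` is 2-Lipschitz on `[1/2, ∞)`, and `4 M₂`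
  -- for `r³ k₂`, three parts from `r³` and one from `k₂`.
  set M := 1 + MA + MC + 2 * Mq + M₁ + M₁' + 4 * M₂ with hM
  have hMpos : 0 < M := by positivity
  have hη0 : 0 < |η j| := abs_pos.2 hη
  set ρ := min ρ₀ (min (1 / 100 / M) (|η j| / 100 / M)) with hρ
  have hρpos : 0 < ρ := by positivity
  have hρρ₀ : ρ ≤ ρ₀ := min_le_left _ _
  have hmem : ∀ {r}, r ∈ Icc 0 ρ → r ∈ Icc 0 ρ₀ := fun hr => ⟨hr.1, hr.2.trans hρρ₀⟩
  have hMρ : M * ρ ≤ 1 / 100 := by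
    have : ρ ≤ 1 / 100 / M := (min_le_right _ _).trans (min_le_left _ _)
    rw [le_div_iff₀ hMpos] at this
    linarith
  have hMρη : M * ρ ≤ |η j| / 100 := by
    have : ρ ≤ |η j| / 100 / M := (min_le_right _ _).trans (min_le_right _ _)
    rw [le_div_iff₀ hMpos] at this
    linarith
  have hCpos : ∀ r ∈ Icc 0 ρ, ∀ θ, 0 < 1 + r * j.C F G r θ := fun r hr θ => by
    have h1 := hC.bound r (hmem hr) θ
    have h2 := (abs_le.1 (h1.trans (show MC ≤ M by linarith))).1
    have h3 : M * r ≤ M * ρ := mul_le_mul_of_nonneg_left hr.2 hMpos.le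
    nlinarith [mul_le_mul_of_nonneg_left h2 hr.1]
  exact ⟨{
    ρ := ρ
    M := M
    A := j.A F G
    C := j.C F G
    q := fun r θ => 1 + r * j.q' r θ
    K₁ := fun r θ => 2 + r * j.k₁ F G r θ
    K₂ := fun r θ => j.η * r ^ 2 + r ^ 3 * j.k₂ F G r θ
    ρ_pos := hρpos
    one_le_M := by linarith
    M_mul_ρ_le := hMρ
    M_mul_ρ_le_η := hMρη
    continuous_field := fun α => by unfold Jet.field; fun_prop
    field_polar := fun α θ r _ => by
      simp only [Jet.field, hfF, hgG, A, C, A₀, A₁, A₂, C₀, C₁, C₂, Prod.mk.injEq]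
      have h := Real.sin_sq_add_cos_sq θ
      generalize Real.sin θ = s at *
      generalize Real.cos θ = c at *
      constructor
      · linear_combination (-(j.a₂₁ * r ^ 3 * c ^ 2 * s + j.a₀₃ * r ^ 3 * s ^ 3 + r ^ 4 * F r θ)) * h
      · linear_combination (-(j.p * r ^ 2 * c * s + j.q * r ^ 2 * s ^ 2 +
          j.b₂₁ * r ^ 3 * c ^ 2 * s + j.b₁₂ * r ^ 3 * c * s ^ 2 + j.b₀₃ * r ^ 3 * s ^ 3 +
          r ^ 4 * G r θ)) * h
    tame_A := hA.mono (by linarith) hρρ₀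
    tame_C := hC.mono (by linarith) hρρ₀
    half_le_q := fun θ r hr => (hq₀ r (hmem hr) θ).1
    q_le_two := fun θ r hr => (hq₀ r (hmem hr) θ).2
    log_q_lipschitz := fun θ r hr r' hr' => by
      refine (abs_log_sub_log_le (hq₀ r (hmem hr) θ).1 (hq₀ r' (hmem hr') θ).1).trans ?_
      have h1 := hqL.lipschitz r (hmem hr) r' (hmem hr') θ
      have h2 : 2 * Mq * |r - r'| ≤ M * |r - r'| :=
        mul_le_mul_of_nonneg_right (by linarith) (abs_nonneg _)
      linarith
    continuous_q := by
      have hu := j.continuous_u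
      have hv := j.continuous_v
      unfold q'
      fun_prop
    q_periodic := fun r θ => by simp [q', u, v]
    hasDerivAt_w := fun α k t r θ hr hrd hθd =>
      hasDerivAt_polar_w hr.1
        (by linarith [(hq₀ (r t) (hmem (Ioc_subset_Icc_self hr)) (θ t)).1])
        (hCpos _ (Ioc_subset_Icc_self hr) _) hrd hθd
    K₁_near := fun θ r hr => by
      rw [add_sub_cancel_left, abs_mul, abs_of_nonneg hr.1, mul_comm]
      exact mul_le_mul_of_nonneg_right ((hk₁.bound r (hmem hr) θ).trans (by linarith)) hr.1
    K₁_lipschitz := fun θ r hr r' hr' =>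
      (hk₁'.lipschitz r (hmem hr) r' (hmem hr') θ).trans
        (mul_le_mul_of_nonneg_right (by linarith) (abs_nonneg _))
    K₂_near := fun θ r hr => by
      have hr3 : 0 ≤ r ^ 3 := pow_nonneg hr.1 3
      rw [add_sub_cancel_left, abs_mul, abs_of_nonneg hr3, mul_comm]
      exact mul_le_mul_of_nonneg_right ((hk₂.bound r (hmem hr) θ).trans (by linarith)) hr3
    K₂_lipschitz := fun θ R hR r hr r' hr' => by
      have hR0 : 0 ≤ R := hr.1.trans hr.2
      have hR1 : R ≤ 1 := hR.trans (hρρ₀.trans hρ₀1)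
      have hr₀ := hmem (show r ∈ Icc 0 ρ from ⟨hr.1, hr.2.trans hR⟩)
      have hr₀' := hmem (show r' ∈ Icc 0 ρ from ⟨hr'.1, hr'.2.trans hR⟩)
      have h1 := hk₂.bound r hr₀ θ
      have h2 := hk₂.lipschitz r hr₀ r' hr₀' θ
      rw [add_sub_cancel_left, add_sub_cancel_left]
      have h3 : |r ^ 3 - r' ^ 3| ≤ 3 * R ^ 2 * |r - r'| := by
        rw [show r ^ 3 - r' ^ 3 = (r ^ 2 + r * r' + r' ^ 2) * (r - r') by ring, abs_mul]
        refine mul_le_mul_of_nonneg_right ?_ (abs_nonneg _)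
        have hr0 := hr.1
        have hr0' := hr'.1
        rw [abs_of_nonneg (by positivity)]
        have e1 := pow_le_pow_left₀ hr0 hr.2 2
        have e2 := pow_le_pow_left₀ hr0' hr'.2 2
        have e3 := mul_le_mul hr.2 hr'.2 hr0' hR0
        linarith [sq R]
      have h4 : r' ^ 3 ≤ R ^ 2 := by
        have e1 := pow_le_pow_left₀ hr'.1 hr'.2 3
        have e2 := pow_le_pow_of_le_one hR0 hR1 (show 2 ≤ 3 by norm_num)
        linarith
      have h5 : 0 ≤ r' ^ 3 := pow_nonneg hr'.1 3
      have hd := abs_nonneg (r - r')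
      calc |r ^ 3 * j.k₂ F G r θ - r' ^ 3 * j.k₂ F G r' θ|
          = |(r ^ 3 - r' ^ 3) * j.k₂ F G r θ + r' ^ 3 * (j.k₂ F G r θ - j.k₂ F G r' θ)| := by
            congr 1; ring
        _ ≤ |r ^ 3 - r' ^ 3| * |j.k₂ F G r θ| + r' ^ 3 * |j.k₂ F G r θ - j.k₂ F G r' θ| := by
            refine (abs_add_le _ _).trans (le_of_eq ?_)
            rw [abs_mul, abs_mul, abs_of_nonneg h5]
        _ ≤ (3 * R ^ 2 * |r - r'|) * M₂ + R ^ 2 * (M₂ * |r - r'|) := by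
            gcongr
        _ = 4 * M₂ * (R ^ 2 * |r - r'|) := by ring
        _ ≤ M * (R ^ 2 * |r - r'|) :=
            mul_le_mul_of_nonneg_right (by linarith) (by positivity)
        _ = M * R ^ 2 * |r - r'| := by ring }⟩

end Jet

end BoundaryHopf

/-! ### Coefficients and Taylor expansion of the boundary polynomial -/

namespace SimpleGraph

variable {V : Type*} [Fintype V] (G : SimpleGraph V)

theorem mem_setBoundary {S : Finset V} {w : V} :
    w ∈ G.setBoundary S ↔ w ∉ S ∧ ∃ v ∈ S, G.Adj v w := by
  classical
  simp [setBoundary]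

theorem setBoundary_empty : G.setBoundary ∅ = ∅ := by
  ext w
  simp [mem_setBoundary]

theorem card_setBoundary_eq_zero_iff {S : Finset V} :
    (G.setBoundary S).card = 0 ↔ ∀ v ∈ S, ∀ w, G.Adj v w → w ∈ S := by
  rw [Finset.card_eq_zero, Finset.eq_empty_iff_forall_notMem]
  simp only [mem_setBoundary]
  grind

theorem card_setBoundary_singleton [DecidableRel G.Adj] (v : V) :
    (G.setBoundary {v}).card = G.degree v := by
  rw [← G.card_neighborFinset_eq_degree]
  congr 1
  ext w
  rw [mem_setBoundary, mem_neighborFinset]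
  simp only [Finset.mem_singleton, exists_eq_left]
  exact ⟨fun h => h.2, fun h => ⟨fun e => G.loopless.irrefl v (e ▸ h), h⟩⟩

theorem boundaryCoeff_eq_zero {i j : ℕ}
    (h : ∀ S : Finset V, S.card = j → (G.setBoundary S).card ≠ i) : G.boundaryCoeff i j = 0 := by
  rw [boundaryCoeff, Finset.card_eq_zero, Finset.filter_eq_empty_iff]
  exact fun S _ hS => h S hS.2 hS.1

theorem boundaryCoeff_pos {i j : ℕ} {S : Finset V} (hj : S.card = j)
    (hi : (G.setBoundary S).card = i) : 0 < G.boundaryCoeff i j :=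
  Finset.card_pos.2 ⟨S, by simp [hi, hj]⟩

theorem boundaryCoeff_one_eq_zero [DecidableRel G.Adj] {i : ℕ} (h : ∀ v, G.degree v ≠ i) :
    G.boundaryCoeff i 1 = 0 := by
  refine G.boundaryCoeff_eq_zero fun S hS => ?_
  obtain ⟨v, rfl⟩ := Finset.card_eq_one.1 hS
  rw [card_setBoundary_singleton]
  exact h v

theorem boundaryCoeff_one_pos [DecidableRel G.Adj] {v : V} :
    0 < G.boundaryCoeff (G.degree v) 1 :=
  G.boundaryCoeff_pos (Finset.card_singleton v) (G.card_setBoundary_singleton v)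

variable {G}

/-- A nonempty proper set of vertices of a connected graph has a nonempty boundary. -/
theorem Connected.card_setBoundary_ne_zero (hG : G.Connected) {S : Finset V} (h0 : 0 < S.card)
    (h1 : S.card < Fintype.card V) : (G.setBoundary S).card ≠ 0 := by
  rw [Ne, card_setBoundary_eq_zero_iff]
  intro h
  obtain ⟨v, hv⟩ := Finset.card_pos.1 h0
  have hwalk : ∀ {a b : V}, G.Walk a b → a ∈ S → b ∈ S := by
    intro a b p
    induction p with
    | nil => exact id
    | cons hadj _ ih => exact fun ha => ih (h _ ha _ hadj)
  have huniv : S = Finset.univ := Finset.eq_univ_iff_forall.2 fun w => by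
    obtain ⟨p⟩ := hG.preconnected v w
    exact hwalk p hv
  rw [huniv, Finset.card_univ] at h1
  exact lt_irrefl _ h1

theorem Connected.boundaryCoeff_zero_eq_zero (hG : G.Connected) {j : ℕ} (h0 : 0 < j)
    (h1 : j < Fintype.card V) : G.boundaryCoeff 0 j = 0 :=
  G.boundaryCoeff_eq_zero fun _ hS => hG.card_setBoundary_ne_zero (hS ▸ h0) (hS ▸ h1)

/-- In a closed set of three vertices, a vertex of degree different from `0` and `2` is adjacent to
exactly one of the others. -/
theorem adj_xor_of_closed [DecidableRel G.Adj] {a b c : V} (hbc : b ≠ c)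
    (hcl : ∀ w, G.Adj a w → w = b ∨ w = c) (h0 : G.degree a ≠ 0) (h2 : G.degree a ≠ 2) :
    (G.Adj a b ∧ ¬ G.Adj a c) ∨ (¬ G.Adj a b ∧ G.Adj a c) := by
  classical
  by_cases hb : G.Adj a b <;> by_cases hc : G.Adj a c
  · refine absurd ?_ h2
    rw [← G.card_neighborFinset_eq_degree, show G.neighborFinset a = {b, c} from ?_,
      Finset.card_pair hbc]
    ext w
    simp only [mem_neighborFinset, Finset.mem_insert, Finset.mem_singleton]
    exact ⟨hcl w, fun h => by rcases h with rfl | rfl <;> assumption⟩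
  · exact Or.inl ⟨hb, hc⟩
  · exact Or.inr ⟨hb, hc⟩
  · refine absurd ?_ h0
    rw [← G.card_neighborFinset_eq_degree, Finset.card_eq_zero,
      Finset.eq_empty_iff_forall_notMem]
    intro w hw
    rw [mem_neighborFinset] at hw
    rcases hcl w hw with rfl | rfl <;> contradiction

/-- In a closed triple every vertex would have exactly one neighbour among the other two, and three
vertices cannot be paired off. -/
theorem boundaryCoeff_zero_three_eq_zero [DecidableRel G.Adj] (h0 : ∀ v, G.degree v ≠ 0)
    (h2 : ∀ v, G.degree v ≠ 2) : G.boundaryCoeff 0 3 = 0 := by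
  classical
  refine G.boundaryCoeff_eq_zero fun S hS hB => ?_
  rw [card_setBoundary_eq_zero_iff] at hB
  obtain ⟨a, b, c, hab, hac, hbc, rfl⟩ := Finset.card_eq_three.1 hS
  simp only [Finset.mem_insert, Finset.mem_singleton, forall_eq_or_imp, forall_eq] at hB
  obtain ⟨ha, hb, hc⟩ := hB
  have hA := adj_xor_of_closed hbc (fun w hw => (ha w hw).resolve_left fun e =>
    G.loopless.irrefl a (e ▸ hw)) (h0 a) (h2 a)
  have hB := adj_xor_of_closed hac (fun w hw => by
    rcases hb w hw with h | h | h
    · exact Or.inl h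
    · exact absurd (h ▸ hw) (G.loopless.irrefl b)
    · exact Or.inr h) (h0 b) (h2 b)
  have hC := adj_xor_of_closed hab (fun w hw => by
    rcases hc w hw with h | h | h
    · exact Or.inl h
    · exact Or.inr h
    · exact absurd (h ▸ hw) (G.loopless.irrefl c)) (h0 c) (h2 c)
  rw [G.adj_comm b a] at hB
  rw [G.adj_comm c a, G.adj_comm c b] at hC
  tauto

theorem boundaryCoeff_zero_two_pos {c : G.ConnectedComponent}
    (e : c.toSimpleGraph ≃g pathGraph 2) : 0 < G.boundaryCoeff 0 2 := by
  classical
  refine G.boundaryCoeff_pos (S := c.supp.toFinset) ?_ ?_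
  · rw [Set.toFinset_card]
    exact (Fintype.card_congr (show c.supp ≃ Fin 2 from e.toEquiv)).trans (Fintype.card_fin 2)
  · rw [card_setBoundary_eq_zero_iff]
    intro v hv w hadj
    rw [Set.mem_toFinset] at hv ⊢
    exact (c.mem_supp_congr_adj hadj).1 hv

variable (G)

/-- The terms of degree at least four of the boundary polynomial. -/
noncomputable def boundaryTail (z : ℝ × ℝ) : ℝ :=
  ∑ S : Finset V with 4 ≤ (G.setBoundary S).card + S.card,
    z.1 ^ (G.setBoundary S).card * z.2 ^ S.card

theorem continuous_boundaryTail : Continuous G.boundaryTail := by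
  unfold boundaryTail
  fun_prop

theorem sum_indicator_eq_boundaryCoeff (a b : ℕ) :
    ∑ S : Finset V, (if (G.setBoundary S).card = a ∧ S.card = b then (1 : ℝ) else 0) =
      G.boundaryCoeff a b := by
  rw [Finset.sum_boole, boundaryCoeff]

theorem boundaryCoeff_zero_zero : G.boundaryCoeff 0 0 = 1 := by
  rw [boundaryCoeff, Finset.card_eq_one]
  refine ⟨∅, ?_⟩
  ext S
  simp only [Finset.mem_filter, Finset.mem_univ, true_and, Finset.mem_singleton,
    Finset.card_eq_zero]
  exact ⟨fun h => h.2, fun h => ⟨h ▸ G.setBoundary_empty, h⟩⟩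

/-- The empty set has empty boundary, so no pure power of `x` occurs and the constant term is 1; the
remaining monomials of degree at most three are those listed. -/
theorem boundaryPoly_eq (x y : ℝ) : G.boundaryPoly x y =
    1 + G.boundaryCoeff 0 1 * y + G.boundaryCoeff 1 1 * (x * y) + G.boundaryCoeff 0 2 * y ^ 2 +
      G.boundaryCoeff 2 1 * (x ^ 2 * y) + G.boundaryCoeff 1 2 * (x * y ^ 2) +
      G.boundaryCoeff 0 3 * y ^ 3 + G.boundaryTail (x, y) := by
  have key : ∀ i j : ℕ, (j = 0 → i = 0) → x ^ i * y ^ j =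
      (if i = 0 ∧ j = 0 then 1 else 0) + (if i = 0 ∧ j = 1 then 1 else 0) * y +
      (if i = 1 ∧ j = 1 then 1 else 0) * (x * y) + (if i = 0 ∧ j = 2 then 1 else 0) * y ^ 2 +
      (if i = 2 ∧ j = 1 then 1 else 0) * (x ^ 2 * y) +
      (if i = 1 ∧ j = 2 then 1 else 0) * (x * y ^ 2) +
      (if i = 0 ∧ j = 3 then 1 else 0) * y ^ 3 + (if 4 ≤ i + j then x ^ i * y ^ j else 0) := by
    intro i j hij
    by_cases h4 : 4 ≤ i + j
    · rw [if_neg (by omega), if_neg (by omega), if_neg (by omega), if_neg (by omega),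
        if_neg (by omega), if_neg (by omega), if_neg (by omega), if_pos h4]
      ring
    · have hi : i ≤ 3 := by omega
      have hj : j ≤ 3 := by omega
      interval_cases i <;> interval_cases j <;> simp_all
  have hS : ∀ S : Finset V, S.card = 0 → (G.setBoundary S).card = 0 := fun S hS => by
    rw [Finset.card_eq_zero.1 hS, setBoundary_empty, Finset.card_empty]
  rw [boundaryPoly, Finset.sum_congr rfl fun S _ => key _ _ (hS S)]
  simp only [Finset.sum_add_distrib, ← Finset.sum_mul, sum_indicator_eq_boundaryCoeff,
    boundaryCoeff_zero_zero, Nat.cast_one]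
  rw [boundaryTail, Finset.sum_filter]

/-- The tail of the boundary polynomial in polar coordinates, divided by `r ^ 4`. -/
noncomputable def polarTail (r θ : ℝ) : ℝ :=
  ∑ S : Finset V with 4 ≤ (G.setBoundary S).card + S.card,
    r ^ ((G.setBoundary S).card + S.card - 4) *
      (Real.cos θ ^ (G.setBoundary S).card * Real.sin θ ^ S.card)

theorem tame_polarTail (ρ : ℝ) : BoundaryHopf.Tame ρ G.polarTail :=
  BoundaryHopf.Tame.sum _ fun _ _ => ((BoundaryHopf.Tame.radius ρ).pow _).mul
    (((BoundaryHopf.Tame.cos ρ).pow _).mul ((BoundaryHopf.Tame.sin ρ).pow _))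

theorem boundaryTail_polar (r θ : ℝ) :
    G.boundaryTail (r * Real.cos θ, r * Real.sin θ) = r ^ 4 * G.polarTail r θ := by
  rw [boundaryTail, polarTail, Finset.mul_sum]
  refine Finset.sum_congr rfl fun S hS => ?_
  have h4 := (Finset.mem_filter.1 hS).2
  simp only [mul_pow]
  rw [← mul_assoc (r ^ 4), ← pow_add, Nat.add_sub_cancel' h4, pow_add]
  ring

end SimpleGraph

/-! ### The corollary -/

namespace BoundaryHopf

variable {V₁ V₂ : Type*} [Fintype V₁] [Fintype V₂]

/-- The terms of degree at most three of the system. -/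
noncomputable def jet (G₁ : SimpleGraph V₁) (G₂ : SimpleGraph V₂) : Jet where
  p := G₂.boundaryCoeff 1 1
  q := G₂.boundaryCoeff 0 2
  a₂₁ := G₁.boundaryCoeff 2 1
  a₀₃ := G₁.boundaryCoeff 0 3
  b₂₁ := G₂.boundaryCoeff 2 1
  b₁₂ := G₂.boundaryCoeff 1 2
  b₀₃ := G₂.boundaryCoeff 0 3

/-- The vanishing coefficients leave a linear part `α` times the identity plus the rotation, and
bring the terms of degree two and three to the shape of a `Jet`. -/
theorem nonempty_polarForm {G₁ : SimpleGraph V₁} {G₂ : SimpleGraph V₂}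
    (h01 : G₁.boundaryCoeff 0 1 = 0) (h11 : G₁.boundaryCoeff 1 1 = 0)
    (h02 : G₁.boundaryCoeff 0 2 = 0) (h12 : G₁.boundaryCoeff 1 2 = 0)
    (h01' : G₂.boundaryCoeff 0 1 = 0) (hη : (jet G₁ G₂).η ≠ 0) :
    Nonempty (PolarForm (field G₁ G₂) (jet G₁ G₂).η) := by
  have h := (jet G₁ G₂).nonempty_polarForm hη G₁.continuous_boundaryTail
    G₂.continuous_boundaryTail (G₁.tame_polarTail 1) (G₂.tame_polarTail 1)
    G₁.boundaryTail_polar G₂.boundaryTail_polar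
  have e : (jet G₁ G₂).field G₁.boundaryTail G₂.boundaryTail = field G₁ G₂ := by
    funext α z
    rw [Jet.field, field, G₁.boundaryPoly_eq, G₂.boundaryPoly_eq, h01, h11, h02, h12, h01']
    simp only [jet, Nat.cast_zero, Prod.mk.injEq]
    constructor <;> ring
  rwa [e] at h

theorem sigmaB_eq {G₁ : SimpleGraph V₁} (G₂ : SimpleGraph V₂)
    (h02 : G₁.boundaryCoeff 0 2 = 0) (h12 : G₁.boundaryCoeff 1 2 = 0) :
    sigmaB G₁ G₂ = 6 * Real.pi * (jet G₁ G₂).η := by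
  simp only [sigmaB, h02, h12, Jet.η, jet, Nat.cast_zero]
  ring

end BoundaryHopf

theorem corollary3p10 {V₁ V₂ : Type*} [Fintype V₁] [Fintype V₂]
    (G₁ : SimpleGraph V₁) (G₂ : SimpleGraph V₂) [DecidableRel G₁.Adj] [DecidableRel G₂.Adj]
    (hcard₁ : 3 ≤ Fintype.card V₁) (hconn₁ : G₁.Connected)
    (hpend₁ : ∀ v, G₁.degree v ≠ 1)
    (hpair₁ : ∀ S : Finset V₁, S.card = 2 → (G₁.setBoundary S).card ≠ 1) :
    (3 ≤ Fintype.card V₂ → G₂.Connected → (∃ v, G₂.degree v = 2) →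
      BoundaryHopf.IsLiapunovNumber (BoundaryHopf.field G₁ G₂ 0) (BoundaryHopf.sigmaB G₁ G₂) ∧
      0 < BoundaryHopf.sigmaB G₁ G₂ ∧
      BoundaryHopf.SubcriticalHopf (BoundaryHopf.field G₁ G₂)) ∧
    ((∀ v, G₂.degree v ≠ 0) →
      (∃ c : G₂.ConnectedComponent,
        Nonempty (c.toSimpleGraph ≃g SimpleGraph.pathGraph 2)) →
      (∀ c : G₂.ConnectedComponent,
        IsEmpty (c.toSimpleGraph ≃g SimpleGraph.pathGraph 3) ∧
        IsEmpty (c.toSimpleGraph ≃g SimpleGraph.cycleGraph 3)) →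
      (∀ v, G₂.degree v ≠ 2) → (∃ v, G₂.degree v = 1) →
      BoundaryHopf.IsLiapunovNumber (BoundaryHopf.field G₁ G₂ 0) (BoundaryHopf.sigmaB G₁ G₂) ∧
      BoundaryHopf.sigmaB G₁ G₂ < 0 ∧
      BoundaryHopf.SupercriticalHopf (BoundaryHopf.field G₁ G₂)) := by
  have h01 : G₁.boundaryCoeff 0 1 = 0 := hconn₁.boundaryCoeff_zero_eq_zero one_pos (by omega)
  have h02 : G₁.boundaryCoeff 0 2 = 0 := hconn₁.boundaryCoeff_zero_eq_zero two_pos (by omega)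
  have h11 : G₁.boundaryCoeff 1 1 = 0 := G₁.boundaryCoeff_one_eq_zero hpend₁
  have h12 : G₁.boundaryCoeff 1 2 = 0 := G₁.boundaryCoeff_eq_zero hpair₁
  rw [BoundaryHopf.sigmaB_eq G₂ h02 h12]
  refine ⟨fun hcard₂ hconn₂ ⟨v, hv⟩ => ?_, fun hdeg0 ⟨c, ⟨e⟩⟩ _ hdeg2 ⟨v, hv⟩ => ?_⟩
  -- Connectedness removes the product `B₁₁ B₀₂`, and the vertex of degree 2 makes `B₂₁` positive.
  · have hη : 0 < (BoundaryHopf.jet G₁ G₂).η := by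
      have h02' : G₂.boundaryCoeff 0 2 = 0 := hconn₂.boundaryCoeff_zero_eq_zero two_pos (by omega)
      have h21 : 0 < (G₂.boundaryCoeff 2 1 : ℝ) := by
        have := G₂.boundaryCoeff_one_pos (v := v)
        rw [hv] at this
        exact_mod_cast this
      simp only [BoundaryHopf.Jet.η, BoundaryHopf.jet, h02', Nat.cast_zero]
      have : (0 : ℝ) ≤ G₂.boundaryCoeff 0 3 := Nat.cast_nonneg _
      linarith
    obtain ⟨P⟩ := BoundaryHopf.nonempty_polarForm h01 h11 h02 h12
      (hconn₂.boundaryCoeff_zero_eq_zero one_pos (by omega)) hη.ne'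
    exact ⟨P.isLiapunovNumber, by positivity, P.subcriticalHopf hη⟩
  -- Only the negative product `-B₁₁ B₀₂` survives; it is nonzero thanks to the leaf and the
  -- component `P₂`.
  · have hη : (BoundaryHopf.jet G₁ G₂).η < 0 := by
      have h02' : 0 < (G₂.boundaryCoeff 0 2 : ℝ) := by
        exact_mod_cast SimpleGraph.boundaryCoeff_zero_two_pos e
      have h11' : 0 < (G₂.boundaryCoeff 1 1 : ℝ) := by
        have := G₂.boundaryCoeff_one_pos (v := v)
        rw [hv] at this
        exact_mod_cast this
      simp only [BoundaryHopf.Jet.η, BoundaryHopf.jet, G₂.boundaryCoeff_one_eq_zero hdeg2,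
        SimpleGraph.boundaryCoeff_zero_three_eq_zero hdeg0 hdeg2, Nat.cast_zero]
      have := mul_pos h11' h02'
      linarith
    obtain ⟨P⟩ := BoundaryHopf.nonempty_polarForm h01 h11 h02 h12
      (G₂.boundaryCoeff_one_eq_zero hdeg0) hη.ne
    exact ⟨P.isLiapunovNumber, mul_neg_of_pos_of_neg (by positivity) hη, P.supercriticalHopf hη⟩
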